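/- Let $L,\rho_1,\rho_2,\kappa,b>0$ and $\tau,\sigma\in[0,1]$. On the complex space $L^2(0,L)$ let $A=-\partial_x^2$ with $D(A)=H^2(0,L)\cap H^1_0(0,L)$, and let $A^\theta$ be its (spectral) fractional powers, so that $D(A^{1/2})=H^1_0(0,L)$. Let $\mathcal H=[H^1_0(0,L)\times L^2(0,L)]^2$ be the Hilbert space of all $U=(u,w,\psi,v)$ with the inner product $$\langle U,U^*\rangle_{\mathcal H}=\rho_1\langle w,w^*\rangle+\rho_2\langle v,v^*\rangle+\kappa\langle u_x+\psi,u^*_x+\psi^*\rangle+b\langle\psi_x,\psi^*_x\rangle,$$ and let $$\mathcal B U=\Big(w,\ \tfrac1{\rho_1}[\kappa(u_x+\psi)_x-A^\tau w],\ v,\ \tfrac1{\rho_2}[-bA\psi-\kappa(u_x+\psi)-A^\sigma v]\Big)$$ on $D(\mathcal B)=D(A)\times(D(A^{1/2})\cap D(A^\tau))\times D(A)\times(D(A^{1/2})\cap D(A^\sigma))$. Then: (i) $\mathcal B$ is densely defined, dissipative and closable; its closure $\overline{\mathcal B}$ has $0$ in its resolvent set and generates a $C_0$-semigroup of contractions $S(t)$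 on $\mathcal H$. If $\tau,\sigma\le\frac12$, then $\overline{\mathcal B}=\mathcal B$, so that $\mathcal B$ itself has these properties. (ii) For every $U_0\in\mathcal H$ the problem $U'=\mathcal B U$, $U(0)=U_0$ has a unique weak solution $U\in C([0,\infty),\mathcal H)$, namely $U(t)=S(t)U_0$. Here a weak solution is a $U\in C([0,\infty),\mathcal H)$ with $U(0)=U_0$ such that for every $V\in D(\mathcal B^*)$ and $t\ge0$, $\langle U(t),V\rangle=\langle U_0,V\rangle+\int_0^t\langle U(s),\mathcal B^*V\rangle\,ds$. (iii) For $k\in\mathbb N$, if $U_0\in D(\mathcal B^k)$, then $U\in\bigcap_{j=0}^kC^{k-j}([0,\infty),D(\mathcal B^j))$, where $D(\mathcal B^j)$ carries the graph norm of $I,\mathcal B,\dots,\mathcal B^j$. The same holds with $\overline{\mathcal B}$ in place of $\mathcal B$ throughout this sentence: if $U_0\in D(\overline{\mathcal B}^{\,k})$, then $U\in\bigcap_{j=0}^kC^{k-j}([0,\infty),D(\overline{\mathcal B}^{\,j}))$. -/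

import Mathlib

open MeasureTheory Set Filter Topology
open scoped ContDiff NNReal ENNReal

noncomputable section

namespace Timoshenko

/-! ### Function spaces on the interval `(0, L)` -/

/-- The complex Hilbert space `L²(0, L)`. -/
abbrev L2 (L : ℝ) : Type := Lp ℂ 2 (volume.restrict (Ioo (0 : ℝ) L))

/-- The test functions `C_c^∞((0, L); ℂ)`. -/
def testFn (L : ℝ) : Submodule ℂ (ℝ → ℂ) where
  carrier := {φ | ContDiff ℝ ∞ φ ∧ HasCompactSupport φ ∧ tsupport φ ⊆ Ioo 0 L}
  zero_mem' := ⟨contDiff_const, HasCompactSupport.zero, by simp [tsupport]⟩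
  add_mem' := fun {a b} ha hb => ⟨ha.1.add hb.1, ha.2.1.add hb.2.1,
    (tsupport_add a b).trans (union_subset ha.2.2 hb.2.2)⟩
  smul_mem' := fun c φ h => ⟨contDiff_const.smul h.1, h.2.1.smul_left (f := fun _ => c),
    (closure_mono (Function.support_const_smul_subset c φ)).trans h.2.2⟩

/-- `g ∈ L²(0, L)` is the weak derivative of `f ∈ L²(0, L)`. -/
def IsWeakDeriv (L : ℝ) (f g : L2 L) : Prop :=
  ∀ φ ∈ testFn L, ∫ x in Ioo 0 L, f x * deriv φ x = -∫ x in Ioo 0 L, g x * φ x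

theorem testFn_cont {L : ℝ} {φ : ℝ → ℂ} (h : φ ∈ testFn L) : Continuous φ := h.1.continuous

theorem testFn_deriv {L : ℝ} {φ : ℝ → ℂ} (h : φ ∈ testFn L) : deriv φ ∈ testFn L := by
  refine ⟨?_, h.2.1.deriv, (tsupport_deriv_subset (𝕜 := ℝ)).trans h.2.2⟩
  exact (contDiff_infty_iff_deriv.1 h.1).2

theorem testFn_memLp {L : ℝ} {φ : ℝ → ℂ} (h : φ ∈ testFn L) (p : ℝ≥0∞) :
    MemLp φ p (volume.restrict (Ioo (0 : ℝ) L)) :=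
  (testFn_cont h).memLp_of_hasCompactSupport h.2.1

theorem integrable_mul_test {L : ℝ} (f : L2 L) {φ : ℝ → ℂ} (h : φ ∈ testFn L) :
    Integrable (fun x => f x * φ x) (volume.restrict (Ioo (0 : ℝ) L)) :=
  (Lp.memLp f).integrable_mul (testFn_memLp h 2)

theorem IsWeakDeriv.add {L : ℝ} {f g f' g' : L2 L} (h : IsWeakDeriv L f g)
    (h' : IsWeakDeriv L f' g') : IsWeakDeriv L (f + f') (g + g') := by
  intro φ hφ
  have e1 : ∫ x in Ioo 0 L, (f + f') x * deriv φ x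
      = ∫ x in Ioo 0 L, (f x * deriv φ x + f' x * deriv φ x) := by
    refine integral_congr_ae ?_
    filter_upwards [Lp.coeFn_add f f'] with x hx
    rw [hx, Pi.add_apply, add_mul]
  have e2 : ∫ x in Ioo 0 L, (g + g') x * φ x = ∫ x in Ioo 0 L, (g x * φ x + g' x * φ x) := by
    refine integral_congr_ae ?_
    filter_upwards [Lp.coeFn_add g g'] with x hx
    rw [hx, Pi.add_apply, add_mul]
  rw [e1, e2, integral_add (integrable_mul_test f (testFn_deriv hφ))
    (integrable_mul_test f' (testFn_deriv hφ)), integral_add (integrable_mul_test g hφ)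
    (integrable_mul_test g' hφ), h φ hφ, h' φ hφ]
  ring

theorem IsWeakDeriv.smul {L : ℝ} {f g : L2 L} (c : ℂ) (h : IsWeakDeriv L f g) :
    IsWeakDeriv L (c • f) (c • g) := by
  intro φ hφ
  have e1 : ∫ x in Ioo 0 L, (c • f) x * deriv φ x = ∫ x in Ioo 0 L, c * (f x * deriv φ x) := by
    refine integral_congr_ae ?_
    filter_upwards [Lp.coeFn_smul c f] with x hx
    rw [hx, Pi.smul_apply, smul_eq_mul, mul_assoc]
  have e2 : ∫ x in Ioo 0 L, (c • g) x * φ x = ∫ x in Ioo 0 L, c * (g x * φ x) := by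
    refine integral_congr_ae ?_
    filter_upwards [Lp.coeFn_smul c g] with x hx
    rw [hx, Pi.smul_apply, smul_eq_mul, mul_assoc]
  rw [e1, e2, integral_const_mul, integral_const_mul, h φ hφ]
  ring

theorem integral_zero_mul (L : ℝ) (χ : ℝ → ℂ) : ∫ x in Ioo 0 L, (0 : L2 L) x * χ x = 0 := by
  rw [integral_congr_ae (g := fun _ => (0 : ℂ))]
  · simp
  · filter_upwards [Lp.coeFn_zero ℂ 2 (volume.restrict (Ioo 0 L))] with x hx
    rw [hx, Pi.zero_apply, zero_mul]

theorem IsWeakDeriv.zero (L : ℝ) : IsWeakDeriv L 0 0 := by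
  intro φ hφ
  rw [integral_zero_mul, integral_zero_mul, neg_zero]

theorem IsWeakDeriv.unique {L : ℝ} {f g g' : L2 L} (h : IsWeakDeriv L f g)
    (h' : IsWeakDeriv L f g') : g = g' := by
  have hd : IsWeakDeriv L 0 (g - g') := by
    simpa [sub_eq_add_neg] using h.add (h'.smul (-1))
  have key : ∀ᵐ x ∂(volume : Measure ℝ), x ∈ Ioo 0 L → (g - g') x = 0 := by
    refine isOpen_Ioo.ae_eq_zero_of_integral_contDiff_smul_eq_zero ?_ ?_
    · refine IntegrableOn.locallyIntegrableOn ?_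
      exact (Lp.memLp (g - g')).integrable (by norm_num)
    · intro φ h1 h2 h3
      have ht : (fun x => (φ x : ℂ)) ∈ testFn L := by
        refine ⟨Complex.ofRealCLM.contDiff.comp h1, h2.comp_left (g := fun y : ℝ => (y : ℂ))
          Complex.ofReal_zero, ?_⟩
        refine (closure_mono ?_).trans h3
        intro x hx
        simpa using hx
      have e := hd _ ht
      rw [integral_zero_mul] at e
      have e' : ∫ x in Ioo 0 L, (g - g') x * (φ x : ℂ) = 0 := by
        simpa using e.symm
      have hs : ∫ x, φ x • (g - g') x = ∫ x in Ioo 0 L, φ x • (g - g') x := by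
        refine (setIntegral_eq_integral_of_forall_compl_eq_zero ?_).symm
        intro x hx
        have : φ x = 0 := image_eq_zero_of_notMem_tsupport fun hx' => hx (h3 hx')
        simp [this]
      rw [hs, ← e']
      refine integral_congr_ae (Eventually.of_forall fun x => ?_)
      simp [mul_comm]
  have : g - g' = 0 := by
    refine Lp.ext ?_
    have k2 := (ae_restrict_iff' measurableSet_Ioo).2 key
    filter_upwards [k2, Lp.coeFn_zero ℂ 2 (volume.restrict (Ioo 0 L))] with x hx h0
    rw [hx, h0]; rfl
  exact sub_eq_zero.1 this

/-- The weak derivative `d/dx` as an unbounded operator on `L²(0, L)`, with domain `H¹(0, L)`. -/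
def dx (L : ℝ) : L2 L →ₗ.[ℂ] L2 L where
  domain :=
    { carrier := {f | ∃ g, IsWeakDeriv L f g}
      zero_mem' := ⟨0, IsWeakDeriv.zero L⟩
      add_mem' := fun ⟨g, hg⟩ ⟨g', hg'⟩ => ⟨g + g', hg.add hg'⟩
      smul_mem' := fun c _ ⟨g, hg⟩ => ⟨c • g, hg.smul c⟩ }
  toFun :=
    { toFun := fun f => f.2.choose
      map_add' := fun f f' =>
        (f + f').2.choose_spec.unique (f.2.choose_spec.add f'.2.choose_spec)
      map_smul' := fun c f => (c • f).2.choose_spec.unique (f.2.choose_spec.smul c) }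

theorem dx_spec {L : ℝ} (f : (dx L).domain) : IsWeakDeriv L f (dx L f) := f.2.choose_spec

theorem dx_eq {L : ℝ} (f : (dx L).domain) {g : L2 L} (h : IsWeakDeriv L f g) : dx L f = g :=
  (dx_spec f).unique h

/-- The pairs `(φ, φ')` in `L²(0, L) × L²(0, L)`, for `φ` a test function. -/
def testGraph (L : ℝ) : Submodule ℂ (L2 L × L2 L) where
  carrier := {q | ∃ φ ∈ testFn L, q.1 =ᵐ[volume.restrict (Ioo 0 L)] φ ∧
    q.2 =ᵐ[volume.restrict (Ioo 0 L)] deriv φ}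
  zero_mem' := ⟨0, (testFn L).zero_mem, Lp.coeFn_zero _ _ _, by
    have : deriv (0 : ℝ → ℂ) = 0 := by ext x; simp
    rw [this]; exact Lp.coeFn_zero _ _ _⟩
  add_mem' := by
    rintro a b ⟨φ, hφ, h1, h2⟩ ⟨χ, hχ, k1, k2⟩
    refine ⟨φ + χ, (testFn L).add_mem hφ hχ, ?_, ?_⟩
    · exact (Lp.coeFn_add _ _).trans (h1.add k1)
    · refine (Lp.coeFn_add _ _).trans ((h2.add k2).trans (Eventually.of_forall fun x => ?_))
      exact (deriv_add (hφ.1.differentiable (by simp) x)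
        (hχ.1.differentiable (by simp) x)).symm
  smul_mem' := by
    rintro c a ⟨φ, hφ, h1, h2⟩
    refine ⟨c • φ, (testFn L).smul_mem c hφ, ?_, ?_⟩
    · exact (Lp.coeFn_smul _ _).trans (h1.const_smul c)
    · refine (Lp.coeFn_smul _ _).trans ((h2.const_smul c).trans (Eventually.of_forall fun x => ?_))
      exact (deriv_const_smul c (hφ.1.differentiable (by simp) x)).symm

/-- The pairs `(u, u')` with `u ∈ H¹₀(0, L)`: the closure of the test functions in the norm
of `H¹`. -/
def H10graph (L : ℝ) : Submodule ℂ (L2 L × L2 L) := (testGraph L).topologicalClosure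

/-- The space `H¹₀(0, L)`, the closure of `C_c^∞(0, L)` in `H¹(0, L)`. -/
def H10 (L : ℝ) : Submodule ℂ (L2 L) := (H10graph L).map (LinearMap.fst ℂ _ _)

theorem testGraph_isWeakDeriv {L : ℝ} {q : L2 L × L2 L} (h : q ∈ testGraph L) :
    IsWeakDeriv L q.1 q.2 := by
  obtain ⟨φ, hφ, h1, h2⟩ := h
  intro χ hχ
  have e1 : ∫ x in Ioo 0 L, q.1 x * deriv χ x = ∫ x, φ x * deriv χ x := by
    rw [integral_congr_ae (g := fun x => φ x * deriv χ x)]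
    · refine setIntegral_eq_integral_of_forall_compl_eq_zero fun x hx => ?_
      rw [image_eq_zero_of_notMem_tsupport (fun hx' => hx (hφ.2.2 hx')), zero_mul]
    · filter_upwards [h1] with x hx
      rw [hx]
  have e2 : ∫ x in Ioo 0 L, q.2 x * χ x = ∫ x, deriv φ x * χ x := by
    rw [integral_congr_ae (g := fun x => deriv φ x * χ x)]
    · refine setIntegral_eq_integral_of_forall_compl_eq_zero fun x hx => ?_
      rw [image_eq_zero_of_notMem_tsupport (fun hx' => hx (hχ.2.2 hx')), mul_zero]
    · filter_upwards [h2] with x hx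
      rw [hx]
  rw [e1, e2]
  have hp : ∀ {a b : ℝ → ℂ}, a ∈ testFn L → b ∈ testFn L → Integrable (a * b) volume := by
    intro a b ha hb
    exact ((testFn_cont ha).mul (testFn_cont hb)).integrable_of_hasCompactSupport
      (ha.2.1.mul_right)
  exact integral_mul_deriv_eq_deriv_mul_of_integrable
    (fun x _ => (hφ.1.differentiable (by simp) x).hasDerivAt)
    (fun x _ => (hχ.1.differentiable (by simp) x).hasDerivAt)
    (hp hφ (testFn_deriv hχ)) (hp (testFn_deriv hφ) hχ) (hp hφ hχ)

theorem continuous_integral_mul {L : ℝ} {φ : ℝ → ℂ} (h : φ ∈ testFn L) :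
    Continuous fun f : L2 L => ∫ x in Ioo 0 L, f x * φ x := by
  have hm : MemLp (fun x => star (φ x)) 2 (volume.restrict (Ioo (0 : ℝ) L)) :=
    (testFn_memLp h 2).star
  have e : (fun f : L2 L => ∫ x in Ioo 0 L, f x * φ x)
      = fun f => inner ℂ (hm.toLp _) f := by
    ext f
    rw [L2.inner_def]
    refine integral_congr_ae ?_
    filter_upwards [hm.coeFn_toLp] with x hx
    rw [hx]
    simp
  rw [e]
  exact continuous_const.inner continuous_id

theorem H10graph_isWeakDeriv {L : ℝ} {q : L2 L × L2 L} (h : q ∈ H10graph L) :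
    IsWeakDeriv L q.1 q.2 := by
  intro φ hφ
  have hc : IsClosed {q : L2 L × L2 L | ∫ x in Ioo 0 L, q.1 x * deriv φ x
      = -∫ x in Ioo 0 L, q.2 x * φ x} :=
    isClosed_eq ((continuous_integral_mul (testFn_deriv hφ)).comp continuous_fst)
      ((continuous_integral_mul hφ).comp continuous_snd).neg
  exact closure_minimal (fun q hq => testGraph_isWeakDeriv hq φ hφ) hc h

theorem H10_le (L : ℝ) : H10 L ≤ (dx L).domain := by
  rintro _ ⟨q, hq, rfl⟩
  exact ⟨q.2, H10graph_isWeakDeriv hq⟩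

/-- The derivative `u ↦ u_x` on `H¹₀(0, L)`. -/
def grad (L : ℝ) : H10 L →ₗ[ℂ] L2 L := (dx L).toFun ∘ₗ Submodule.inclusion (H10_le L)

theorem grad_mem {L : ℝ} (u : H10 L) : ((u : L2 L), grad L u) ∈ H10graph L := by
  obtain ⟨_, q, hq, rfl⟩ := u
  have : grad L ⟨_, q, hq, rfl⟩ = q.2 := dx_eq _ (H10graph_isWeakDeriv hq)
  rw [this]
  exact hq

theorem test_bound {L : ℝ} {q : L2 L × L2 L} (h : q ∈ testGraph L) :
    ‖q.1‖ ≤ (measureUnivNNReal (volume.restrict (Ioo (0 : ℝ) L)) : ℝ) ^ (1 / 2 : ℝ) *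
      (measureUnivNNReal (volume.restrict (Ioo (0 : ℝ) L)) : ℝ) ^ (1 / 2 : ℝ) * ‖q.2‖ := by
  obtain ⟨φ, hφ, h1, h2⟩ := h
  set μ := volume.restrict (Ioo (0 : ℝ) L) with hμ
  have hφ' := testFn_deriv hφ
  -- the `L¹` norm of the derivative
  have hI : ∫ x, ‖deriv φ x‖ ∂μ ≤ (measureUnivNNReal μ : ℝ) ^ (1 / 2 : ℝ) * ‖q.2‖ := by
    have a1 : ∫ x, ‖deriv φ x‖ ∂μ = (eLpNorm (deriv φ) 1 μ).toReal := by
      rw [integral_norm_eq_lintegral_enorm (testFn_cont hφ').aestronglyMeasurable,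
        eLpNorm_one_eq_lintegral_enorm]
    have a2 : ‖q.2‖ = (eLpNorm (deriv φ) 2 μ).toReal := by
      rw [Lp.norm_def, eLpNorm_congr_ae h2]
    have a3 := eLpNorm_le_eLpNorm_mul_rpow_measure_univ (μ := μ) (p := 1) (q := 2)
      (by norm_num) (testFn_cont hφ').aestronglyMeasurable
    have a4 : ((1 : ℝ≥0∞).toReal⁻¹ : ℝ) - (2 : ℝ≥0∞).toReal⁻¹ = 1 / 2 := by norm_num
    rw [one_div, one_div, a4] at a3
    have a5 := ENNReal.toReal_mono (ENNReal.mul_ne_top (testFn_memLp hφ' 2).2.ne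
      (ENNReal.rpow_ne_top_of_nonneg (by norm_num) (measure_ne_top μ _))) a3
    rw [ENNReal.toReal_mul, ← ENNReal.toReal_rpow] at a5
    rw [a1, a2, mul_comm]
    exact a5
  have hpt : ∀ x, ‖φ x‖ ≤ ∫ x, ‖deriv φ x‖ ∂μ := by
    intro x
    by_cases hx : x ∈ Ioo 0 L
    · have f0 : φ 0 = 0 := image_eq_zero_of_notMem_tsupport fun h0 => by
        simpa using (hφ.2.2 h0).1
      have e : ∫ y in (0 : ℝ)..x, deriv φ y = φ x := by
        rw [intervalIntegral.integral_deriv_eq_sub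
          (fun y _ => hφ.1.differentiable (by simp) y)
          ((testFn_cont hφ').intervalIntegrable _ _), f0, sub_zero]
      rw [← e]
      refine (intervalIntegral.norm_integral_le_integral_norm hx.1.le).trans ?_
      rw [intervalIntegral.integral_of_le hx.1.le, integral_Ioc_eq_integral_Ioo]
      refine setIntegral_mono_set ?_ (Eventually.of_forall fun y => norm_nonneg _)
        (Ioo_subset_Ioo_right hx.2.le).eventuallyLE
      exact ((testFn_memLp hφ' 1).integrable le_rfl).norm
    · rw [image_eq_zero_of_notMem_tsupport fun h0 => hx (hφ.2.2 h0), norm_zero]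
      exact integral_nonneg fun _ => norm_nonneg _
  have hb := Lp.norm_le_of_ae_bound (f := q.1) (C := ∫ x, ‖deriv φ x‖ ∂μ)
    (integral_nonneg fun _ => norm_nonneg _) (by
      filter_upwards [h1] with x hx
      rw [hx]; exact hpt x)
  have e2 : ((2 : ℝ≥0∞).toReal⁻¹ : ℝ) = 1 / 2 := by norm_num
  rw [e2] at hb
  rw [mul_assoc]
  exact hb.trans (mul_le_mul_of_nonneg_left hI (by positivity))

/-- The Poincaré inequality on `H¹₀(0, L)`. -/
theorem exists_poincare (L : ℝ) : ∃ C : ℝ, 0 ≤ C ∧ ∀ u : H10 L, ‖u‖ ≤ C * ‖grad L u‖ := by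
  obtain ⟨K, hK0, hK⟩ : ∃ K : ℝ, 0 ≤ K ∧ ∀ q ∈ testGraph L, ‖q.1‖ ≤ K * ‖q.2‖ := by
    refine ⟨(measureUnivNNReal (volume.restrict (Ioo (0 : ℝ) L)) : ℝ) ^ (1 / 2 : ℝ) *
      (measureUnivNNReal (volume.restrict (Ioo (0 : ℝ) L)) : ℝ) ^ (1 / 2 : ℝ), ?_, ?_⟩
    · positivity
    · intro q hq
      exact test_bound hq
  refine ⟨K, hK0, fun u => ?_⟩
  have hc : IsClosed {q : L2 L × L2 L | ‖q.1‖ ≤ K * ‖q.2‖} :=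
    isClosed_le continuous_fst.norm (continuous_const.mul continuous_snd.norm)
  have hs : closure (testGraph L : Set (L2 L × L2 L)) ⊆ {q | ‖q.1‖ ≤ K * ‖q.2‖} :=
    closure_minimal hK hc
  have hm : ((u : L2 L), grad L u) ∈ closure (testGraph L : Set (L2 L × L2 L)) := grad_mem u
  have := hs hm
  rw [Set.mem_ofPred_eq] at this
  rw [Submodule.coe_norm]
  exact this

/-! ### Unbounded operators -/

section Operators

variable {E : Type*} [NormedAddCommGroup E]

/-- The composition `B ∘ T` of unbounded operators, on `{x ∈ D(T) | T x ∈ D(B)}`. -/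
def pcomp [Module ℂ E] (B T : E →ₗ.[ℂ] E) : E →ₗ.[ℂ] E where
  domain := (B.domain.comap T.toFun).map T.domain.subtype
  toFun :=
    { toFun := fun x => B ⟨T ⟨x, by obtain ⟨_, y, _, rfl⟩ := x; exact y.2⟩, by
        obtain ⟨_, y, hy, rfl⟩ := x; exact hy⟩
      map_add' := fun x y => by
        rw [← B.map_add]
        congr 1
        exact Subtype.ext (T.map_add ⟨x, _⟩ ⟨y, _⟩)
      map_smul' := fun c x => by
        rw [RingHom.id_apply, ← B.map_smul]
        congr 1
        exact Subtype.ext (T.map_smul c ⟨x, _⟩) }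

/-- The powers of an unbounded operator: `B⁰ = I` on the whole space and `Bⁿ⁺¹ = Bⁿ ∘ B` on
`D(Bⁿ⁺¹) = {x ∈ D(B) | B x ∈ D(Bⁿ)}`. -/
def ppow [Module ℂ E] (B : E →ₗ.[ℂ] E) : ℕ → (E →ₗ.[ℂ] E)
  | 0 => LinearMap.id.toPMap ⊤
  | n + 1 => pcomp (ppow B n) B

theorem ppow_domain_succ_le [Module ℂ E] (B : E →ₗ.[ℂ] E) (n : ℕ) :
    (ppow B (n + 1)).domain ≤ (ppow B n).domain := by
  induction n with
  | zero => exact fun _ _ => Submodule.mem_top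
  | succ n ih =>
    rintro _ ⟨y, hy, rfl⟩
    exact ⟨y, ih hy, rfl⟩

theorem ppow_domain_anti [Module ℂ E] (B : E →ₗ.[ℂ] E) :
    Antitone fun n => (ppow B n).domain :=
  antitone_nat_of_succ_le (ppow_domain_succ_le B)

/-- The space `D(Bʲ)`, as a type of its own: it will carry the graph norm. -/
def PowDomain [Module ℂ E] (B : E →ₗ.[ℂ] E) (j : ℕ) : Type _ := ↥(ppow B j).domain

instance [Module ℂ E] (B : E →ₗ.[ℂ] E) (j : ℕ) : AddCommGroup (PowDomain B j) :=
  inferInstanceAs (AddCommGroup ↥(ppow B j).domain)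

instance [Module ℂ E] (B : E →ₗ.[ℂ] E) (j : ℕ) : Module ℂ (PowDomain B j) :=
  inferInstanceAs (Module ℂ ↥(ppow B j).domain)

/-- The inclusion of `D(Bʲ)` in the whole space. -/
def PowDomain.val [Module ℂ E] {B : E →ₗ.[ℂ] E} {j : ℕ} (x : PowDomain B j) : E :=
  ((show ↥(ppow B j).domain from x) : E)

/-- The map `x ↦ (x, B x, …, Bʲ x)` on `D(Bʲ)`. -/
def powGraph [NormedSpace ℂ E] (B : E →ₗ.[ℂ] E) (j : ℕ) :
    PowDomain B j →ₗ[ℂ] (Fin (j + 1) → E) :=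
  LinearMap.pi fun i => (ppow B i).toFun ∘ₗ
    Submodule.inclusion (ppow_domain_anti B (Nat.lt_succ_iff.1 i.2))

theorem powGraph_injective [NormedSpace ℂ E] (B : E →ₗ.[ℂ] E) (j : ℕ) :
    Function.Injective (powGraph B j) := fun _ _ h => Subtype.ext (congrFun h 0)

/-- `D(Bʲ)` carries the graph norm `max (‖x‖, ‖B x‖, …, ‖Bʲ x‖)`. -/
instance [NormedSpace ℂ E] (B : E →ₗ.[ℂ] E) (j : ℕ) : NormedAddCommGroup (PowDomain B j) :=
  NormedAddCommGroup.induced _ _ (powGraph B j) (powGraph_injective B j)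

instance [NormedSpace ℂ E] (B : E →ₗ.[ℂ] E) (j : ℕ) : NormedSpace ℂ (PowDomain B j) :=
  NormedSpace.induced ℂ (PowDomain B j) (Fin (j + 1) → E) (powGraph B j)

/-- `U ∈ Cᵐ([0, ∞), D(Bʲ))`. -/
def IsCmInto [NormedSpace ℂ E] (B : E →ₗ.[ℂ] E) (m j : ℕ) (U : ℝ → E) : Prop :=
  ∃ V : ℝ → PowDomain B j, (∀ t, 0 ≤ t → (V t).val = U t) ∧ ContDiffOn ℝ m V (Ici 0)

/-- `B` is dissipative: `Re ⟨B x, x⟩ ≤ 0` for every `x ∈ D(B)`. -/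
def IsDissipative [InnerProductSpace ℂ E] (B : E →ₗ.[ℂ] E) : Prop :=
  ∀ x : B.domain, (inner ℂ (B x) (x : E)).re ≤ 0

/-- `z` lies in the resolvent set of `B`: the operator `z - B : D(B) → E` is bijective, with
bounded inverse. -/
def InResolventSet [NormedSpace ℂ E] (B : E →ₗ.[ℂ] E) (z : ℂ) : Prop :=
  ∃ R : E →L[ℂ] E, (∀ y : E, ∃ h : R y ∈ B.domain, z • R y - B ⟨R y, h⟩ = y) ∧
    ∀ x : B.domain, R (z • (x : E) - B x) = x

/-- A `C₀`-semigroup of contractions on `E`. -/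
structure ContractionSemigroup (E : Type*) [NormedAddCommGroup E] [NormedSpace ℂ E] where
  toFun : ℝ≥0 → E →L[ℂ] E
  map_zero : toFun 0 = ContinuousLinearMap.id ℂ E
  map_add : ∀ s t, toFun (s + t) = (toFun s).comp (toFun t)
  continuous_apply : ∀ x, Continuous fun t => toFun t x
  norm_le_one : ∀ t, ‖toFun t‖ ≤ 1

/-- `B` is the infinitesimal generator of `S`: one has `x ∈ D(B)` and `B x = y` if and only if
`(S(t) x - x) / t → y` as `t → 0⁺`. -/
def IsGenerator [NormedSpace ℂ E] (B : E →ₗ.[ℂ] E) (S : ContractionSemigroup E) : Prop :=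
  ∀ x y : E, (x, y) ∈ B.graph ↔
    Tendsto (fun t : ℝ≥0 => (t : ℝ)⁻¹ • (S.toFun t x - x)) (𝓝[>] 0) (𝓝 y)

/-- `U` is a weak solution in `C([0, ∞), E)` of `U' = B U`, `U(0) = U₀`: it is continuous, and for
every `V ∈ D(B*)` the function `t ↦ ⟨V, U(t)⟩` is absolutely continuous with derivative
`⟨B* V, U(t)⟩`, that is,
`⟨V, U(t)⟩ = ⟨V, U₀⟩ + ∫₀ᵗ ⟨B* V, U(s)⟩ ds`. -/
structure IsWeakSolution [InnerProductSpace ℂ E] [CompleteSpace E] (B : E →ₗ.[ℂ] E) (U₀ : E)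
    (U : ℝ → E) : Prop where
  continuousOn : ContinuousOn U (Ici 0)
  initial : U 0 = U₀
  weak : ∀ V : B.adjoint.domain, ∀ t : ℝ, 0 ≤ t →
    inner ℂ (V : E) (U t) = inner ℂ (V : E) U₀ + ∫ s in (0 : ℝ)..t, inner ℂ (B.adjoint V) (U s)

end Operators

/-! ### The Dirichlet Laplacian and its fractional powers -/

/-- The operator `A = -d²/dx²` with `D(A) = H²(0, L) ∩ H¹₀(0, L)`. -/
def lapA (L : ℝ) : L2 L →ₗ.[ℂ] L2 L := -((ppow (dx L) 2).domRestrict (H10 L))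

theorem memLp_sine (L : ℝ) (n : ℕ) :
    MemLp (fun x : ℝ => ((√(2 / L) * Real.sin ((n + 1) * Real.pi * x / L) : ℝ) : ℂ)) 2
      (volume.restrict (Ioo (0 : ℝ) L)) := by
  refine MemLp.of_bound (Continuous.aestronglyMeasurable (by fun_prop)) (√(2 / L)) ?_
  refine Eventually.of_forall fun x => ?_
  rw [Complex.norm_real, Real.norm_eq_abs, abs_mul, abs_of_nonneg (Real.sqrt_nonneg _)]
  exact mul_le_of_le_one_right (Real.sqrt_nonneg _) (Real.abs_sin_le_one _)

/-- The orthonormal basis `√(2/L) sin((n+1)πx/L)`, `n = 0, 1, …`, of eigenfunctions of `A`. -/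
def eigenfn (L : ℝ) (n : ℕ) : L2 L := (memLp_sine L n).toLp _

/-- The eigenvalues `((n+1)π/L)²` of `A`. -/
def eigenval (L : ℝ) (n : ℕ) : ℝ := ((n + 1) * Real.pi / L) ^ 2

/-- The `n`-th term `λₙ^θ ⟨eₙ, f⟩ eₙ` of the expansion of `A^θ f`. -/
def fracTerm (L θ : ℝ) (f : L2 L) (n : ℕ) : L2 L :=
  (((eigenval L n ^ θ : ℝ) : ℂ) * inner ℂ (eigenfn L n) f) • eigenfn L n

theorem fracTerm_add (L θ : ℝ) (f g : L2 L) :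
    fracTerm L θ (f + g) = fracTerm L θ f + fracTerm L θ g := by
  ext1 n
  simp only [fracTerm, Pi.add_apply, inner_add_right, mul_add, add_smul]

theorem fracTerm_smul (L θ : ℝ) (c : ℂ) (f : L2 L) :
    fracTerm L θ (c • f) = c • fracTerm L θ f := by
  ext1 n
  simp only [fracTerm, Pi.smul_apply, inner_smul_right, smul_smul]
  ring_nf

theorem fracTerm_zero (L θ : ℝ) : fracTerm L θ 0 = 0 := by
  simpa using fracTerm_smul L θ 0 0

/-- The fractional power `A^θ f = ∑ λₙ^θ ⟨eₙ, f⟩ eₙ`, defined on all `f ∈ L²(0, L)` for which the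
series converges in `L²(0, L)`. -/
def fracA (L θ : ℝ) : L2 L →ₗ.[ℂ] L2 L where
  domain :=
    { carrier := {f | Summable (fracTerm L θ f)}
      zero_mem' := by
        change Summable (fracTerm L θ 0)
        rw [fracTerm_zero]
        exact summable_zero
      add_mem' := fun {f g} hf hg => by
        change Summable (fracTerm L θ (f + g))
        rw [fracTerm_add]
        exact Summable.add hf hg
      smul_mem' := fun c f hf => by
        change Summable (fracTerm L θ (c • f))
        rw [fracTerm_smul]
        exact Summable.const_smul c hf }
  toFun :=
    { toFun := fun f => ∑' n, fracTerm L θ f n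
      map_add' := fun f g => by
        rw [Submodule.coe_add, fracTerm_add]
        exact Summable.tsum_add f.2 g.2
      map_smul' := fun c f => by
        rw [Submodule.coe_smul, fracTerm_smul]
        exact Summable.tsum_const_smul c f.2 }

/-! ### The energy space -/

/-- The constants of the beam: its length `L` and the positive coefficients
`ρ₁ = ρA`, `ρ₂ = ρI`, `κ = kAG`, `b = EI`. -/
structure Beam where
  L : ℝ
  ρ₁ : ℝ
  ρ₂ : ℝ
  κ : ℝ
  b : ℝ
  L_pos : 0 < L
  ρ₁_pos : 0 < ρ₁
  ρ₂_pos : 0 < ρ₂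
  κ_pos : 0 < κ
  b_pos : 0 < b

/-- The phase space `[H¹₀(0, L) × L²(0, L)]²` of all `U = (u, w, ψ, v)`. -/
def Energy (p : Beam) : Type := ↥(H10 p.L) × L2 p.L × ↥(H10 p.L) × L2 p.L

namespace Energy

variable {p : Beam}

instance : AddCommGroup (Energy p) :=
  inferInstanceAs (AddCommGroup (↥(H10 p.L) × L2 p.L × ↥(H10 p.L) × L2 p.L))

instance : Module ℂ (Energy p) :=
  inferInstanceAs (Module ℂ (↥(H10 p.L) × L2 p.L × ↥(H10 p.L) × L2 p.L))

/-- The element `(u, w, ψ, v)`. -/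
def mk (u : H10 p.L) (w : L2 p.L) (ψ : H10 p.L) (v : L2 p.L) : Energy p := (u, w, ψ, v)

/-- The displacement `u`. -/
def u (U : Energy p) : H10 p.L := U.1

/-- The velocity `w`. -/
def w (U : Energy p) : L2 p.L := U.2.1

/-- The rotation angle `ψ`. -/
def ψ (U : Energy p) : H10 p.L := U.2.2.1

/-- The angular velocity `v`. -/
def v (U : Energy p) : L2 p.L := U.2.2.2

/-- The shear strain `u_x + ψ`. -/
def shear (U : Energy p) : L2 p.L := grad p.L U.u + (U.ψ : L2 p.L)

@[simp] theorem u_add (U V : Energy p) : (U + V).u = U.u + V.u := rfl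
@[simp] theorem w_add (U V : Energy p) : (U + V).w = U.w + V.w := rfl
@[simp] theorem ψ_add (U V : Energy p) : (U + V).ψ = U.ψ + V.ψ := rfl
@[simp] theorem v_add (U V : Energy p) : (U + V).v = U.v + V.v := rfl
@[simp] theorem u_sub (U V : Energy p) : (U - V).u = U.u - V.u := rfl
@[simp] theorem w_sub (U V : Energy p) : (U - V).w = U.w - V.w := rfl
@[simp] theorem ψ_sub (U V : Energy p) : (U - V).ψ = U.ψ - V.ψ := rfl
@[simp] theorem v_sub (U V : Energy p) : (U - V).v = U.v - V.v := rfl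
@[simp] theorem u_smul (c : ℂ) (U : Energy p) : (c • U).u = c • U.u := rfl
@[simp] theorem w_smul (c : ℂ) (U : Energy p) : (c • U).w = c • U.w := rfl
@[simp] theorem ψ_smul (c : ℂ) (U : Energy p) : (c • U).ψ = c • U.ψ := rfl
@[simp] theorem v_smul (c : ℂ) (U : Energy p) : (c • U).v = c • U.v := rfl

@[simp] theorem shear_add (U V : Energy p) : (U + V).shear = U.shear + V.shear := by
  simp only [shear, u_add, ψ_add, map_add, Submodule.coe_add]
  abel

@[simp] theorem shear_smul (c : ℂ) (U : Energy p) : (c • U).shear = c • U.shear := by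
  simp only [shear, u_smul, ψ_smul, map_smul, Submodule.coe_smul, smul_add]

/-- The components as linear maps. -/
def wL : Energy p →ₗ[ℂ] L2 p.L := ⟨⟨w, fun _ _ => rfl⟩, fun _ _ => rfl⟩

def ψL : Energy p →ₗ[ℂ] H10 p.L := ⟨⟨ψ, fun _ _ => rfl⟩, fun _ _ => rfl⟩

def vL : Energy p →ₗ[ℂ] L2 p.L := ⟨⟨v, fun _ _ => rfl⟩, fun _ _ => rfl⟩

def shearL : Energy p →ₗ[ℂ] L2 p.L := ⟨⟨shear, shear_add⟩, shear_smul⟩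

/-- The energy inner product
`ρ₁⟨w, w*⟩ + ρ₂⟨v, v*⟩ + κ⟨u_x + ψ, u*_x + ψ*⟩ + b⟨ψ_x, ψ*_x⟩`. -/
def energyInner (U V : Energy p) : ℂ :=
  (p.ρ₁ : ℂ) * inner ℂ U.w V.w + (p.ρ₂ : ℂ) * inner ℂ U.v V.v
    + (p.κ : ℂ) * inner ℂ U.shear V.shear + (p.b : ℂ) * inner ℂ (grad p.L U.ψ) (grad p.L V.ψ)

theorem re_energyInner (U : Energy p) : (energyInner U U).re =
    p.ρ₁ * ‖U.w‖ ^ 2 + p.ρ₂ * ‖U.v‖ ^ 2 + p.κ * ‖U.shear‖ ^ 2 + p.b * ‖grad p.L U.ψ‖ ^ 2 := by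
  have h : energyInner U U = ((p.ρ₁ * ‖U.w‖ ^ 2 + p.ρ₂ * ‖U.v‖ ^ 2 + p.κ * ‖U.shear‖ ^ 2
      + p.b * ‖grad p.L U.ψ‖ ^ 2 : ℝ) : ℂ) := by
    simp only [energyInner, inner_self_eq_norm_sq_to_K]
    push_cast
    rfl
  rw [h, Complex.ofReal_re]

/-- The energy inner product makes the phase space an inner product space. -/
@[reducible] def core : InnerProductSpace.Core ℂ (Energy p) where
  inner := energyInner
  conj_inner_symm U V := by
    simp only [energyInner, map_add, map_mul, Complex.conj_ofReal, inner_conj_symm]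
  re_inner_nonneg U := by
    have h1 := p.ρ₁_pos
    have h2 := p.ρ₂_pos
    have h3 := p.κ_pos
    have h4 := p.b_pos
    change 0 ≤ (energyInner U U).re
    rw [re_energyInner]
    positivity
  add_left U V W := by
    simp only [energyInner, w_add, v_add, ψ_add, shear_add, map_add, inner_add_left]
    ring
  smul_left U V c := by
    simp only [energyInner, w_smul, v_smul, ψ_smul, shear_smul, map_smul, inner_smul_left]
    ring
  definite U h := by
    have h1 := p.ρ₁_pos
    have h2 := p.ρ₂_pos
    have h3 := p.κ_pos
    have h4 := p.b_pos
    have h := congrArg Complex.re h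
    rw [re_energyInner, Complex.zero_re] at h
    have k1 : 0 ≤ p.ρ₁ * ‖U.w‖ ^ 2 := by positivity
    have k2 : 0 ≤ p.ρ₂ * ‖U.v‖ ^ 2 := by positivity
    have k3 : 0 ≤ p.κ * ‖U.shear‖ ^ 2 := by positivity
    have k4 : 0 ≤ p.b * ‖grad p.L U.ψ‖ ^ 2 := by positivity
    have z : ∀ {c r : ℝ}, 0 < c → c * r ^ 2 = 0 → r = 0 := by
      intro c r hc h
      have := (mul_eq_zero.1 h).resolve_left hc.ne'
      exact pow_eq_zero_iff two_ne_zero |>.1 this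
    obtain ⟨C, -, hC⟩ := exists_poincare p.L
    have hz : ∀ f : H10 p.L, ‖grad p.L f‖ = 0 → f = 0 := by
      intro f hf
      have := hC f
      rw [hf, mul_zero] at this
      exact norm_le_zero_iff.1 this
    have e1 : U.w = 0 := norm_eq_zero.1 (z h1 (by linarith))
    have e2 : U.v = 0 := norm_eq_zero.1 (z h2 (by linarith))
    have e3 : U.shear = 0 := norm_eq_zero.1 (z h3 (by linarith))
    have e4 : U.ψ = 0 := hz _ (z h4 (by linarith))
    have e5 : U.u = 0 := by
      refine hz _ ?_
      rw [shear, e4, Submodule.coe_zero, add_zero] at e3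
      rw [e3, norm_zero]
    exact Prod.ext e5 (Prod.ext e1 (Prod.ext e4 e2))

instance : NormedAddCommGroup (Energy p) := core.toNormedAddCommGroup

instance : InnerProductSpace ℂ (Energy p) := InnerProductSpace.ofCore core.toCore

theorem inner_def (U V : Energy p) : inner ℂ U V = energyInner U V := rfl

theorem norm_sq (U : Energy p) : ‖U‖ ^ 2 =
    p.ρ₁ * ‖U.w‖ ^ 2 + p.ρ₂ * ‖U.v‖ ^ 2 + p.κ * ‖U.shear‖ ^ 2 + p.b * ‖grad p.L U.ψ‖ ^ 2 := by
  rw [← re_energyInner, ← inner_def]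
  exact (inner_self_eq_norm_sq (𝕜 := ℂ) U).symm

theorem u_norm_le (U : Energy p) :
    ‖grad p.L U.u‖ ≤ ‖U.shear‖ + ‖U.ψ‖ := by
  have : grad p.L U.u = U.shear - (U.ψ : L2 p.L) := by
    rw [shear, add_sub_cancel_right]
  rw [this]
  exact norm_sub_le _ _

/-- The energy norm controls all the components. -/
theorem exists_bound (p : Beam) : ∃ C : ℝ, 0 ≤ C ∧ ∀ U : Energy p, ‖U.w‖ ≤ C * ‖U‖ ∧
    ‖U.v‖ ≤ C * ‖U‖ ∧ ‖U.shear‖ ≤ C * ‖U‖ ∧ ‖grad p.L U.ψ‖ ≤ C * ‖U‖ := by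
  have h1 := p.ρ₁_pos
  have h2 := p.ρ₂_pos
  have h3 := p.κ_pos
  have h4 := p.b_pos
  have key : ∀ {c a r : ℝ}, 0 < c → 0 ≤ r → c * a ^ 2 ≤ r ^ 2 → a ≤ (√c)⁻¹ * r := by
    intro c a r hc hr h
    have hs : 0 < √c := Real.sqrt_pos.2 hc
    rw [← div_eq_inv_mul, le_div_iff₀ hs]
    refine le_of_sq_le_sq ?_ hr
    rw [mul_pow, Real.sq_sqrt hc.le]
    linarith
  refine ⟨(√p.ρ₁)⁻¹ + (√p.ρ₂)⁻¹ + (√p.κ)⁻¹ + (√p.b)⁻¹, by positivity, fun U => ?_⟩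
  have hn := norm_sq U
  have k1 : 0 ≤ p.ρ₁ * ‖U.w‖ ^ 2 := by positivity
  have k2 : 0 ≤ p.ρ₂ * ‖U.v‖ ^ 2 := by positivity
  have k3 : 0 ≤ p.κ * ‖U.shear‖ ^ 2 := by positivity
  have k4 : 0 ≤ p.b * ‖grad p.L U.ψ‖ ^ 2 := by positivity
  have g1 : 0 ≤ (√p.ρ₁)⁻¹ * ‖U‖ := by positivity
  have g2 : 0 ≤ (√p.ρ₂)⁻¹ * ‖U‖ := by positivity
  have g3 : 0 ≤ (√p.κ)⁻¹ * ‖U‖ := by positivity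
  have g4 : 0 ≤ (√p.b)⁻¹ * ‖U‖ := by positivity
  have f1 := key (a := ‖U.w‖) h1 (norm_nonneg U) (by linarith)
  have f2 := key (a := ‖U.v‖) h2 (norm_nonneg U) (by linarith)
  have f3 := key (a := ‖U.shear‖) h3 (norm_nonneg U) (by linarith)
  have f4 := key (a := ‖grad p.L U.ψ‖) h4 (norm_nonneg U) (by linarith)
  refine ⟨?_, ?_, ?_, ?_⟩ <;> linarith

/-- The phase space is complete, hence a Hilbert space. -/
instance : CompleteSpace (Energy p) := by
  obtain ⟨C, hC0, hC⟩ := exists_bound p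
  obtain ⟨K, hK0, hK⟩ := exists_poincare p.L
  -- a bounded linear image of a Cauchy sequence converges
  have cau : ∀ (T : Energy p → L2 p.L) (M : ℝ), (∀ U V, T (U - V) = T U - T V) →
      (∀ U, ‖T U‖ ≤ M * ‖U‖) → ∀ s : ℕ → Energy p, CauchySeq s →
      ∃ f, Tendsto (fun n => T (s n)) atTop (𝓝 f) := by
    intro T M hs hb s hc
    refine cauchySeq_tendsto_of_complete ?_
    have hl : LipschitzWith (Real.toNNReal M) T := by
      refine LipschitzWith.of_dist_le_mul fun U V => ?_
      rw [dist_eq_norm, dist_eq_norm, ← hs]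
      exact (hb _).trans (mul_le_mul_of_nonneg_right (Real.le_coe_toNNReal M) (norm_nonneg _))
    exact hc.map hl.uniformContinuous
  have bψ : ∀ U : Energy p, ‖U.ψ‖ ≤ K * (C * ‖U‖) := fun U =>
    (hK _).trans (mul_le_mul_of_nonneg_left (hC U).2.2.2 hK0)
  have bu : ∀ U : Energy p, ‖grad p.L U.u‖ ≤ (C + K * C) * ‖U‖ := fun U => by
    have h1 := u_norm_le U
    have h2 := (hC U).2.2.1
    have h3 := bψ U
    nlinarith
  refine Metric.complete_of_cauchySeq_tendsto fun s hs => ?_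
  obtain ⟨w, hw⟩ := cau (fun U => U.w) C (fun _ _ => rfl) (fun U => (hC U).1) s hs
  obtain ⟨v, hv⟩ := cau (fun U => U.v) C (fun _ _ => rfl) (fun U => (hC U).2.1) s hs
  obtain ⟨f, hf⟩ := cau (fun U => (U.ψ : L2 p.L)) (K * C) (fun _ _ => rfl)
    (fun U => by rw [mul_assoc]; exact bψ U) s hs
  obtain ⟨f', hf'⟩ := cau (fun U => grad p.L U.ψ) C (fun U V => by rw [ψ_sub, map_sub])
    (fun U => (hC U).2.2.2) s hs
  obtain ⟨g, hg⟩ := cau (fun U => (U.u : L2 p.L)) (K * (C + K * C)) (fun _ _ => rfl)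
    (fun U => by
      rw [mul_assoc]
      exact (hK _).trans (mul_le_mul_of_nonneg_left (bu U) hK0)) s hs
  obtain ⟨g', hg'⟩ := cau (fun U => grad p.L U.u) (C + K * C) (fun U V => by rw [u_sub, map_sub])
    bu s hs
  have lim : ∀ {a : ℕ → H10 p.L} {f f' : L2 p.L}, Tendsto (fun n => (a n : L2 p.L)) atTop (𝓝 f) →
      Tendsto (fun n => grad p.L (a n)) atTop (𝓝 f') → ∃ z : H10 p.L, (z : L2 p.L) = f ∧
        grad p.L z = f' := by
    intro a f f' h h'
    have hm : (f, f') ∈ H10graph p.L :=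
      (testGraph p.L).isClosed_topologicalClosure.mem_of_tendsto (h.prodMk_nhds h')
        (Eventually.of_forall fun n => grad_mem (a n))
    exact ⟨⟨f, (f, f'), hm, rfl⟩, rfl, dx_eq _ (H10graph_isWeakDeriv hm)⟩
  obtain ⟨ψ, rfl, rfl⟩ := lim hf hf'
  obtain ⟨u, rfl, rfl⟩ := lim hg hg'
  refine ⟨mk u w ψ v, ?_⟩
  rw [tendsto_iff_norm_sub_tendsto_zero]
  have hz : Tendsto (fun n => ‖s n - mk u w ψ v‖ ^ 2) atTop (𝓝 0) := by
    have e : ∀ n, ‖s n - mk u w ψ v‖ ^ 2 = p.ρ₁ * ‖(s n).w - w‖ ^ 2 + p.ρ₂ * ‖(s n).v - v‖ ^ 2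
        + p.κ * ‖(grad p.L (s n).u - grad p.L u) + (((s n).ψ : L2 p.L) - ψ)‖ ^ 2
        + p.b * ‖grad p.L (s n).ψ - grad p.L ψ‖ ^ 2 := by
      intro n
      rw [norm_sq, shear, u_sub, ψ_sub, map_sub, map_sub, Submodule.coe_sub]
      rfl
    simp only [e]
    have t := ((((hw.sub_const w).norm.pow 2).const_mul p.ρ₁).add
      (((hv.sub_const v).norm.pow 2).const_mul p.ρ₂)).add
      ((((hg'.sub_const (grad p.L u)).add (hf.sub_const (ψ : L2 p.L))).norm.pow 2).const_mul p.κ)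
      |>.add (((hf'.sub_const (grad p.L ψ)).norm.pow 2).const_mul p.b)
    simpa using t
  have := hz.sqrt
  simpa [Real.sqrt_sq] using this

end Energy

/-! ### The operator of the Timoshenko system -/

/-- The domain `D(A) × (D(A^{1/2}) ∩ D(A^τ)) × D(A) × (D(A^{1/2}) ∩ D(A^σ))`, where
`D(A^{1/2}) = H¹₀(0, L)`. -/
def domB (p : Beam) (τ σ : ℝ) : Submodule ℂ (Energy p) where
  carrier := {U | (U.u : L2 p.L) ∈ (lapA p.L).domain ∧
    (U.w ∈ H10 p.L ∧ U.w ∈ (fracA p.L τ).domain) ∧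
    (U.ψ : L2 p.L) ∈ (lapA p.L).domain ∧
    (U.v ∈ H10 p.L ∧ U.v ∈ (fracA p.L σ).domain)}
  zero_mem' := ⟨Submodule.zero_mem _, ⟨Submodule.zero_mem _, Submodule.zero_mem _⟩,
    Submodule.zero_mem _, ⟨Submodule.zero_mem _, Submodule.zero_mem _⟩⟩
  add_mem' := fun h k => ⟨Submodule.add_mem _ h.1 k.1,
    ⟨Submodule.add_mem _ h.2.1.1 k.2.1.1, Submodule.add_mem _ h.2.1.2 k.2.1.2⟩,
    Submodule.add_mem _ h.2.2.1 k.2.2.1,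
    ⟨Submodule.add_mem _ h.2.2.2.1 k.2.2.2.1, Submodule.add_mem _ h.2.2.2.2 k.2.2.2.2⟩⟩
  smul_mem' := fun c _ h => ⟨Submodule.smul_mem _ c h.1,
    ⟨Submodule.smul_mem _ c h.2.1.1, Submodule.smul_mem _ c h.2.1.2⟩,
    Submodule.smul_mem _ c h.2.2.1,
    ⟨Submodule.smul_mem _ c h.2.2.2.1, Submodule.smul_mem _ c h.2.2.2.2⟩⟩

theorem grad_mem_dx {p : Beam} {u : H10 p.L} (h : (u : L2 p.L) ∈ (lapA p.L).domain) :
    grad p.L u ∈ (dx p.L).domain := by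
  obtain ⟨y, hy, e⟩ := h.2
  obtain ⟨z, -, e'⟩ := hy
  have : grad p.L u = dx p.L y := congrArg (dx p.L) (Subtype.ext e.symm)
  rw [this, ← show (z : L2 p.L) = dx p.L y from e']
  exact z.2

theorem shear_mem_dx {p : Beam} {τ σ : ℝ} (U : domB p τ σ) : U.1.shear ∈ (dx p.L).domain :=
  Submodule.add_mem _ (grad_mem_dx U.2.1) (H10_le p.L U.1.ψ.2)

/-- The second component `ρ₁⁻¹[κ(u_x + ψ)_x - A^τ w]` of `B U`. -/
def opB₂ (p : Beam) (τ σ : ℝ) : domB p τ σ →ₗ[ℂ] L2 p.L :=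
  (p.ρ₁ : ℂ)⁻¹ • ((p.κ : ℂ) • ((dx p.L).toFun ∘ₗ
      (Energy.shearL ∘ₗ (domB p τ σ).subtype).codRestrict (dx p.L).domain shear_mem_dx)
    - (fracA p.L τ).toFun ∘ₗ
      (Energy.wL ∘ₗ (domB p τ σ).subtype).codRestrict (fracA p.L τ).domain
        fun U => U.2.2.1.2)

/-- The fourth component `ρ₂⁻¹[-bAψ - κ(u_x + ψ) - A^σ v]` of `B U`. -/
def opB₄ (p : Beam) (τ σ : ℝ) : domB p τ σ →ₗ[ℂ] L2 p.L :=
  (p.ρ₂ : ℂ)⁻¹ • (-((p.b : ℂ) • ((lapA p.L).toFun ∘ₗ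
      ((H10 p.L).subtype ∘ₗ Energy.ψL ∘ₗ (domB p τ σ).subtype).codRestrict (lapA p.L).domain
        fun U => U.2.2.2.1))
    - (p.κ : ℂ) • (Energy.shearL ∘ₗ (domB p τ σ).subtype)
    - (fracA p.L σ).toFun ∘ₗ
      (Energy.vL ∘ₗ (domB p τ σ).subtype).codRestrict (fracA p.L σ).domain
        fun U => U.2.2.2.2.2)

/-- The operator
`B U = (w, ρ₁⁻¹[κ(u_x + ψ)_x - A^τ w], v, ρ₂⁻¹[-bAψ - κ(u_x + ψ) - A^σ v])`
on the domain `domB`. -/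
def opB (p : Beam) (τ σ : ℝ) : Energy p →ₗ.[ℂ] Energy p where
  domain := domB p τ σ
  toFun :=
    { toFun := fun U => Energy.mk ⟨U.1.w, U.2.2.1.1⟩ (opB₂ p τ σ U) ⟨U.1.v, U.2.2.2.2.1⟩
        (opB₄ p τ σ U)
      map_add' := fun U V => by
        rw [map_add, map_add]
        rfl
      map_smul' := fun c U => by
        rw [map_smul, map_smul]
        rfl }

theorem opB_apply (p : Beam) (τ σ : ℝ) (U : (opB p τ σ).domain) :
    opB p τ σ U = Energy.mk
      ⟨U.1.w, U.2.2.1.1⟩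
      ((p.ρ₁ : ℂ)⁻¹ • ((p.κ : ℂ) • dx p.L ⟨U.1.shear, shear_mem_dx U⟩
        - fracA p.L τ ⟨U.1.w, U.2.2.1.2⟩))
      ⟨U.1.v, U.2.2.2.2.1⟩
      ((p.ρ₂ : ℂ)⁻¹ • (-((p.b : ℂ) • lapA p.L ⟨U.1.ψ, U.2.2.2.1⟩)
        - (p.κ : ℂ) • U.1.shear - fracA p.L σ ⟨U.1.v, U.2.2.2.2.2⟩)) := rfl

end Timoshenko

end

/-! Everything is read off from one bounded operator. `opB` =: B is densely defined and dissipative,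
has dense range, and satisfies ‖U‖ ≤ K‖BU‖; hence -B⁻¹ extends to a bounded operator R on the whole
space. Dissipativity makes R accretive, and an accretive operator with dense range is injective
(`IsAccretive.injective`). The closure of the graph of B is {(x, y) : R y = -x}
(`closure_graph_of_neg_inverse`), so B is closable and its closure -R⁻¹ has 0 in its resolvent set.
The operators -(ε + R)⁻¹ are the Yosida approximations of this closure; their exponentials converge
to a contraction semigroup S that commutes with R and satisfies S(t)Rx - Rx = -∫₀ᵗ S(s)x ds
(`IsAccretive.exists_semigroup`). These two facts yield the generator and the weak solutions. For
uniqueness, the difference W of two weak solutions is tested with R*z; this gives R W = -∫W, and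
accretivity makes ‖∫W‖² nonincreasing.

For the Timoshenko operator, dissipativity comes from pairing the equation with (w, v), and the
lower bound from pairing it with (u, ψ): w and v are the first and third components of BU, hence
controlled in H¹₀, and |⟨A^τ w, u⟩| ≤ c‖w_x‖‖u_x‖ because τ ≤ 1. The equation BU = F forces w = F.u
and v = F.ψ; the rest is solved by Riesz representation in the energy space as soon as F.u ∈ D(A^τ)
and F.ψ ∈ D(A^σ) (`exists_opB_eq`). This gives dense range, and surjectivity when τ, σ ≤ 1/2, in
which case B is already closed.

The delicate point is regularity in the powers of B itself, since B need not be closed: S(t) must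
map D(B), and not only the domain of the closure, into itself (`semigroup_mem_domB`). In the sine
basis the coefficients of u and ψ are damped oscillators forced by κψ_x and -κ(u_x + ψ). An energy
estimate weighted by λₙ, with Grönwall, propagates ∑ λₙ²|uₙ|² < ∞; only the sign of the damping
enters, not its size. Thus u(t), ψ(t) stay in D(A), and the equation then puts w(t), v(t) in D(A^τ),
D(A^σ). -/

noncomputable section

namespace Timoshenko

/-! ### Dissipative operators seen through their negative inverse. -/

section Abstract

variable {E : Type*} [NormedAddCommGroup E] [InnerProductSpace ℂ E]

/-- A bounded operator `R` is accretive if `Re ⟨R y, y⟩ ≥ 0` for every `y`. -/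
def IsAccretive (R : E →L[ℂ] E) : Prop := ∀ y, 0 ≤ (inner ℂ (R y) y).re

/-- Accretivity at y + s z, where R y = 0, is a quadratic inequality in s without constant term, so
its linear term must vanish. -/
theorem IsAccretive.inner_eq_zero {R : E →L[ℂ] E} (hR : IsAccretive R) {y : E} (hy : R y = 0)
    (z : E) : inner ℂ (R z) y = 0 := by
  by_contra ha
  set a : ℂ := inner ℂ (R z) y with ha'
  set M : ℝ := (inner ℂ (R z) z).re with hM
  have hM0 : 0 ≤ M := hR z
  -- Perturbing y by -r a z turns the linear term into -r|a|².
  have key : ∀ r : ℝ, 0 ≤ -(r * ‖a‖ ^ 2) + r ^ 2 * ‖a‖ ^ 2 * M := by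
    intro r
    have h := hR (y + (-(r : ℂ) * a) • z)
    have e : inner ℂ (R (y + (-(r : ℂ) * a) • z)) (y + (-(r : ℂ) * a) • z)
        = ((-(r * ‖a‖ ^ 2) : ℝ) : ℂ) + ((r ^ 2 * ‖a‖ ^ 2 : ℝ) : ℂ) * inner ℂ (R z) z := by
      rw [map_add, hy, zero_add, map_smul, inner_smul_left, inner_add_right, inner_smul_right,
        ← ha']
      have h2 : (starRingEnd ℂ) a * a = ((‖a‖ ^ 2 : ℝ) : ℂ) := by
        rw [mul_comm, Complex.mul_conj, Complex.normSq_eq_norm_sq]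
      simp only [map_mul, map_neg, Complex.conj_ofReal]
      push_cast at h2 ⊢
      linear_combination (-(r : ℂ) + r ^ 2 * inner ℂ (R z) z) * h2
    rw [e, Complex.add_re, Complex.ofReal_re, Complex.re_ofReal_mul, ← hM] at h
    exact h
  have hp : 0 < ‖a‖ ^ 2 := by positivity
  -- At this r the right-hand side equals -|a|²/(M + 1)²; the shift by 1 covers M = 0.
  have h := key (1 / (M + 1))
  have h1 : 0 < M + 1 := by linarith
  have : -(1 / (M + 1) * ‖a‖ ^ 2) + (1 / (M + 1)) ^ 2 * ‖a‖ ^ 2 * M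
      = -(‖a‖ ^ 2 / (M + 1) ^ 2) := by
    field_simp
    ring
  rw [this] at h
  have : 0 < ‖a‖ ^ 2 / (M + 1) ^ 2 := by positivity
  linarith

theorem IsAccretive.injective {R : E →L[ℂ] E} (hR : IsAccretive R) (hd : DenseRange R) {y : E}
    (hy : R y = 0) : y = 0 := by
  refine hd.eq_zero_of_inner_left ℂ fun z => ?_
  rw [← inner_conj_symm, hR.inner_eq_zero hy z, map_zero]

variable {B : E →ₗ.[ℂ] E} {R : E →L[ℂ] E}

/-- The lower bound makes -B⁻¹ bounded on the range of B, from which it extends by density. The sign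
is chosen so that dissipativity of B becomes accretivity of R. -/
theorem exists_neg_inverse [CompleteSpace E] {K : ℝ} (hK : ∀ x : B.domain, ‖(x : E)‖ ≤ K * ‖B x‖)
    (hr : DenseRange B) : ∃ R : E →L[ℂ] E, ∀ x, R (B x) = -(x : E) :=
  ⟨LinearMap.extendOfNorm (-B.domain.subtype) B.toFun, fun x =>
    LinearMap.extendOfNorm_eq (f := -B.domain.subtype) (e := B.toFun) hr
      ⟨K, fun x => by simpa using! hK x⟩ x⟩

theorem isAccretive_of_neg_inverse (hB : IsDissipative B) (hr : DenseRange B)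
    (hR : ∀ x, R (B x) = -(x : E)) : IsAccretive R := by
  intro y
  refine hr.induction_on (p := fun y => 0 ≤ (inner ℂ (R y) y).re) y ?_ ?_
  · exact isClosed_le continuous_const
      (Complex.continuous_re.comp (R.continuous.inner continuous_id))
  · intro x
    have h := hB x
    rw [hR, inner_neg_left, Complex.neg_re, ← inner_conj_symm, Complex.conj_re]
    linarith

theorem denseRange_of_neg_inverse (hd : Dense (B.domain : Set E))
    (hR : ∀ x, R (B x) = -(x : E)) : DenseRange R := by
  refine hd.mono fun x hx => ⟨-B ⟨x, hx⟩, ?_⟩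
  rw [map_neg, hR, neg_neg]

/-- The condition on the right is closed and holds on the graph. Conversely y ↦ (-R y, y) is
continuous and takes values in the graph when y lies in the dense range of B. -/
theorem closure_graph_of_neg_inverse (hr : DenseRange B) (hR : ∀ x, R (B x) = -(x : E)) (x y : E) :
    (x, y) ∈ B.graph.topologicalClosure ↔ R y = -x := by
  constructor
  · intro h
    have hc : IsClosed {q : E × E | R q.2 = -q.1} :=
      isClosed_eq (R.continuous.comp continuous_snd) continuous_fst.neg
    refine closure_minimal ?_ hc h
    intro q hq
    obtain ⟨z, h1, h2⟩ := LinearPMap.mem_graph_iff _ |>.1 hq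
    rw [Set.mem_ofPred_eq, ← h1, ← h2, hR]
  · intro h
    obtain rfl : x = -R y := by rw [h, neg_neg]
    refine hr.induction_on (p := fun y => (-R y, y) ∈ B.graph.topologicalClosure) y ?_ ?_
    · exact B.graph.isClosed_topologicalClosure.preimage
        (R.continuous.neg.prodMk continuous_id)
    · intro z
      rw [hR, neg_neg]
      exact B.graph.le_topologicalClosure (LinearPMap.mem_graph _ z)

/-- A pair (0, y) in the closed graph has R y = 0, so injectivity of R makes the closure
single-valued. -/
theorem isClosable_of_neg_inverse (hA : IsAccretive R) (hdR : DenseRange R) (hr : DenseRange B)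
    (hR : ∀ x, R (B x) = -(x : E)) : B.IsClosable := by
  refine ⟨B.graph.topologicalClosure.toLinearPMap, (Submodule.toLinearPMap_graph_eq _ ?_).symm⟩
  rintro ⟨x, y⟩ h h0
  rw [closure_graph_of_neg_inverse hr hR] at h
  simp only at h0
  rw [h0, neg_zero] at h
  exact hA.injective hdR h

theorem inResolventSet_zero {C : E →ₗ.[ℂ] E} (hC : ∀ x y, (x, y) ∈ C.graph ↔ R y = -x) :
    InResolventSet C 0 := by
  refine ⟨R, fun y => ?_, fun x => ?_⟩
  · have h : (R y, -y) ∈ C.graph := (hC _ _).2 (by rw [map_neg])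
    obtain ⟨z, h1, h2⟩ := (LinearPMap.mem_graph_iff _).1 h
    simp only at h1 h2
    have hm : R y ∈ C.domain := h1 ▸ z.2
    refine ⟨hm, ?_⟩
    rw [show (⟨R y, hm⟩ : C.domain) = z from Subtype.ext h1.symm, h2]
    simp
  · have := (hC _ _).1 (LinearPMap.mem_graph _ x)
    rw [zero_smul, zero_sub, map_neg, this, neg_neg]

/-! ### Exponentials of bounded dissipative operators -/

variable [CompleteSpace E]

theorem hasDerivAt_exp_apply (G : E →L[ℂ] E) (x : E) (t : ℝ) :
    HasDerivAt (fun t : ℝ => NormedSpace.exp (t • G) x) (NormedSpace.exp (t • G) (G x)) t := by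
  have h := hasDerivAt_exp_smul_const (𝕂 := ℝ) G t
  exact ((ContinuousLinearMap.apply ℂ E x).restrictScalars ℝ).hasFDerivAt.comp_hasDerivAt t h

theorem exp_apply_comm {G H : E →L[ℂ] E} (h : ∀ x, G (H x) = H (G x)) (t : ℝ) (x : E) :
    NormedSpace.exp (t • G) (H x) = H (NormedSpace.exp (t • G) x) := by
  have hc : Commute G H := ContinuousLinearMap.ext h
  exact DFunLike.congr_fun ((hc.smul_left t).exp_left).eq x

/-- The derivative of ‖exp(sG)x‖² is twice Re⟨G·, ·⟩ along the orbit. -/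
theorem norm_exp_apply_le {G : E →L[ℂ] E} (hG : ∀ x, (inner ℂ (G x) x).re ≤ 0) {t : ℝ}
    (ht : 0 ≤ t) (x : E) : ‖NormedSpace.exp (t • G) x‖ ≤ ‖x‖ := by
  have hd : ∀ s : ℝ, HasDerivAt (fun s : ℝ => ‖NormedSpace.exp (s • G) x‖ ^ 2)
      (2 * (inner ℂ (G (NormedSpace.exp (s • G) x)) (NormedSpace.exp (s • G) x)).re) s := by
    intro s
    let _ : InnerProductSpace ℝ E := InnerProductSpace.rclikeToReal ℂ E
    have h := (hasDerivAt_exp_apply G x s).norm_sq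
    rw [exp_apply_comm (fun _ => rfl)] at h
    convert h using 2
    rw [← inner_conj_symm, Complex.conj_re]
    rfl
  have ha : AntitoneOn (fun s : ℝ => ‖NormedSpace.exp (s • G) x‖ ^ 2) (Ici 0) := by
    refine antitoneOn_of_deriv_nonpos (convex_Ici 0)
      (fun s _ => (hd s).continuousAt.continuousWithinAt)
      (fun s _ => (hd s).differentiableAt.differentiableWithinAt) fun s _ => ?_
    rw [(hd s).deriv]
    have := hG (NormedSpace.exp (s • G) x)
    linarith
  have h := ha (mem_Ici.2 le_rfl) ht ht
  simp only [zero_smul, NormedSpace.exp_zero, one_apply_eq_self] at h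
  exact le_of_sq_le_sq h (norm_nonneg _)

/-- Commutation brings G - H next to x in the derivative of the interpolating path, and both
exponentials are contractions for 0 ≤ s ≤ t. This is what makes the Yosida exponentials Cauchy. -/
theorem norm_exp_sub_exp_le {G H : E →L[ℂ] E} (hG : ∀ x, (inner ℂ (G x) x).re ≤ 0)
    (hH : ∀ x, (inner ℂ (H x) x).re ≤ 0) (hc : ∀ x, G (H x) = H (G x)) {t : ℝ} (ht : 0 ≤ t)
    (x : E) : ‖NormedSpace.exp (t • G) x - NormedSpace.exp (t • H) x‖ ≤ ‖G x - H x‖ * t := by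
  -- the path `s ↦ exp (s G) exp ((t - s) H) x`
  have hd : ∀ s : ℝ, HasDerivAt
      (fun s : ℝ => NormedSpace.exp (s • G) (NormedSpace.exp ((t - s) • H) x))
      (NormedSpace.exp (s • G) (NormedSpace.exp ((t - s) • H) (G x - H x))) s := by
    intro s
    have h1 := hasDerivAt_exp_smul_const (𝕂 := ℝ) G s
    have h2 : HasDerivAt (fun s : ℝ => NormedSpace.exp ((t - s) • H) x)
        (-(NormedSpace.exp ((t - s) • H) (H x))) s := by
      have := (hasDerivAt_exp_apply H x (t - s)).scomp s ((hasDerivAt_id s).const_sub t)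
      simpa using! this
    have h3 : HasDerivAt
        (fun s : ℝ => NormedSpace.exp (s • G) (NormedSpace.exp ((t - s) • H) x))
        (NormedSpace.exp (s • G) (G (NormedSpace.exp ((t - s) • H) x))
          + NormedSpace.exp (s • G) (-(NormedSpace.exp ((t - s) • H) (H x)))) s :=
      ((ContinuousLinearMap.restrictScalarsL ℂ E E ℝ ℝ).hasFDerivAt.comp_hasDerivAt s
        h1).clm_apply h2
    have e : G (NormedSpace.exp ((t - s) • H) x) = NormedSpace.exp ((t - s) • H) (G x) :=
      (exp_apply_comm (fun x => (hc x).symm) _ _).symm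
    rwa [e, ← map_add, ← sub_eq_add_neg, ← map_sub] at h3
  -- The path is rescaled to [0, 1] by s = t r, whence the factor t in the derivative.
  have hb := norm_image_sub_le_of_norm_deriv_le_segment_01' (f := fun r : ℝ =>
    NormedSpace.exp ((t * r) • G) (NormedSpace.exp ((t - t * r) • H) x))
    (f' := fun r : ℝ => t • NormedSpace.exp ((t * r) • G)
      (NormedSpace.exp ((t - t * r) • H) (G x - H x))) (C := ‖G x - H x‖ * t) ?_ ?_
  · simpa using hb
  · intro r _
    have := (hd (t * r)).scomp r ((hasDerivAt_id r).const_mul t)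
    simp only [mul_one] at this
    exact this.hasDerivWithinAt
  · intro r hr
    rw [norm_smul, Real.norm_of_nonneg ht, mul_comm]
    refine mul_le_mul_of_nonneg_right ?_ ht
    refine (norm_exp_apply_le hG (mul_nonneg ht hr.1) _).trans (norm_exp_apply_le hH ?_ _)
    nlinarith [hr.2]

end Abstract

section Semigroup

variable {E : Type*} [NormedAddCommGroup E] [InnerProductSpace ℂ E] {R : E →L[ℂ] E}

/-! ### Construction of the semigroup by Yosida approximation -/

/-- Equibounded operators that tend to 0 on a dense set tend to 0 everywhere. With |M| + 1 in place
of M, no sign of M is needed. -/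
theorem tendsto_zero_of_denseRange {ι : Type*} {l : Filter ι} {T : ι → E →L[ℂ] E} {M : ℝ}
    (hT : ∀ i x, ‖T i x‖ ≤ M * ‖x‖) (hd : DenseRange R)
    (h : ∀ z, Tendsto (fun i => T i (R z)) l (𝓝 0)) (x : E) :
    Tendsto (fun i => T i x) l (𝓝 0) := by
  rw [Metric.tendsto_nhds]
  intro ε hε
  obtain ⟨z, hz⟩ := hd.exists_dist_lt x (show 0 < ε / 2 / (|M| + 1) by positivity)
  filter_upwards [Metric.tendsto_nhds.1 (h z) (ε / 2) (by positivity)] with i hi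
  rw [dist_zero_right] at hi ⊢
  have h1 : ‖T i (x - R z)‖ ≤ (|M| + 1) * ‖x - R z‖ :=
    (hT i _).trans (mul_le_mul_of_nonneg_right ((le_abs_self M).trans (by linarith))
      (norm_nonneg _))
  have h2 : (|M| + 1) * ‖x - R z‖ < ε / 2 := by
    rw [dist_eq_norm, lt_div_iff₀ (by positivity)] at hz
    linarith
  have h3 : T i x = T i (x - R z) + T i (R z) := by rw [← map_add, sub_add_cancel]
  calc ‖T i x‖ ≤ ‖T i (x - R z)‖ + ‖T i (R z)‖ := by rw [h3]; exact norm_add_le _ _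
    _ < ε := by linarith

variable [CompleteSpace E]

/-- Re⟨(ε + R)x, x⟩ ≥ ε‖x‖² makes ε + R invertible; G is minus its inverse. -/
theorem IsAccretive.exists_resolvent (hA : IsAccretive R) {ε : ℝ} (hε : 0 < ε) :
    ∃ G : E →L[ℂ] E, (∀ x, (ε : ℂ) • G x + R (G x) = -x) ∧ ∀ x, G (R x) = R (G x) := by
  set f : E →L[ℂ] E := (ε : ℂ) • 1 + R with hf
  have hu : IsUnit f := by
    refine ContinuousLinearMap.isUnit_of_forall_le_norm_inner_map f (c := ⟨ε, hε.le⟩) hε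
      fun x => ?_
    have e : (inner ℂ (f x) x).re = ε * ‖x‖ ^ 2 + (inner ℂ (R x) x).re := by
      have : f x = (ε : ℂ) • x + R x := rfl
      rw [this, inner_add_left, inner_smul_left, Complex.conj_ofReal, Complex.add_re,
        Complex.re_ofReal_mul]
      congr 2
      exact inner_self_eq_norm_sq (𝕜 := ℂ) x
    have h1 := Complex.re_le_norm (inner ℂ (f x) x)
    have h2 := hA x
    change ‖x‖ ^ 2 * ε ≤ _
    linarith
  obtain ⟨⟨f, g, h1, h2⟩, rfl⟩ := hu
  change f = _ at hf
  have k1 : ∀ x, (ε : ℂ) • g x + R (g x) = x := fun x => by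
    have := DFunLike.congr_fun h1 x
    rw [hf] at this
    exact this
  have k2 : ∀ x, g ((ε : ℂ) • x + R x) = x := fun x => by
    have := DFunLike.congr_fun h2 x
    rw [hf] at this
    exact this
  refine ⟨-g, fun x => ?_, fun x => ?_⟩
  · have := k1 x
    simp only [neg_apply, smul_neg, map_neg]
    rw [← neg_add, this]
  · have a1 := k1 x
    have a2 := k2 x
    rw [map_add, map_smul] at a2
    simp only [neg_apply, map_neg]
    rw [neg_inj]
    exact add_left_cancel (a2.trans a1.symm)

/-- The Yosida approximations `-(εₙ + R)⁻¹`, `εₙ = (n + 1)⁻¹`, of the operator `-R⁻¹`. -/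
theorem IsAccretive.exists_yosida (hA : IsAccretive R) (hd : DenseRange R) :
    ∃ G : ℕ → E →L[ℂ] E, (∀ n x, (inner ℂ (G n x) x).re ≤ 0) ∧
      (∀ n x, G n (R x) = R (G n x)) ∧ (∀ n m x, G n (G m x) = G m (G n x)) ∧
      (∀ n x, ‖G n (R x)‖ ≤ 2 * ‖x‖) ∧ ∀ x, Tendsto (fun n => G n (R x)) atTop (𝓝 (-x)) := by
  set ε : ℕ → ℝ := fun n => 1 / ((n : ℝ) + 1) with hεd
  have hε : ∀ n, 0 < ε n := fun n => Nat.one_div_pos_of_nat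
  choose G h1 h2 using fun n => hA.exists_resolvent (hε n)
  -- Pairing x = -(ε G x + R G x) with G x yields at once that G is dissipative and that ‖ε G‖ ≤ 1.
  have hre : ∀ n x, ε n * ‖G n x‖ ^ 2 ≤ -(inner ℂ (G n x) x).re := by
    intro n x
    have e : -(inner ℂ (G n x) x).re = ε n * ‖G n x‖ ^ 2 + (inner ℂ (R (G n x)) (G n x)).re := by
      have hx : x = -((ε n : ℂ) • G n x + R (G n x)) := by rw [h1, neg_neg]
      have hx' : inner ℂ (G n x) x = -(((ε n : ℝ) : ℂ) * inner ℂ (G n x) (G n x)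
          + inner ℂ (G n x) (R (G n x))) := by
        conv_lhs => rw [hx]
        rw [inner_neg_right, inner_add_right, inner_smul_right, ← hx]
      rw [hx', Complex.neg_re, neg_neg, Complex.add_re, Complex.re_ofReal_mul,
        ← inner_conj_symm (G n x) (R (G n x)), Complex.conj_re]
      congr 2
      exact inner_self_eq_norm_sq (𝕜 := ℂ) _
    rw [e]
    linarith [hA (G n x)]
  have hb : ∀ n x, ‖((ε n : ℂ) • G n) x‖ ≤ 1 * ‖x‖ := by
    intro n x
    rw [smul_apply, norm_smul, Complex.norm_real, Real.norm_of_nonneg (hε n).le,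
      one_mul]
    by_cases h0 : ‖G n x‖ = 0
    · rw [h0, mul_zero]; exact norm_nonneg _
    · have h3 : -(inner ℂ (G n x) x).re ≤ ‖G n x‖ * ‖x‖ :=
        (neg_le_abs _).trans ((Complex.abs_re_le_norm _).trans (norm_inner_le_norm _ _))
      have h4 := hre n x
      have h5 : 0 < ‖G n x‖ := lt_of_le_of_ne (norm_nonneg _) (Ne.symm h0)
      nlinarith
  -- This identity reduces the convergence G R x → -x to ε G x → 0, which is clear on the range of
  -- R, where G R z is bounded, and extends by density.
  have hs : ∀ n x, G n (R x) = -x - ((ε n : ℂ) • G n) x := by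
    intro n x
    rw [h2, smul_apply, ← h1 n x]
    abel
  have hn : ∀ n x, ‖G n (R x)‖ ≤ 2 * ‖x‖ := by
    intro n x
    rw [hs]
    refine (norm_sub_le _ _).trans ?_
    rw [norm_neg]
    linarith [hb n x]
  refine ⟨G, fun n x => ?_, h2, fun n m x => ?_, hn, fun x => ?_⟩
  · have := hre n x
    have : 0 ≤ ε n * ‖G n x‖ ^ 2 := mul_nonneg (hε n).le (by positivity)
    linarith
  · have inj : ∀ y, G n ((ε n : ℂ) • y + R y) = -y := fun y => by
      rw [map_add, map_smul, h2, h1]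
    have e : (ε n : ℂ) • G m (G n x) + R (G m (G n x)) = -(G m x) := by
      rw [← h2, ← map_smul, ← map_add, h1, map_neg]
    have := inj (G m (G n x))
    rw [e, map_neg, neg_inj] at this
    exact this
  · have h0 : Tendsto (fun n => ((ε n : ℂ) • G n) x) atTop (𝓝 0) := by
      refine tendsto_zero_of_denseRange hb hd (fun z => ?_) x
      refine squeeze_zero_norm (a := fun n => ε n * (2 * ‖z‖)) (fun n => ?_) ?_
      · rw [smul_apply, norm_smul, Complex.norm_real,
          Real.norm_of_nonneg (hε n).le]
        exact mul_le_mul_of_nonneg_left (hn n z) (hε n).le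
      · simpa [hεd] using (tendsto_one_div_add_atTop_nhds_zero_nat (𝕜 := ℝ)).mul_const (2 * ‖z‖)
    simp only [hs]
    simpa using h0.const_sub (-x)

theorem norm_exp_sub_exp_same_le {G : E →L[ℂ] E} (hG : ∀ x, (inner ℂ (G x) x).re ≤ 0) {s t : ℝ}
    (hs : 0 ≤ s) (ht : 0 ≤ t) (x : E) :
    ‖NormedSpace.exp (t • G) x - NormedSpace.exp (s • G) x‖ ≤ ‖G x‖ * |t - s| :=
  (convex_Ici (0 : ℝ)).norm_image_sub_le_of_norm_hasDerivWithin_le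
    (fun r _ => (hasDerivAt_exp_apply G x r).hasDerivWithinAt)
    (fun _ hr => norm_exp_apply_le hG hr _) hs ht

/-- An accretive `R` with dense range is `-B⁻¹` for the generator `B` of a semigroup of
contractions. -/
theorem IsAccretive.exists_semigroup (hA : IsAccretive R) (hd : DenseRange R) :
    ∃ S : ContractionSemigroup E, (∀ t x, R (S.toFun t x) = S.toFun t (R x)) ∧
      ∀ (t : ℝ) (x : E), 0 ≤ t → S.toFun t.toNNReal (R x) - R x
        = -∫ s in (0 : ℝ)..t, S.toFun s.toNNReal x := by
  obtain ⟨G, hdis, hcR, hcG, hbd, hlim⟩ := hA.exists_yosida hd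
  let T : ℕ → ℝ → E →L[ℂ] E := fun n t => NormedSpace.exp (t • G n)
  have hT : ∀ n (t : ℝ≥0) x, ‖T n t x‖ ≤ ‖x‖ := fun n t x => norm_exp_apply_le (hdis n) t.2 x
  -- On the range of R the sequence is Cauchy because Gₙ R z converges; contractivity carries this
  -- to all x.
  have hex : ∀ (t : ℝ≥0) x, ∃ y, Tendsto (fun n => T n t x) atTop (𝓝 y) := by
    intro t x
    refine cauchySeq_tendsto_of_complete (cauchySeq_iff_tendsto_dist_atTop_0.2 ?_)
    simp only [dist_eq_norm]
    have h := tendsto_zero_of_denseRange (l := atTop) (T := fun q : ℕ × ℕ => T q.1 t - T q.2 t)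
      (M := 2) (fun q x => ?_) hd (fun z => ?_) x
    · simpa using h.norm
    · rw [sub_apply]
      refine (norm_sub_le _ _).trans ?_
      linarith [hT q.1 t x, hT q.2 t x]
    · have h1 : Tendsto (fun q : ℕ × ℕ => ‖G q.1 (R z) - G q.2 (R z)‖ * (t : ℝ)) atTop (𝓝 0) := by
        have := ((((hlim z).comp tendsto_fst).sub ((hlim z).comp tendsto_snd)).norm).mul_const
          (t : ℝ)
        rw [prod_atTop_atTop_eq] at this
        simpa using this
      exact squeeze_zero_norm (fun q => norm_exp_sub_exp_le (hdis _) (hdis _) (hcG _ _) t.2 _) h1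
  choose Sf hSf using hex
  have hle : ∀ t x, ‖Sf t x‖ ≤ ‖x‖ := fun t x =>
    le_of_tendsto (hSf t x).norm (Eventually.of_forall fun n => hT n t x)
  let S : ℝ≥0 → E →L[ℂ] E := fun t => LinearMap.mkContinuous
    { toFun := Sf t
      map_add' := fun x y => tendsto_nhds_unique (hSf t (x + y)) (by
        simpa using (hSf t x).add (hSf t y))
      map_smul' := fun c x => tendsto_nhds_unique (hSf t (c • x)) (by
        simpa using (hSf t x).const_smul c) } 1 (fun x => by simpa using hle t x)
  have hS : ∀ (t : ℝ≥0) x, Tendsto (fun n => T n t x) atTop (𝓝 (S t x)) := hSf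
  have hSle : ∀ t x, ‖S t x‖ ≤ ‖x‖ := hle
  have hSR : ∀ t x, R (S t x) = S t (R x) := fun t x => by
    refine tendsto_nhds_unique ((R.continuous.tendsto _).comp (hS t x)) ?_
    refine (hS t (R x)).congr fun n => ?_
    exact exp_apply_comm (hcR n) _ _
  -- Orbits starting at R z are Lipschitz with constant 2‖z‖, a bound inherited from the
  -- approximations; all other orbits are uniform limits of these.
  have hcont : ∀ x, Continuous fun t : ℝ≥0 => S t x := by
    intro x
    refine continuous_of_uniform_approx_of_continuous fun u hu => ?_
    obtain ⟨ε, hε, hu⟩ := Metric.mem_uniformity_dist.1 hu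
    obtain ⟨z, hz⟩ := hd.exists_dist_lt x hε
    refine ⟨fun t => S t (R z), ?_, fun t => hu ?_⟩
    · have hl : LipschitzWith (Real.toNNReal (2 * ‖z‖)) fun t => S t (R z) := by
        refine LipschitzWith.of_dist_le_mul fun t s => ?_
        rw [dist_eq_norm, Real.coe_toNNReal _ (by positivity)]
        refine le_of_tendsto ((hS t _).sub (hS s _)).norm (Eventually.of_forall fun n => ?_)
        refine (norm_exp_sub_exp_same_le (hdis n) s.2 t.2 _).trans ?_
        exact mul_le_mul_of_nonneg_right (hbd n z) (abs_nonneg _)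
      exact hl.continuous
    · rw [dist_eq_norm, ← map_sub]
      exact (hSle _ _).trans_lt (by rwa [← dist_eq_norm])
  refine ⟨⟨S, ?_, ?_, hcont, ?_⟩, hSR, ?_⟩
  · ext x
    refine tendsto_nhds_unique (hS 0 x) ?_
    simp [T]
  · intro s t
    ext x
    refine tendsto_nhds_unique (hS (s + t) x) ?_
    have e : ∀ n, T n ((s + t : ℝ≥0) : ℝ) x = T n s (T n t x - S t x) + T n s (S t x) := by
      intro n
      have hc : Commute ((s : ℝ) • G n) ((t : ℝ) • G n) :=
        ((Commute.refl (G n)).smul_left _).smul_right _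
      have : T n ((s + t : ℝ≥0) : ℝ) = T n s * T n t := by
        simp only [T, NNReal.coe_add, add_smul]
        let _ : NormedAlgebra ℚ (E →L[ℂ] E) := NormedAlgebra.restrictScalars ℚ ℂ _
        exact NormedSpace.exp_add_of_commute hc
      rw [this, ← map_add, sub_add_cancel]
      rfl
    simp only [e]
    have h1 : Tendsto (fun n => T n s (T n t x - S t x)) atTop (𝓝 0) := by
      refine squeeze_zero_norm (fun n => hT n s _) ?_
      simpa using ((hS t x).sub_const (S t x)).norm
    simpa using h1.add (hS s (S t x))
  · exact fun t => ContinuousLinearMap.opNorm_le_bound _ zero_le_one fun x => by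
      simpa using hSle t x
  · intro t x ht
    have h1 : ∀ n, T n (t.toNNReal : ℝ) (R x) - R x = ∫ s in (0 : ℝ)..t, T n s (G n (R x)) := by
      intro n
      rw [intervalIntegral.integral_eq_sub_of_hasDerivAt
        (fun s _ => hasDerivAt_exp_apply (G n) (R x) s)]
      · simp [T, Real.coe_toNNReal t ht]
      · refine Continuous.intervalIntegrable ?_ _ _
        exact continuous_iff_continuousAt.2 fun s =>
          (hasDerivAt_exp_apply (G n) (G n (R x)) s).continuousAt
    have h2 : Tendsto (fun n => T n (t.toNNReal : ℝ) (R x) - R x) atTop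
        (𝓝 (S t.toNNReal (R x) - R x)) := (hS _ _).sub_const _
    simp only [h1] at h2
    refine tendsto_nhds_unique h2 ?_
    rw [← intervalIntegral.integral_neg]
    refine intervalIntegral.tendsto_integral_filter_of_dominated_convergence (fun _ => 2 * ‖x‖)
      ?_ ?_ (by simp) ?_
    · refine Eventually.of_forall fun n => Continuous.aestronglyMeasurable ?_
      exact continuous_iff_continuousAt.2 fun s =>
        (hasDerivAt_exp_apply (G n) (G n (R x)) s).continuousAt
    · refine Eventually.of_forall fun n => Eventually.of_forall fun s hs => ?_
      rw [uIoc_of_le ht] at hs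
      exact (norm_exp_apply_le (hdis n) hs.1.le _).trans (hbd n x)
    · refine Eventually.of_forall fun s hs => ?_
      rw [uIoc_of_le ht] at hs
      have hs' : ((s.toNNReal : ℝ≥0) : ℝ) = s := Real.coe_toNNReal s hs.1.le
      -- Operator and argument both vary with n: contractivity disposes of the moving argument Gₙ R
      -- x + x → 0, leaving Tₙ(s) at the fixed vector x.
      have e : ∀ n, T n s (G n (R x)) = T n s (G n (R x) + x) - T n s x := by
        intro n
        rw [← map_sub, add_sub_cancel_right]
      simp only [e]
      have a1 : Tendsto (fun n => T n s (G n (R x) + x)) atTop (𝓝 0) := by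
        refine squeeze_zero_norm (fun n => norm_exp_apply_le (hdis n) hs.1.le _) ?_
        simpa using ((hlim x).add_const x).norm
      have a2 := hS s.toNNReal x
      rw [hs'] at a2
      simpa using a1.sub a2

end Semigroup

/-! ### Generator, weak solutions and regularity of orbits, from the integrated identity. -/

section Solutions

variable {E : Type*} [NormedAddCommGroup E] [InnerProductSpace ℂ E] {R : E →L[ℂ] E}
  {S : ContractionSemigroup E}

theorem ContractionSemigroup.continuous_orbit (S : ContractionSemigroup E) (x : E) :
    Continuous fun t : ℝ => S.toFun t.toNNReal x :=
  (S.continuous_apply x).comp continuous_real_toNNReal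

/-- For x = -R y the integrated identity reads S(t)x = x + ∫₀ᵗ S(s)y ds, so the fundamental theorem
of calculus applies. -/
theorem hasDerivWithinAt_orbit [CompleteSpace E] (hS : ∀ (t : ℝ) (x : E), 0 ≤ t →
      S.toFun t.toNNReal (R x) - R x = -∫ s in (0 : ℝ)..t, S.toFun s.toNNReal x)
    {x y : E} (hxy : R y = -x) {t : ℝ} (ht : 0 ≤ t) :
    HasDerivWithinAt (fun t : ℝ => S.toFun t.toNNReal x) (S.toFun t.toNNReal y) (Ici 0) t := by
  have hc := S.continuous_orbit y
  have h : HasDerivAt (fun t : ℝ => x + ∫ s in (0 : ℝ)..t, S.toFun s.toNNReal y)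
      (S.toFun t.toNNReal y) t :=
    (intervalIntegral.integral_hasDerivAt_right (hc.intervalIntegrable _ _)
      (hc.stronglyMeasurableAtFilter _ _) hc.continuousAt).const_add x
  have e : ∀ r ∈ Ici (0 : ℝ), S.toFun r.toNNReal x = x + ∫ s in (0 : ℝ)..r, S.toFun s.toNNReal y := by
    intro r hr
    have := hS r y hr
    rw [hxy, map_neg] at this
    rw [← sub_eq_iff_eq_add', ← neg_inj, ← this]
    abel
  exact h.hasDerivWithinAt.congr e (e t ht)

/-- For the converse, R is applied to the difference quotients at x: they become those at R x, which
converge to -x, and therefore R y = -x. -/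
theorem isGenerator_of_neg_inverse [CompleteSpace E] {C : E →ₗ.[ℂ] E}
    (hC : ∀ x y, (x, y) ∈ C.graph ↔ R y = -x)
    (hSR : ∀ t x, R (S.toFun t x) = S.toFun t (R x)) (hS : ∀ (t : ℝ) (x : E), 0 ≤ t →
      S.toFun t.toNNReal (R x) - R x = -∫ s in (0 : ℝ)..t, S.toFun s.toNNReal x) :
    IsGenerator C S := by
  have key : ∀ {x y : E}, R y = -x →
      Tendsto (fun t : ℝ≥0 => (t : ℝ)⁻¹ • (S.toFun t x - x)) (𝓝[>] 0) (𝓝 y) := by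
    intro x y hxy
    have h := hasDerivWithinAt_orbit hS hxy le_rfl
    rw [hasDerivWithinAt_iff_tendsto_slope] at h
    have hc : Tendsto (fun t : ℝ≥0 => (t : ℝ)) (𝓝[>] 0) (𝓝[Ici 0 \ {0}] 0) := by
      refine tendsto_nhdsWithin_iff.2 ⟨?_, ?_⟩
      · exact (NNReal.continuous_coe.tendsto 0).mono_left nhdsWithin_le_nhds
      · filter_upwards [self_mem_nhdsWithin] with t ht
        exact ⟨t.2, fun h0 => ne_of_gt (mem_Ioi.1 ht) (NNReal.coe_eq_zero.1 h0)⟩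
    have h2 := h.comp hc
    simpa [Function.comp_def, slope_def_module, S.map_zero] using h2
  intro x y
  rw [hC]
  refine ⟨key, fun h => ?_⟩
  have h1 := (R.continuous.tendsto _).comp h
  have h2 := key (x := R x) (y := -x) (by rw [map_neg])
  refine tendsto_nhds_unique h1 (h2.congr fun t => ?_)
  rw [Function.comp_apply, ← hSR, ← map_sub, ← Complex.coe_smul, ← Complex.coe_smul, map_smul]

/-- The duality identity is a closed condition on pairs, so the adjoint of B also tests the closure
of B. -/
theorem adjoint_inner_of_mem_closure [CompleteSpace E] {B : E →ₗ.[ℂ] E}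
    (hd : Dense (B.domain : Set E)) (V : B.adjoint.domain)
    {x y : E} (h : (x, y) ∈ B.graph.topologicalClosure) :
    inner ℂ (V : E) y = inner ℂ (B.adjoint V) x := by
  have hc : IsClosed {q : E × E | inner ℂ (V : E) q.2 = inner ℂ (B.adjoint V) q.1} :=
    isClosed_eq (continuous_const.inner continuous_snd) (continuous_const.inner continuous_fst)
  refine closure_minimal ?_ hc h
  intro q hq
  obtain ⟨z, h1, h2⟩ := (LinearPMap.mem_graph_iff _).1 hq
  rw [Set.mem_ofPred_eq, ← h1, ← h2]
  exact (LinearPMap.adjoint_isFormalAdjoint hd V z).symm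

theorem inner_intervalIntegral [CompleteSpace E] (w : E) {f : ℝ → E} (hf : Continuous f) (a b : ℝ) :
    inner ℂ w (∫ s in a..b, f s) = ∫ s in a..b, inner ℂ w (f s) :=
  ((innerSL ℂ w).intervalIntegral_comp_comm (hf.intervalIntegrable a b)).symm

/-- For every x, in the domain or not, (∫₀ᵗ S(s)x ds, S(t)x - x) lies in the closed graph; pairing
with V gives the weak equation. -/
theorem isWeakSolution_orbit [CompleteSpace E] {B : E →ₗ.[ℂ] E} (hd : Dense (B.domain : Set E))
    (hB : ∀ x y, (x, y) ∈ B.graph.topologicalClosure ↔ R y = -x)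
    (hSR : ∀ t x, R (S.toFun t x) = S.toFun t (R x)) (hS : ∀ (t : ℝ) (x : E), 0 ≤ t →
      S.toFun t.toNNReal (R x) - R x = -∫ s in (0 : ℝ)..t, S.toFun s.toNNReal x) (x : E) :
    IsWeakSolution B x fun t => S.toFun t.toNNReal x := by
  refine ⟨(S.continuous_orbit x).continuousOn, by simp [S.map_zero], fun V t ht => ?_⟩
  have h := adjoint_inner_of_mem_closure hd V ((hB (∫ s in (0 : ℝ)..t, S.toFun s.toNNReal x)
    (S.toFun t.toNNReal x - x)).2 (by rw [map_sub, hSR, hS t x ht]))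
  rw [inner_sub_right, inner_intervalIntegral _ (S.continuous_orbit x)] at h
  rw [← h, add_sub_cancel]

/-- With Y = ∫W one has Y = -R W, so (‖Y‖²)' = -2 Re⟨R W, W⟩ ≤ 0 and Y vanishes; then R W = 0. -/
theorem IsAccretive.eq_zero_of_integral_eq [CompleteSpace E] (hA : IsAccretive R)
    (hdR : DenseRange R) {W : ℝ → E} (hW : Continuous W)
    (h : ∀ t, 0 ≤ t → R (W t) = -∫ s in (0 : ℝ)..t, W s) {t : ℝ} (ht : 0 ≤ t) : W t = 0 := by
  set Y : ℝ → E := fun t => ∫ s in (0 : ℝ)..t, W s with hY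
  have hd : ∀ t, HasDerivAt Y (W t) t := fun t =>
    intervalIntegral.integral_hasDerivAt_right (hW.intervalIntegrable _ _)
      (hW.stronglyMeasurableAtFilter _ _) hW.continuousAt
  have hd2 : ∀ t, HasDerivAt (fun t => ‖Y t‖ ^ 2) (2 * (inner ℂ (Y t) (W t)).re) t := by
    intro t
    let _ : InnerProductSpace ℝ E := InnerProductSpace.rclikeToReal ℂ E
    exact (hd t).norm_sq
  have ha : AntitoneOn (fun t => ‖Y t‖ ^ 2) (Ici 0) := by
    refine antitoneOn_of_deriv_nonpos (convex_Ici 0)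
      (fun s _ => (hd2 s).continuousAt.continuousWithinAt)
      (fun s _ => (hd2 s).differentiableAt.differentiableWithinAt) fun s hs => ?_
    rw [interior_Ici] at hs
    have e : Y s = -R (W s) := by rw [h s (le_of_lt hs), neg_neg]
    rw [(hd2 s).deriv, e, inner_neg_left, Complex.neg_re]
    linarith [hA (W s)]
  have h0 := ha (mem_Ici.2 le_rfl) ht ht
  have hY0 : Y 0 = 0 := by simp [hY]
  have hYt : Y t = 0 := by
    simp only [hY0, norm_zero] at h0
    have : ‖Y t‖ = 0 := by nlinarith [norm_nonneg (Y t)]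
    exact norm_eq_zero.1 this
  refine hA.injective hdR ?_
  rw [h t ht, show (∫ s in (0 : ℝ)..t, W s) = 0 from hYt, neg_zero]

theorem IsWeakSolution.unique [CompleteSpace E] {B : E →ₗ.[ℂ] E} (hd : Dense (B.domain : Set E))
    (hA : IsAccretive R) (hdR : DenseRange R) (hR : ∀ x, R (B x) = -(x : E)) {x : E}
    {U U' : ℝ → E} (hU : IsWeakSolution B x U) (hU' : IsWeakSolution B x U') {t : ℝ} (ht : 0 ≤ t) :
    U' t = U t := by
  -- Weak solutions are controlled only on [0, ∞); freezing the time at `max s 0` gives a path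
  -- continuous on the whole line.
  have hW : Continuous fun s : ℝ => U' (max s 0) - U (max s 0) := by
    have hm : Continuous fun s : ℝ => max s 0 := continuous_id.max continuous_const
    exact (hU'.continuousOn.comp_continuous hm fun s => mem_Ici.2 (le_max_right _ _)).sub
      (hU.continuousOn.comp_continuous hm fun s => mem_Ici.2 (le_max_right _ _))
  have key := hA.eq_zero_of_integral_eq hdR hW (fun t ht => ?_) ht
  · simp only [max_eq_left ht] at key
    exact sub_eq_zero.1 key
  · refine ext_inner_left ℂ fun z => ?_
    -- The vectors R*z lie in the domain of the adjoint, with B*R*z = -z; since z is arbitrary, they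
    -- detect the whole of R W.
    have hz : ∀ x : B.domain, inner ℂ (-z) (x : E) = inner ℂ (ContinuousLinearMap.adjoint R z) (B x) := by
      intro x
      rw [ContinuousLinearMap.adjoint_inner_left, hR, inner_neg_left, inner_neg_right]
    let V : B.adjoint.domain := ⟨_, LinearPMap.mem_adjoint_domain_of_exists _ ⟨-z, hz⟩⟩
    have hV : B.adjoint V = -z := LinearPMap.adjoint_apply_eq hd V hz
    have hi : ∀ {U : ℝ → E}, IsWeakSolution B x U → IntervalIntegrable
        (fun s => inner ℂ (-z) (U s)) volume 0 t := by
      intro U hU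
      refine ContinuousOn.intervalIntegrable ?_
      rw [uIcc_of_le ht]
      exact (continuousOn_const.inner hU.continuousOn).mono Icc_subset_Ici_self
    have h1 := hU.weak V t ht
    have h2 := hU'.weak V t ht
    rw [hV] at h1 h2
    have h3 : inner ℂ (V : E) (U' t - U t)
        = ∫ s in (0 : ℝ)..t, inner ℂ (-z) (U' (max s 0) - U (max s 0)) := by
      rw [inner_sub_right, h1, h2, add_sub_add_left_eq_sub,
        ← intervalIntegral.integral_sub (hi hU') (hi hU)]
      refine intervalIntegral.integral_congr fun s hs => ?_
      rw [uIcc_of_le ht] at hs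
      simp only [max_eq_left hs.1, inner_sub_right]
    rw [max_eq_left ht, ← ContinuousLinearMap.adjoint_inner_left, inner_neg_right, ← inner_neg_left,
      inner_intervalIntegral _ hW, ← h3]

/-! ### Regularity of orbits -/

variable {T : E →ₗ.[ℂ] E}

theorem mem_graph_pcomp {B T : E →ₗ.[ℂ] E} {x y : E} :
    (x, y) ∈ (pcomp B T).graph ↔ ∃ z, (x, z) ∈ T.graph ∧ (z, y) ∈ B.graph := by
  simp only [LinearPMap.mem_graph_iff]
  constructor
  · rintro ⟨⟨_, w, hw, rfl⟩, h1, h2⟩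
    exact ⟨T w, ⟨w, h1, rfl⟩, ⟨T w, hw⟩, rfl, h2⟩
  · rintro ⟨_, ⟨w, h1, rfl⟩, ⟨v, hv⟩, rfl, h2⟩
    exact ⟨⟨w, w, hv, rfl⟩, h1, h2⟩

theorem mem_graph_ppow_zero {x y : E} : (x, y) ∈ (ppow T 0).graph ↔ x = y := by
  simp only [LinearPMap.mem_graph_iff]
  constructor
  · rintro ⟨z, h1, h2⟩
    exact h1.symm.trans h2
  · rintro rfl
    exact ⟨⟨x, Submodule.mem_top⟩, rfl, rfl⟩

theorem mem_graph_ppow_succ {n : ℕ} {x y : E} :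
    (x, y) ∈ (ppow T (n + 1)).graph ↔ ∃ z, (x, z) ∈ T.graph ∧ (z, y) ∈ (ppow T n).graph :=
  mem_graph_pcomp

/-- Powers are built with T applied first; differentiating T^i S(t)x needs T applied last. -/
theorem mem_graph_ppow_succ' {n : ℕ} {x y : E} :
    (x, y) ∈ (ppow T (n + 1)).graph ↔ ∃ z, (x, z) ∈ (ppow T n).graph ∧ (z, y) ∈ T.graph := by
  induction n generalizing x with
  | zero =>
    simp only [mem_graph_ppow_succ, mem_graph_ppow_zero]
    simp
  | succ n ih =>
    rw [mem_graph_ppow_succ]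
    simp only [ih, mem_graph_ppow_succ (n := n)]
    constructor
    · rintro ⟨a, h1, b, h2, h3⟩
      exact ⟨b, ⟨a, h1, h2⟩, h3⟩
    · rintro ⟨b, ⟨a, h1, h2⟩, h3⟩
      exact ⟨a, h1, b, h2, h3⟩

theorem mem_ppow_domain_succ {n : ℕ} {x y : E} (h : (x, y) ∈ T.graph) :
    x ∈ (ppow T (n + 1)).domain ↔ y ∈ (ppow T n).domain := by
  rw [LinearPMap.mem_domain_iff, LinearPMap.mem_domain_iff]
  simp only [mem_graph_ppow_succ]
  constructor
  · rintro ⟨w, z, h1, h2⟩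
    obtain rfl := LinearPMap.mem_graph_snd_inj _ h1 h rfl
    exact ⟨w, h2⟩
  · rintro ⟨w, h2⟩
    exact ⟨w, y, h, h2⟩

theorem ppow_graph_invariant (hT : ∀ t x y, (x, y) ∈ T.graph → (S.toFun t x, S.toFun t y) ∈ T.graph)
    (t : ℝ≥0) {n : ℕ} {x y : E} (h : (x, y) ∈ (ppow T n).graph) :
    (S.toFun t x, S.toFun t y) ∈ (ppow T n).graph := by
  induction n generalizing x with
  | zero =>
    rw [mem_graph_ppow_zero] at h ⊢
    rw [h]
  | succ n ih =>
    rw [mem_graph_ppow_succ] at h ⊢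
    obtain ⟨z, h1, h2⟩ := h
    exact ⟨_, hT t _ _ h1, ih h2⟩

/-- The orbit of a point of `D(Tʲ)`, as a path in `D(Tʲ)`. -/
def powOrbit (hT : ∀ t x y, (x, y) ∈ T.graph → (S.toFun t x, S.toFun t y) ∈ T.graph) {j : ℕ}
    (x : (ppow T j).domain) (t : ℝ) : PowDomain T j :=
  show ↥(ppow T j).domain from ⟨S.toFun t.toNNReal x,
    (ppow T j).mem_domain_of_mem_graph (ppow_graph_invariant hT _ ((ppow T j).mem_graph x))⟩

theorem powGraph_mem {j : ℕ} (x : PowDomain T j) (i : Fin (j + 1)) :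
    (x.val, powGraph T j x i) ∈ (ppow T i).graph :=
  (ppow T i).mem_graph (Submodule.inclusion (ppow_domain_anti T (Nat.lt_succ_iff.1 i.2)) x)

theorem powGraph_powOrbit
    (hT : ∀ t x y, (x, y) ∈ T.graph → (S.toFun t x, S.toFun t y) ∈ T.graph) {j : ℕ}
    (x : (ppow T j).domain) (t : ℝ) (i : Fin (j + 1)) {y : E} (hy : ((x : E), y) ∈ (ppow T i).graph) :
    powGraph T j (powOrbit hT x t) i = S.toFun t.toNNReal y :=
  LinearPMap.mem_graph_snd_inj _ (powGraph_mem (powOrbit hT x t) i)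
    (ppow_graph_invariant hT t.toNNReal hy) rfl

theorem isInducing_powGraph (T : E →ₗ.[ℂ] E) (j : ℕ) : IsInducing (powGraph T j) :=
  (AddMonoidHomClass.isometry_of_norm (powGraph T j) fun _ => rfl).isUniformInducing.isInducing

/-- The graph norm is induced by `powGraph`, so slopes converge as soon as their images do. No
completeness of D(Tʲ) is involved, which matters when T is not closed. -/
theorem hasDerivWithinAt_powGraph {j : ℕ} {f : ℝ → PowDomain T j} {f' : PowDomain T j} {s : Set ℝ}
    {t : ℝ} (h : HasDerivWithinAt (fun r => powGraph T j (f r)) (powGraph T j f') s t) :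
    HasDerivWithinAt f f' s t := by
  rw [hasDerivWithinAt_iff_tendsto_slope] at h ⊢
  rw [(isInducing_powGraph T j).tendsto_nhds_iff]
  refine h.congr fun r => ?_
  simp only [slope_def_module, Function.comp_apply]
  rw [← map_sub, ← Complex.coe_smul, ← Complex.coe_smul, map_smul]

/-- Induction on m: in D(Tʲ) the derivative of the orbit of x is the orbit of T x, and T x loses one
power of the domain. -/
theorem contDiffOn_powOrbit
    (hT : ∀ t x y, (x, y) ∈ T.graph → (S.toFun t x, S.toFun t y) ∈ T.graph)
    (hD : ∀ {x y : E} {t : ℝ}, (x, y) ∈ T.graph → 0 ≤ t →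
      HasDerivWithinAt (fun t : ℝ => S.toFun t.toNNReal x) (S.toFun t.toNNReal y) (Ici 0) t)
    {j : ℕ} (m : ℕ) (x : (ppow T j).domain) (hx : (x : E) ∈ (ppow T (j + m)).domain) :
    ContDiffOn ℝ m (powOrbit hT x) (Ici 0) := by
  induction m generalizing x with
  | zero =>
    rw [Nat.cast_zero, contDiffOn_zero]
    refine Continuous.continuousOn ((isInducing_powGraph T j).continuous_iff.2 ?_)
    refine continuous_pi fun i => ?_
    have hy := powGraph_mem (show PowDomain T j from x) i
    exact (S.continuous_orbit _).congr fun t => (powGraph_powOrbit hT x t i hy).symm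
  | succ m ih =>
    have hx1 : (x : E) ∈ T.domain := by
      have := ppow_domain_anti T (show 1 ≤ j + (m + 1) by omega) hx
      rw [LinearPMap.mem_domain_iff] at this
      obtain ⟨y, hy⟩ := this
      obtain ⟨z, h1, h2⟩ := mem_graph_ppow_succ'.1 hy
      obtain rfl := mem_graph_ppow_zero.1 h1
      exact T.mem_domain_of_mem_graph h2
    have hg : ((x : E), T ⟨x, hx1⟩) ∈ T.graph := T.mem_graph ⟨x, hx1⟩
    have hy2 : T ⟨x, hx1⟩ ∈ (ppow T (j + m)).domain := (mem_ppow_domain_succ hg).1 hx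
    set y : (ppow T j).domain := ⟨T ⟨x, hx1⟩, ppow_domain_anti T (Nat.le_add_right j m) hy2⟩ with hyd
    have hd : ∀ t ∈ Ici (0 : ℝ), HasDerivWithinAt (powOrbit hT x) (powOrbit hT y t) (Ici 0) t := by
      intro t ht
      refine hasDerivWithinAt_powGraph (hasDerivWithinAt_pi.2 fun i => ?_)
      have hyi := powGraph_mem (show PowDomain T j from y) i
      have h2 : ((x : E), powGraph T j (show PowDomain T j from y) i) ∈ (ppow T (i + 1)).graph := by
        rw [mem_graph_ppow_succ]
        exact ⟨_, hg, hyi⟩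
      -- Here z = Tⁱx, and Tⁱ(T x) = T z: the i-th component of the orbit is the orbit of z ∈ D(T),
      -- so it is differentiable.
      obtain ⟨z, hz1, hz2⟩ := mem_graph_ppow_succ'.1 h2
      simp only [powGraph_powOrbit hT x _ i hz1, powGraph_powOrbit hT y _ i hyi]
      exact hD hz2 ht
    have hm : (((m + 1 : ℕ) : ℕ∞) : WithTop ℕ∞) = (m : WithTop ℕ∞) + 1 := by push_cast; rfl
    change ContDiffOn ℝ (((m + 1 : ℕ) : ℕ∞) : WithTop ℕ∞) _ _
    rw [hm, contDiffOn_succ_iff_derivWithin (uniqueDiffOn_Ici 0)]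
    refine ⟨fun t ht => (hd t ht).differentiableWithinAt, fun h => by simp at h, ?_⟩
    exact (ih y hy2).congr fun t ht => (hd t ht).derivWithin (uniqueDiffOn_Ici 0 t ht)

theorem isCmInto_orbit
    (hT : ∀ t x y, (x, y) ∈ T.graph → (S.toFun t x, S.toFun t y) ∈ T.graph)
    (hD : ∀ {x y : E} {t : ℝ}, (x, y) ∈ T.graph → 0 ≤ t →
      HasDerivWithinAt (fun t : ℝ => S.toFun t.toNNReal x) (S.toFun t.toNNReal y) (Ici 0) t)
    {k : ℕ} {x : E} (hx : x ∈ (ppow T k).domain) {j : ℕ} (hj : j ≤ k) :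
    IsCmInto T (k - j) j fun t => S.toFun t.toNNReal x :=
  ⟨powOrbit hT ⟨x, ppow_domain_anti T hj hx⟩, fun _ _ => rfl,
    contDiffOn_powOrbit hT hD (k - j) _ (by rwa [Nat.add_sub_cancel' hj])⟩

end Solutions

/-! ### Sines and cosines -/

/-- The frequency `(n+1)π/L`, the square root of the eigenvalue. -/
def freq (L : ℝ) (n : ℕ) : ℝ := (n + 1) * Real.pi / L

theorem eigenval_eq (L : ℝ) (n : ℕ) : eigenval L n = freq L n ^ 2 := rfl

theorem freq_pos {L : ℝ} (hL : 0 < L) (n : ℕ) : 0 < freq L n :=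
  div_pos (mul_pos (by positivity) Real.pi_pos) hL

theorem eigenval_pos {L : ℝ} (hL : 0 < L) (n : ℕ) : 0 < eigenval L n := pow_pos (freq_pos hL n) 2

theorem freq_mul_length {L : ℝ} (hL : 0 < L) (n : ℕ) : freq L n * L = ((n + 1 : ℕ) : ℝ) * Real.pi := by
  rw [freq, div_mul_cancel₀ _ hL.ne']
  push_cast
  rfl

/-- The functions `√(2/L) sin((n+1)πx/L)` on the real line. -/
def sinFn (L : ℝ) (n : ℕ) (x : ℝ) : ℝ := √(2 / L) * Real.sin (freq L n * x)

/-- The functions `√(2/L) cos((n+1)πx/L)` on the real line. -/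
def cosFn (L : ℝ) (n : ℕ) (x : ℝ) : ℝ := √(2 / L) * Real.cos (freq L n * x)

theorem memLp_cosine (L : ℝ) (n : ℕ) :
    MemLp (fun x : ℝ => ((cosFn L n x : ℝ) : ℂ)) 2 (volume.restrict (Ioo (0 : ℝ) L)) := by
  refine MemLp.of_bound (Continuous.aestronglyMeasurable (by unfold cosFn; fun_prop)) (√(2 / L)) ?_
  refine Eventually.of_forall fun x => ?_
  rw [Complex.norm_real, Real.norm_eq_abs, cosFn, abs_mul, abs_of_nonneg (Real.sqrt_nonneg _)]
  exact mul_le_of_le_one_right (Real.sqrt_nonneg _) (Real.abs_cos_le_one _)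

/-- The functions `√(2/L) cos((n+1)πx/L)` in `L²(0, L)`. -/
def cosine (L : ℝ) (n : ℕ) : L2 L := (memLp_cosine L n).toLp _

theorem coeFn_cosine (L : ℝ) (n : ℕ) :
    cosine L n =ᵐ[volume.restrict (Ioo 0 L)] fun x => (cosFn L n x : ℂ) :=
  (memLp_cosine L n).coeFn_toLp

theorem coeFn_eigenfn (L : ℝ) (n : ℕ) :
    eigenfn L n =ᵐ[volume.restrict (Ioo 0 L)] fun x => (sinFn L n x : ℂ) := by
  refine (memLp_sine L n).coeFn_toLp.trans (Eventually.of_forall fun x => ?_)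
  simp only [sinFn, freq, div_mul_eq_mul_div]

theorem inner_eq_integral_of_real {L : ℝ} {f g : L2 L} {F G : ℝ → ℝ}
    (hf : f =ᵐ[volume.restrict (Ioo 0 L)] fun x => (F x : ℂ))
    (hg : g =ᵐ[volume.restrict (Ioo 0 L)] fun x => (G x : ℂ)) :
    inner ℂ f g = ((∫ x in Ioo 0 L, F x * G x : ℝ) : ℂ) := by
  rw [L2.inner_def, ← integral_complex_ofReal]
  refine integral_congr_ae ?_
  filter_upwards [hf, hg] with x h1 h2
  rw [h1, h2]
  simp [mul_comm]

theorem integral_Ioo_eq_interval {L : ℝ} (hL : 0 < L) (f : ℝ → ℝ) :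
    ∫ x in Ioo 0 L, f x = ∫ x in (0 : ℝ)..L, f x := by
  rw [intervalIntegral.integral_of_le hL.le, integral_Ioc_eq_integral_Ioo]

theorem integral_cos_mul_eq_zero {L c : ℝ} (hc : c ≠ 0) (h : Real.sin (c * L) = 0) :
    ∫ x in (0 : ℝ)..L, Real.cos (c * x) = 0 := by
  rw [intervalIntegral.integral_comp_mul_left (fun x => Real.cos x) hc, integral_cos, h]
  simp

theorem integral_cos_freq_add {L : ℝ} (hL : 0 < L) (n m : ℕ) :
    ∫ x in (0 : ℝ)..L, Real.cos ((freq L n + freq L m) * x) = 0 := by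
  refine integral_cos_mul_eq_zero (add_pos (freq_pos hL n) (freq_pos hL m)).ne' ?_
  rw [add_mul, freq_mul_length hL, freq_mul_length hL, ← add_mul]
  exact_mod_cast Real.sin_nat_mul_pi (n + 1 + (m + 1))

theorem integral_cos_freq_sub {L : ℝ} (hL : 0 < L) (n m : ℕ) :
    ∫ x in (0 : ℝ)..L, Real.cos ((freq L n - freq L m) * x) = if n = m then L else 0 := by
  split_ifs with h
  · subst h
    simp
  · refine integral_cos_mul_eq_zero ?_ ?_
    · rw [freq, freq, ← sub_div, ← sub_mul]
      refine div_ne_zero (mul_ne_zero ?_ Real.pi_ne_zero) hL.ne'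
      rw [add_sub_add_right_eq_sub, sub_ne_zero]
      exact_mod_cast h
    · rw [sub_mul, freq_mul_length hL, freq_mul_length hL, ← sub_mul]
      exact_mod_cast Real.sin_int_mul_pi (((n + 1 : ℕ) : ℤ) - ((m + 1 : ℕ) : ℤ))

theorem orthonormal_eigenfn {L : ℝ} (hL : 0 < L) : Orthonormal ℂ (eigenfn L) := by
  rw [orthonormal_iff_ite]
  intro n m
  rw [inner_eq_integral_of_real (coeFn_eigenfn L n) (coeFn_eigenfn L m), integral_Ioo_eq_interval hL]
  have e : ∀ x, sinFn L n x * sinFn L m x = (1 / L) * (Real.cos ((freq L n - freq L m) * x)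
      - Real.cos ((freq L n + freq L m) * x)) := by
    intro x
    have hs : √(2 / L) * √(2 / L) = 2 / L := Real.mul_self_sqrt (by positivity)
    rw [sub_mul, add_mul, Real.cos_sub, Real.cos_add, sinFn, sinFn]
    linear_combination (Real.sin (freq L n * x) * Real.sin (freq L m * x)) * hs
  simp only [e]
  rw [intervalIntegral.integral_const_mul, intervalIntegral.integral_sub
    (Continuous.intervalIntegrable (by fun_prop) _ _)
    (Continuous.intervalIntegrable (by fun_prop) _ _), integral_cos_freq_add hL,
    integral_cos_freq_sub hL, sub_zero]
  split_ifs with h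
  · rw [one_div, inv_mul_cancel₀ hL.ne', Complex.ofReal_one]
  · rw [mul_zero, Complex.ofReal_zero]

/-- Only Bessel's inequality for the cosines is used, applied to derivatives of functions in H¹₀;
their completeness plays no role. -/
theorem orthonormal_cosine {L : ℝ} (hL : 0 < L) : Orthonormal ℂ (cosine L) := by
  rw [orthonormal_iff_ite]
  intro n m
  rw [inner_eq_integral_of_real (coeFn_cosine L n) (coeFn_cosine L m), integral_Ioo_eq_interval hL]
  have e : ∀ x, cosFn L n x * cosFn L m x = (1 / L) * (Real.cos ((freq L n - freq L m) * x)
      + Real.cos ((freq L n + freq L m) * x)) := by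
    intro x
    have hs : √(2 / L) * √(2 / L) = 2 / L := Real.mul_self_sqrt (by positivity)
    rw [sub_mul, add_mul, Real.cos_sub, Real.cos_add, cosFn, cosFn]
    linear_combination (Real.cos (freq L n * x) * Real.cos (freq L m * x)) * hs
  simp only [e]
  rw [intervalIntegral.integral_const_mul, intervalIntegral.integral_add
    (Continuous.intervalIntegrable (by fun_prop) _ _)
    (Continuous.intervalIntegrable (by fun_prop) _ _), integral_cos_freq_add hL,
    integral_cos_freq_sub hL, add_zero]
  split_ifs with h
  · rw [one_div, inv_mul_cancel₀ hL.ne', Complex.ofReal_one]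
  · rw [mul_zero, Complex.ofReal_zero]

theorem inner_eigenfn_eq (L : ℝ) (n : ℕ) (f : L2 L) :
    inner ℂ (eigenfn L n) f = ∫ x in Ioo 0 L, (sinFn L n x : ℂ) * f x := by
  rw [L2.inner_def]
  refine integral_congr_ae ?_
  filter_upwards [coeFn_eigenfn L n] with x hx
  rw [hx]
  simp [mul_comm]

/-- The sines are complete in `L²(0, L)`. -/
theorem eq_zero_of_inner_eigenfn {L : ℝ} (hL : 0 < L) {f : L2 L}
    (hf : ∀ n, inner ℂ (eigenfn L n) f = 0) : f = 0 := by
  set μ := volume.restrict (Ioo (0 : ℝ) L) with hμ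
  have hfi : Integrable f μ := (Lp.memLp f).integrable (by norm_num)
  let ext : C(Icc (0 : ℝ) L, ℝ) → ℝ → ℝ := fun h x => IccExtend hL.le h x
  have hext : ∀ h, Continuous (ext h) := fun h => h.continuous.Icc_extend'
  have hbd : ∀ h x, ‖(ext h x : ℂ)‖ ≤ ‖h‖ := fun h x => by
    rw [Complex.norm_real]
    exact h.norm_coe_le_norm _
  let s : ℕ → ℝ → ℂ := fun n x => (Real.sin (n * Real.pi / L * x) : ℂ)
  have hs : ∀ n x, ‖s n x‖ ≤ 1 := fun n x => by
    rw [Complex.norm_real]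
    exact Real.abs_sin_le_one _
  have hsc : ∀ n, Continuous (s n) := fun n => by fun_prop
  have hint : ∀ n h, Integrable (fun x => s n x * f x * (ext h x : ℂ)) μ := by
    intro n h
    refine (hfi.bdd_mul (hsc n).aestronglyMeasurable (Eventually.of_forall (hs n))).mul_bdd ?_
      (c := ‖h‖) (Eventually.of_forall (hbd h))
    exact (Complex.continuous_ofReal.comp (hext h)).aestronglyMeasurable
  -- P h says that h f is orthogonal to all sines. It holds for h = 1, survives multiplication by c
  -- = cos(πx/L), and so reaches all continuous h by Stone–Weierstrass.
  let P : C(Icc (0 : ℝ) L, ℝ) → Prop := fun h => ∀ n, ∫ x, s n x * f x * (ext h x : ℂ) ∂μ = 0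
  have hext_add : ∀ h k x, ext (h + k) x = ext h x + ext k x := fun _ _ _ => rfl
  have hext_mul : ∀ h k x, ext (h * k) x = ext h x * ext k x := fun _ _ _ => rfl
  have hadd : ∀ {h k}, P h → P k → P (h + k) := by
    intro h k hh hk n
    simp only [hext_add, Complex.ofReal_add, mul_add]
    rw [integral_add (hint n h) (hint n k), hh n, hk n, add_zero]
  have hone : P 1 := by
    intro n
    have e1 : ∀ x, ext 1 x = 1 := fun _ => rfl
    simp only [e1, Complex.ofReal_one, mul_one]
    cases n with
    | zero => simp [s]
    | succ n =>
      have h := hf n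
      rw [inner_eigenfn_eq] at h
      have e2 : ∀ x, (sinFn L n x : ℂ) * f x = (√(2 / L) : ℂ) * (s (n + 1) x * f x) := by
        intro x
        simp only [sinFn, s, freq]
        push_cast
        ring
      simp only [e2] at h
      rw [integral_const_mul] at h
      refine (mul_eq_zero.1 h).resolve_left ?_
      refine Complex.ofReal_ne_zero.2 ?_
      positivity
  let c : C(Icc (0 : ℝ) L, ℝ) := ⟨fun x => Real.cos (Real.pi / L * x), by fun_prop⟩
  have hcx : ∀ x ∈ Ioo 0 L, ext c x = Real.cos (Real.pi / L * x) := fun x hx =>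
    IccExtend_of_mem hL.le c (Ioo_subset_Icc_self hx)
  have hcos : ∀ {h}, P h → P (c * h) := by
    intro h hh n
    -- The formula 2 sin(nθ) cos θ = sin((n+1)θ) + sin((n-1)θ). For n = 0 the last term is -sin θ,
    -- whence the sign and the index 1, natural subtraction giving 0 instead.
    have e : ∀ᵐ x ∂μ, s n x * f x * (ext (c * h) x : ℂ) =
        (1 / 2 : ℂ) * (s (n + 1) x * f x * (ext h x : ℂ) +
          (if n = 0 then -1 else 1) * (s (if n = 0 then 1 else n - 1) x * f x * (ext h x : ℂ))) := by
      rw [hμ, ae_restrict_iff' measurableSet_Ioo]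
      refine Eventually.of_forall fun x hx => ?_
      rw [hext_mul, hcx x hx]
      have t1 : Real.sin (((n + 1 : ℕ) : ℝ) * Real.pi / L * x)
          = Real.sin (n * Real.pi / L * x + Real.pi / L * x) := by
        congr 1
        push_cast
        ring
      rw [Real.sin_add] at t1
      have t2 : (if n = 0 then -1 else 1) * Real.sin (((if n = 0 then 1 else n - 1 : ℕ) : ℝ) * Real.pi / L * x)
          = Real.sin (n * Real.pi / L * x - Real.pi / L * x) := by
        cases n with
        | zero =>
          simp only [if_true, Nat.cast_zero, Nat.cast_one]
          rw [neg_one_mul, ← Real.sin_neg]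
          congr 1
          ring
        | succ n =>
          simp only [Nat.succ_ne_zero, if_false, one_mul, Nat.add_sub_cancel]
          congr 1
          push_cast
          ring
      rw [Real.sin_sub] at t2
      have t3 : Real.sin (n * Real.pi / L * x) * Real.cos (Real.pi / L * x) = 1 / 2 *
          (Real.sin (((n + 1 : ℕ) : ℝ) * Real.pi / L * x) + (if n = 0 then -1 else 1) *
          Real.sin (((if n = 0 then 1 else n - 1 : ℕ) : ℝ) * Real.pi / L * x)) := by
        rw [t1, t2]
        ring
      have t4 := congrArg (fun r : ℝ => (r : ℂ)) t3
      simp only [Complex.ofReal_mul, Complex.ofReal_add, apply_ite Complex.ofReal,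
        Complex.ofReal_neg, Complex.ofReal_one, Complex.ofReal_div, Complex.ofReal_ofNat] at t4
      simp only [s, Complex.ofReal_mul]
      linear_combination (f x * (ext h x : ℂ)) * t4
    rw [integral_congr_ae e, integral_const_mul, integral_add (hint _ _) ((hint _ _).const_mul _),
      integral_const_mul, hh, hh]
    simp
  have hadj : ∀ a ∈ Algebra.adjoin ℝ {c}, ∀ h, P h → P (a * h) := by
    intro a ha
    induction ha using Algebra.adjoin_induction with
    | mem x hx =>
      obtain rfl := hx
      exact fun h => hcos
    | algebraMap r =>
      intro h hh n
      have e : ∀ x, s n x * f x * (ext (algebraMap ℝ C(Icc (0 : ℝ) L, ℝ) r * h) x : ℂ)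
          = (r : ℂ) * (s n x * f x * (ext h x : ℂ)) := by
        intro x
        rw [hext_mul, show ext (algebraMap ℝ C(Icc (0 : ℝ) L, ℝ) r) x = r from rfl]
        push_cast
        ring
      simp only [e]
      rw [integral_const_mul, hh n, mul_zero]
    | add x y _ _ hx hy =>
      intro h hh
      rw [add_mul]
      exact hadd (hx h hh) (hy h hh)
    | mul x y _ _ hx hy =>
      intro h hh
      rw [mul_assoc]
      exact hx _ (hy h hh)
  -- One generator suffices, because the cosine is injective on [0, π].
  have hsep : (Algebra.adjoin ℝ {c}).SeparatesPoints := by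
    intro x y hxy
    refine ⟨c, ⟨c, Algebra.subset_adjoin rfl, rfl⟩, fun he => hxy (Subtype.ext ?_)⟩
    have hm : ∀ z : Icc (0 : ℝ) L, Real.pi / L * z ∈ Icc 0 Real.pi := fun z => by
      refine ⟨mul_nonneg (by positivity) z.2.1, ?_⟩
      rw [div_mul_eq_mul_div, div_le_iff₀ hL]
      exact mul_le_mul_of_nonneg_left z.2.2 Real.pi_pos.le
    exact mul_left_cancel₀ (div_pos Real.pi_pos hL).ne' (Real.injOn_cos (hm x) (hm y) he)
  have hall : ∀ h, P h := by
    intro h n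
    have htop := ContinuousMap.subalgebra_topologicalClosure_eq_top_of_separatesPoints _ hsep
    have hmem : h ∈ closure ((Algebra.adjoin ℝ {c} : Subalgebra ℝ C(Icc (0 : ℝ) L, ℝ)) :
        Set C(Icc (0 : ℝ) L, ℝ)) := by
      rw [← Subalgebra.topologicalClosure_coe, htop]
      trivial
    have hcont : Continuous fun h => ∫ x, s n x * f x * (ext h x : ℂ) ∂μ := by
      refine continuous_iff_continuousAt.2 fun h0 => ?_
      refine continuousAt_of_dominated (bound := fun x => ‖f x‖ * (‖h0‖ + 1)) ?_ ?_ ?_ ?_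
      · exact Eventually.of_forall fun h => (hint n h).aestronglyMeasurable
      · have : ∀ᶠ h in 𝓝 h0, ‖h‖ < ‖h0‖ + 1 :=
          continuous_norm.continuousAt.eventually_lt continuousAt_const (by linarith)
        filter_upwards [this] with h hh
        refine Eventually.of_forall fun x => ?_
        rw [norm_mul, norm_mul]
        refine mul_le_mul ?_ ((hbd h x).trans hh.le) (norm_nonneg _) (norm_nonneg _)
        exact mul_le_of_le_one_left (norm_nonneg _) (hs n x)
      · exact hfi.norm.mul_const _
      · refine Eventually.of_forall fun x => ?_
        refine continuousAt_const.mul ?_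
        exact (Complex.continuous_ofReal.comp (continuous_eval_const (projIcc 0 L hL.le x))).continuousAt
    refine closure_minimal (t := {h | ∫ x, s n x * f x * (ext h x : ℂ) ∂μ = 0}) (fun a ha => ?_)
      (isClosed_eq hcont continuous_const) hmem
    have := hadj a ha 1 hone n
    rwa [mul_one] at this
  -- The case n = 1: sin(πx/L) f annihilates every test function, and sin(πx/L) > 0 inside the
  -- interval.
  have key : ∀ᵐ x ∂(volume : Measure ℝ), x ∈ Ioo 0 L → s 1 x * f x = 0 := by
    refine isOpen_Ioo.ae_eq_zero_of_integral_contDiff_smul_eq_zero ?_ ?_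
    · refine IntegrableOn.locallyIntegrableOn ?_
      exact hfi.bdd_mul (hsc 1).aestronglyMeasurable (Eventually.of_forall (hs 1))
    · intro φ h1 h2 h3
      have e := hall ⟨fun x => φ x, h1.continuous.comp continuous_subtype_val⟩ 1
      rw [← setIntegral_eq_integral_of_forall_compl_eq_zero (s := Ioo 0 L) (fun x hx => ?_), ← e]
      · refine setIntegral_congr_fun measurableSet_Ioo fun x hx => ?_
        have : ext ⟨fun x => φ x, h1.continuous.comp continuous_subtype_val⟩ x = φ x :=
          IccExtend_of_mem hL.le _ (Ioo_subset_Icc_self hx)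
        simp only [this, Complex.real_smul]
        ring
      · rw [image_eq_zero_of_notMem_tsupport fun hx' => hx (h3 hx'), zero_smul]
  refine Lp.ext ?_
  have k2 := (ae_restrict_iff' measurableSet_Ioo).2 key
  filter_upwards [k2, Lp.coeFn_zero ℂ 2 μ, ae_restrict_mem measurableSet_Ioo] with x hx h0 hxm
  rw [h0]
  refine (mul_eq_zero.1 hx).resolve_left ?_
  refine Complex.ofReal_ne_zero.2 ?_
  refine (Real.sin_pos_of_pos_of_lt_pi ?_ ?_).ne'
  · have := hxm.1
    positivity
  · rw [Nat.cast_one, one_mul, div_mul_eq_mul_div, div_lt_iff₀ hL]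
    exact mul_lt_mul_of_pos_left hxm.2 Real.pi_pos

/-! ### Weak derivatives -/

theorem isWeakDeriv_of_hasDerivAt {L : ℝ} {F F' : ℝ → ℂ} (hd : ∀ x, HasDerivAt F (F' x) x)
    (hc : Continuous F') {f g : L2 L} (hf : f =ᵐ[volume.restrict (Ioo 0 L)] F)
    (hg : g =ᵐ[volume.restrict (Ioo 0 L)] F') : IsWeakDeriv L f g := by
  intro χ hχ
  have hFc : Continuous F := continuous_iff_continuousAt.2 fun x => (hd x).continuousAt
  have e1 : ∫ x in Ioo 0 L, f x * deriv χ x = ∫ x, F x * deriv χ x := by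
    rw [integral_congr_ae (g := fun x => F x * deriv χ x)]
    · refine setIntegral_eq_integral_of_forall_compl_eq_zero fun x hx => ?_
      rw [image_eq_zero_of_notMem_tsupport (fun hx' => hx ((testFn_deriv hχ).2.2 hx')), mul_zero]
    · filter_upwards [hf] with x hx
      rw [hx]
  have e2 : ∫ x in Ioo 0 L, g x * χ x = ∫ x, F' x * χ x := by
    rw [integral_congr_ae (g := fun x => F' x * χ x)]
    · refine setIntegral_eq_integral_of_forall_compl_eq_zero fun x hx => ?_
      rw [image_eq_zero_of_notMem_tsupport (fun hx' => hx (hχ.2.2 hx')), mul_zero]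
    · filter_upwards [hg] with x hx
      rw [hx]
  rw [e1, e2]
  have hp : ∀ {a b : ℝ → ℂ}, Continuous a → b ∈ testFn L → Integrable (a * b) volume := by
    intro a b ha hb
    exact (ha.mul (testFn_cont hb)).integrable_of_hasCompactSupport hb.2.1.mul_left
  exact integral_mul_deriv_eq_deriv_mul_of_integrable (fun x _ => hd x)
    (fun x _ => (hχ.1.differentiable (by simp) x).hasDerivAt)
    (hp hFc (testFn_deriv hχ)) (hp hc hχ) (hp hFc hχ)

theorem hasDerivAt_sinFn (L : ℝ) (n : ℕ) (x : ℝ) :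
    HasDerivAt (sinFn L n) (freq L n * cosFn L n x) x := by
  have h := (((hasDerivAt_id x).const_mul (freq L n)).sin).const_mul (√(2 / L))
  refine h.congr_deriv ?_
  simp only [cosFn, id]
  ring

theorem hasDerivAt_cosFn (L : ℝ) (n : ℕ) (x : ℝ) :
    HasDerivAt (cosFn L n) (-(freq L n * sinFn L n x)) x := by
  have h := (((hasDerivAt_id x).const_mul (freq L n)).cos).const_mul (√(2 / L))
  refine h.congr_deriv ?_
  simp only [sinFn, id]
  ring

theorem continuous_sinFn (L : ℝ) (n : ℕ) : Continuous (sinFn L n) := by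
  unfold sinFn
  fun_prop

theorem isWeakDeriv_cosine (L : ℝ) (n : ℕ) :
    IsWeakDeriv L (cosine L n) (-((freq L n : ℂ) • eigenfn L n)) := by
  refine isWeakDeriv_of_hasDerivAt (F := fun x => (cosFn L n x : ℂ))
    (fun x => (hasDerivAt_cosFn L n x).ofReal_comp) ?_ (coeFn_cosine L n) ?_
  · exact Complex.continuous_ofReal.comp ((continuous_const.mul (continuous_sinFn L n)).neg)
  · filter_upwards [Lp.coeFn_neg ((freq L n : ℂ) • eigenfn L n),
      Lp.coeFn_smul (freq L n : ℂ) (eigenfn L n), coeFn_eigenfn L n] with x h1 h2 h3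
    rw [h1, Pi.neg_apply, h2, Pi.smul_apply, h3]
    push_cast
    rfl

theorem exists_testGraph {L : ℝ} {φ : ℝ → ℂ} (hφ : φ ∈ testFn L) :
    ∃ q ∈ testGraph L, q.1 =ᵐ[volume.restrict (Ioo 0 L)] φ ∧
      q.2 =ᵐ[volume.restrict (Ioo 0 L)] deriv φ := by
  have h1 := (testFn_memLp hφ 2).coeFn_toLp
  have h2 := (testFn_memLp (testFn_deriv hφ) 2).coeFn_toLp
  exact ⟨((testFn_memLp hφ 2).toLp _, (testFn_memLp (testFn_deriv hφ) 2).toLp _),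
    ⟨φ, hφ, h1, h2⟩, h1, h2⟩

theorem exists_testGraph_snd {L : ℝ} {q : L2 L × L2 L} (hq : q ∈ testGraph L) :
    ∃ r, (q.2, r) ∈ testGraph L := by
  obtain ⟨φ, hφ, -, h2⟩ := hq
  have h3 := (testFn_memLp (testFn_deriv (testFn_deriv hφ)) 2).coeFn_toLp
  exact ⟨_, deriv φ, testFn_deriv hφ, h2, h3⟩

theorem testFn_conj {L : ℝ} {φ : ℝ → ℂ} (hφ : φ ∈ testFn L) :
    (fun x => (starRingEnd ℂ) (φ x)) ∈ testFn L := by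
  refine ⟨Complex.conjCLE.contDiff.comp hφ.1,
    hφ.2.1.comp_left (g := fun z => (starRingEnd ℂ) z) (map_zero _), ?_⟩
  refine (closure_mono fun x hx => ?_).trans hφ.2.2
  simpa using hx

theorem deriv_conj_testFn {L : ℝ} {φ : ℝ → ℂ} (hφ : φ ∈ testFn L) (x : ℝ) :
    deriv (fun x => (starRingEnd ℂ) (φ x)) x = (starRingEnd ℂ) (deriv φ x) :=
  (Complex.conjCLE.toContinuousLinearMap.hasFDerivAt.comp_hasDerivAt x
    (hφ.1.differentiable (by simp) x).hasDerivAt).deriv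

theorem inner_eq_integral_conj {L : ℝ} {f g : L2 L} {φ : ℝ → ℂ}
    (hf : f =ᵐ[volume.restrict (Ioo 0 L)] φ) :
    inner ℂ f g = ∫ x in Ioo 0 L, g x * (starRingEnd ℂ) (φ x) := by
  rw [L2.inner_def]
  refine integral_congr_ae ?_
  filter_upwards [hf] with x hx
  rw [hx]
  rfl

/-- Conjugation preserves test functions, so the bilinear definition becomes an inner product
identity, which passes to limits in the graph norm. -/
theorem isWeakDeriv_iff_inner {L : ℝ} {f g : L2 L} :
    IsWeakDeriv L f g ↔ ∀ q ∈ testGraph L, inner ℂ q.2 f = -inner ℂ q.1 g := by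
  constructor
  · rintro h q ⟨φ, hφ, h1, h2⟩
    rw [inner_eq_integral_conj h1, inner_eq_integral_conj h2, ← h _ (testFn_conj hφ)]
    simp only [deriv_conj_testFn hφ]
  · intro h φ hφ
    obtain ⟨q, hq, h1, h2⟩ := exists_testGraph (testFn_conj hφ)
    have := h q hq
    rw [inner_eq_integral_conj h1, inner_eq_integral_conj h2] at this
    simpa [deriv_conj_testFn hφ] using this

theorem inner_H10graph {L : ℝ} {q : L2 L × L2 L} (hq : q ∈ H10graph L) {g h : L2 L}
    (hg : IsWeakDeriv L g h) : inner ℂ q.2 g = -inner ℂ q.1 h := by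
  have hc : IsClosed {q : L2 L × L2 L | inner ℂ q.2 g = -inner ℂ q.1 h} :=
    isClosed_eq (continuous_snd.inner continuous_const) (continuous_fst.inner continuous_const).neg
  exact closure_minimal (fun q hq => isWeakDeriv_iff_inner.1 hg q hq) hc hq

theorem inner_grad {L : ℝ} (u : H10 L) {g h : L2 L} (hg : IsWeakDeriv L g h) :
    inner ℂ (grad L u) g = -inner ℂ (u : L2 L) h :=
  inner_H10graph (grad_mem u) hg

theorem isWeakDeriv_grad {L : ℝ} (u : H10 L) : IsWeakDeriv L u (grad L u) :=
  H10graph_isWeakDeriv (grad_mem u)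

theorem isWeakDeriv_of_inner_grad {L : ℝ} {g h : L2 L}
    (H : ∀ u : H10 L, inner ℂ (grad L u) g = -inner ℂ (u : L2 L) h) : IsWeakDeriv L g h := by
  rw [isWeakDeriv_iff_inner]
  intro q hq
  have hq' : q ∈ H10graph L := (testGraph L).le_topologicalClosure hq
  have := H ⟨q.1, q, hq', rfl⟩
  rwa [show grad L ⟨q.1, q, hq', rfl⟩ = q.2 from dx_eq _ (H10graph_isWeakDeriv hq')] at this

theorem grad_eq {L : ℝ} {q : L2 L × L2 L} (hq : q ∈ H10graph L) :
    ∃ h : q.1 ∈ H10 L, grad L ⟨q.1, h⟩ = q.2 :=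
  ⟨⟨q, hq, rfl⟩, dx_eq _ (H10graph_isWeakDeriv hq)⟩

theorem H10graph_closed (L : ℝ) : IsClosed (H10graph L : Set (L2 L × L2 L)) :=
  (testGraph L).isClosed_topologicalClosure

/-! ### Smooth functions vanishing at the end points -/

theorem tendsto_L2_of_bounded {L : ℝ} {f : ℕ → L2 L} {g : L2 L} {C : ℝ}
    (hb : ∀ n, ∀ᵐ x ∂volume.restrict (Ioo 0 L), ‖f n x‖ ≤ C)
    (hl : ∀ᵐ x ∂volume.restrict (Ioo 0 L), Tendsto (fun n => f n x) atTop (𝓝 (g x))) :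
    Tendsto f atTop (𝓝 g) := by
  have e : ∀ n, ‖f n - g‖ ^ 2 = ∫ x in Ioo 0 L, ‖f n x - g x‖ ^ 2 := by
    intro n
    rw [← inner_self_eq_norm_sq (𝕜 := ℂ), L2.inner_def, ← integral_re
      (L2.integrable_inner (𝕜 := ℂ) _ _)]
    refine integral_congr_ae ?_
    filter_upwards [Lp.coeFn_sub (f n) g] with x hx
    rw [hx, Pi.sub_apply, inner_self_eq_norm_sq]
  have hgb : ∀ᵐ x ∂volume.restrict (Ioo 0 L), ‖g x‖ ≤ C := by
    filter_upwards [ae_all_iff.2 hb, hl] with x h1 h2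
    exact le_of_tendsto h2.norm (Eventually.of_forall h1)
  have h0 : Tendsto (fun n => ‖f n - g‖ ^ 2) atTop (𝓝 0) := by
    simp only [e]
    have := tendsto_integral_of_dominated_convergence (μ := volume.restrict (Ioo 0 L))
      (F := fun n x => ‖f n x - g x‖ ^ 2) (f := fun _ => (0 : ℝ)) (fun _ => (C + C) ^ 2)
      (fun n => ?_) (integrable_const _) (fun n => ?_) ?_
    · simpa using this
    · exact (((Lp.aestronglyMeasurable (f n)).sub (Lp.aestronglyMeasurable g)).norm).pow 2
    · filter_upwards [hb n, hgb] with x h1 h2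
      rw [Real.norm_of_nonneg (by positivity)]
      exact pow_le_pow_left₀ (norm_nonneg _) ((norm_sub_le _ _).trans (add_le_add h1 h2)) 2
    · filter_upwards [hl] with x hx
      simpa using ((hx.sub_const (g x)).norm).pow 2
  rw [tendsto_iff_norm_sub_tendsto_zero]
  simpa [Real.sqrt_sq] using h0.sqrt

/-- A smooth step: `0` on `(-∞, 1]` and `1` on `[2, ∞)`. -/
def step (y : ℝ) : ℝ := Real.smoothTransition (y - 1)

theorem contDiff_step : ContDiff ℝ ∞ step :=
  Real.smoothTransition.contDiff.comp (contDiff_id.sub contDiff_const)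

theorem step_eq_zero {y : ℝ} (h : y ≤ 1) : step y = 0 :=
  Real.smoothTransition.zero_of_nonpos (by linarith)

theorem step_eq_one {y : ℝ} (h : 2 ≤ y) : step y = 1 :=
  Real.smoothTransition.one_of_one_le (by linarith)

theorem norm_step_le (y : ℝ) : |step y| ≤ 1 := by
  rw [step, abs_of_nonneg (Real.smoothTransition.nonneg _)]
  exact Real.smoothTransition.le_one _

theorem deriv_step_eq_zero_of_lt {y : ℝ} (h : y < 1) : deriv step y = 0 := by
  have : step =ᶠ[𝓝 y] fun _ => 0 := by
    filter_upwards [Iio_mem_nhds h] with z hz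
    exact step_eq_zero (le_of_lt hz)
  rw [this.deriv_eq, deriv_const]

theorem deriv_step_eq_zero_of_gt {y : ℝ} (h : 2 < y) : deriv step y = 0 := by
  have : step =ᶠ[𝓝 y] fun _ => 1 := by
    filter_upwards [Ioi_mem_nhds h] with z hz
    exact step_eq_one (le_of_lt hz)
  rw [this.deriv_eq, deriv_const]

theorem exists_step_bound : ∃ M : ℝ, ∀ y, |y * deriv step y| ≤ M := by
  have hc : Continuous fun y => y * deriv step y :=
    continuous_id.mul (contDiff_step.continuous_deriv (by simp))
  have hs : HasCompactSupport fun y => y * deriv step y := by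
    refine HasCompactSupport.intro (isCompact_Icc (a := (1 : ℝ)) (b := 2)) fun y hy => ?_
    rw [mem_Icc, not_and_or, not_le, not_le] at hy
    rcases hy with h | h
    · rw [deriv_step_eq_zero_of_lt h, mul_zero]
    · rw [deriv_step_eq_zero_of_gt h, mul_zero]
  exact hs.exists_bound_of_continuous hc

/-- A smooth function that vanishes at `0` and at `L` lies in `H¹₀(0, L)`. -/
theorem mem_H10graph_of_contDiff {L : ℝ} {F : ℝ → ℂ} (hF : ContDiff ℝ ∞ F) (h0 : F 0 = 0)
    (hL : F L = 0) {C : ℝ} (hC : ∀ x, ‖deriv F x‖ ≤ C) {f g : L2 L}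
    (hf : f =ᵐ[volume.restrict (Ioo 0 L)] F) (hg : g =ᵐ[volume.restrict (Ioo 0 L)] deriv F) :
    (f, g) ∈ H10graph L := by
  obtain ⟨M, hM⟩ := exists_step_bound
  have hC0 : 0 ≤ C := (norm_nonneg _).trans (hC 0)
  have hM0 : 0 ≤ M := (abs_nonneg _).trans (hM 0)
  have hFd : Differentiable ℝ F := hF.differentiable (by simp)
  have hmv : ∀ a x, ‖F x - F a‖ ≤ C * |x - a| := fun a x =>
    convex_univ.norm_image_sub_le_of_norm_deriv_le (fun y _ => hFd y) (fun y _ => hC y)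
      (mem_univ a) (mem_univ x)
  have hF0 : ∀ x ∈ Ioo 0 L, ‖F x‖ ≤ C * x := fun x hx => by
    have := hmv 0 x
    rwa [h0, sub_zero, sub_zero, abs_of_pos hx.1] at this
  have hFL : ∀ x ∈ Ioo 0 L, ‖F x‖ ≤ C * (L - x) := fun x hx => by
    have := hmv L x
    rwa [hL, sub_zero, abs_sub_comm, abs_of_pos (sub_pos.2 hx.2)] at this
  -- Cutoffs with transition layers 1/k ≤ x ≤ 2/k and their mirror images at L. There χ' is of order
  -- k while |F| is at most C times the distance to the end point, so χ'F stays bounded and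
  -- dominated convergence applies.
  let χ : ℕ → ℝ → ℝ := fun k x => step (k * x) * step (k * (L - x))
  let χ' : ℕ → ℝ → ℝ := fun k x => k * deriv step (k * x) * step (k * (L - x))
    - step (k * x) * (k * deriv step (k * (L - x)))
  have hsd : Differentiable ℝ step := contDiff_step.differentiable (by simp)
  have hχ : ∀ k x, HasDerivAt (χ k) (χ' k x) x := by
    intro k x
    have a1 : HasDerivAt (fun x : ℝ => step (k * x)) (k * deriv step (k * x)) x := by
      have := (hsd (k * x)).hasDerivAt.scomp x ((hasDerivAt_id x).const_mul (k : ℝ))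
      simpa using! this
    have a2 : HasDerivAt (fun x : ℝ => step (k * (L - x))) (-(k * deriv step (k * (L - x)))) x := by
      have := (hsd (k * (L - x))).hasDerivAt.scomp x
        (((hasDerivAt_id x).const_sub L).const_mul (k : ℝ))
      simpa using! this
    have a3 := a1.mul a2
    convert! a3 using 1
    simp only [χ']
    ring
  let φ : ℕ → ℝ → ℂ := fun k x => (χ k x : ℂ) * F x
  have hφd : ∀ k x, HasDerivAt (φ k) ((χ' k x : ℂ) * F x + (χ k x : ℂ) * deriv F x) x :=
    fun k x => (hχ k x).ofReal_comp.mul (hFd x).hasDerivAt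
  have hφ : ∀ k : ℕ, φ (k + 1) ∈ testFn L := by
    intro k
    have hk : (0 : ℝ) < ((k + 1 : ℕ) : ℝ) := by positivity
    have hsub : tsupport (φ (k + 1)) ⊆ Icc (1 / ((k + 1 : ℕ) : ℝ)) (L - 1 / ((k + 1 : ℕ) : ℝ)) := by
      refine closure_minimal (fun x hx => ?_) isClosed_Icc
      have hx' : step (((k + 1 : ℕ) : ℝ) * x) ≠ 0 ∧ step (((k + 1 : ℕ) : ℝ) * (L - x)) ≠ 0 := by
        have : χ (k + 1) x ≠ 0 := fun h => hx (by simp only [φ, h, Complex.ofReal_zero, zero_mul])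
        exact ⟨left_ne_zero_of_mul this, right_ne_zero_of_mul this⟩
      have b1 : 1 < ((k + 1 : ℕ) : ℝ) * x := not_le.1 fun h => hx'.1 (step_eq_zero h)
      have b2 : 1 < ((k + 1 : ℕ) : ℝ) * (L - x) := not_le.1 fun h => hx'.2 (step_eq_zero h)
      constructor
      · rw [div_le_iff₀ hk]
        linarith
      · have : 1 / ((k + 1 : ℕ) : ℝ) ≤ L - x := by
          rw [div_le_iff₀ hk]
          linarith
        linarith
    have hpos : 0 < 1 / ((k + 1 : ℕ) : ℝ) := by positivity
    refine ⟨?_, HasCompactSupport.of_support_subset_isCompact isCompact_Icc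
      ((subset_tsupport _).trans hsub), hsub.trans (Icc_subset_Ioo hpos (by linarith))⟩
    refine ContDiff.mul (Complex.ofRealCLM.contDiff.comp ?_) hF
    exact (contDiff_step.comp (contDiff_const.mul contDiff_id)).mul
      (contDiff_step.comp (contDiff_const.mul (contDiff_const.sub contDiff_id)))
  choose q hq hq1 hq2 using fun k => exists_testGraph (hφ k)
  have hev : ∀ x ∈ Ioo 0 L, ∀ᶠ k : ℕ in atTop,
      2 < ((k + 1 : ℕ) : ℝ) * x ∧ 2 < ((k + 1 : ℕ) : ℝ) * (L - x) := by
    intro x hx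
    have : ∀ {c : ℝ}, 0 < c → ∀ᶠ k : ℕ in atTop, 2 < ((k + 1 : ℕ) : ℝ) * c := fun hc =>
      ((tendsto_natCast_atTop_atTop.comp (tendsto_add_atTop_nat 1)).atTop_mul_const
        hc).eventually_gt_atTop 2
    exact (this hx.1).and (this (sub_pos.2 hx.2))
  have hχle : ∀ k x, ‖(χ k x : ℂ)‖ ≤ 1 := by
    intro k x
    rw [Complex.norm_real, Real.norm_eq_abs, abs_mul]
    exact mul_le_one₀ (norm_step_le _) (abs_nonneg _) (norm_step_le _)
  have hmem := ae_restrict_mem (μ := volume) (measurableSet_Ioo (a := (0 : ℝ)) (b := L))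
  have l1 : Tendsto (fun k => (q k).1) atTop (𝓝 f) := by
    refine tendsto_L2_of_bounded (C := C * |L|) (fun k => ?_) ?_
    · filter_upwards [hq1 k, hmem] with x h1 h2
      rw [h1, norm_mul]
      refine (mul_le_of_le_one_left (norm_nonneg _) (hχle _ _)).trans ((hF0 x h2).trans ?_)
      exact mul_le_mul_of_nonneg_left (h2.2.le.trans (le_abs_self L)) hC0
    · filter_upwards [ae_all_iff.2 hq1, hf, hmem] with x h1 h2 h3
      refine tendsto_const_nhds.congr' ?_
      filter_upwards [hev x h3] with k hk
      simp only [h1, h2, φ, χ, step_eq_one hk.1.le, step_eq_one hk.2.le, mul_one,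
        Complex.ofReal_one, one_mul]
  have l2 : Tendsto (fun k => (q k).2) atTop (𝓝 g) := by
    refine tendsto_L2_of_bounded (C := (C * M + C * M) + C) (fun k => ?_) ?_
    · filter_upwards [hq2 k, hmem] with x h1 h2
      rw [h1, (hφd _ x).deriv]
      refine (norm_add_le _ _).trans (add_le_add ?_ ?_)
      · set K : ℝ := ((k + 1 : ℕ) : ℝ) with hK
        have hK0 : 0 ≤ K := by positivity
        rw [norm_mul, Complex.norm_real, Real.norm_eq_abs]
        have c1 : |K * deriv step (K * x) * step (K * (L - x))| * ‖F x‖ ≤ C * M := by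
          rw [abs_mul, abs_mul, abs_of_nonneg hK0]
          calc K * |deriv step (K * x)| * |step (K * (L - x))| * ‖F x‖
              ≤ K * |deriv step (K * x)| * 1 * (C * x) :=
                mul_le_mul (mul_le_mul_of_nonneg_left (norm_step_le _) (by positivity)) (hF0 x h2)
                  (norm_nonneg _) (by positivity)
            _ = C * |K * x * deriv step (K * x)| := by
                rw [abs_mul, abs_mul, abs_of_nonneg hK0, abs_of_pos h2.1]
                ring
            _ ≤ C * M := mul_le_mul_of_nonneg_left (hM _) hC0
        have c2 : |step (K * x) * (K * deriv step (K * (L - x)))| * ‖F x‖ ≤ C * M := by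
          rw [abs_mul, abs_mul, abs_of_nonneg hK0]
          calc |step (K * x)| * (K * |deriv step (K * (L - x))|) * ‖F x‖
              ≤ 1 * (K * |deriv step (K * (L - x))|) * (C * (L - x)) :=
                mul_le_mul (mul_le_mul_of_nonneg_right (norm_step_le _) (by positivity)) (hFL x h2)
                  (norm_nonneg _) (by positivity)
            _ = C * |K * (L - x) * deriv step (K * (L - x))| := by
                rw [abs_mul, abs_mul, abs_of_nonneg hK0, abs_of_pos (sub_pos.2 h2.2)]
                ring
            _ ≤ C * M := mul_le_mul_of_nonneg_left (hM _) hC0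
        refine (mul_le_mul_of_nonneg_right (abs_sub _ _) (norm_nonneg _)).trans ?_
        rw [add_mul]
        exact add_le_add c1 c2
      · rw [norm_mul]
        exact (mul_le_of_le_one_left (norm_nonneg _) (hχle _ _)).trans (hC x)
    · filter_upwards [ae_all_iff.2 hq2, hg, hmem] with x h1 h2 h3
      refine tendsto_const_nhds.congr' ?_
      filter_upwards [hev x h3] with k hk
      simp only [h1, h2, (hφd _ x).deriv, χ, χ', step_eq_one hk.1.le, step_eq_one hk.2.le,
        deriv_step_eq_zero_of_gt hk.1, deriv_step_eq_zero_of_gt hk.2, mul_one, mul_zero, sub_zero,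
        Complex.ofReal_one, Complex.ofReal_zero, zero_mul, one_mul, zero_add]
  exact (H10graph_closed L).mem_of_tendsto (l1.prodMk_nhds l2)
    (Eventually.of_forall fun k => (testGraph L).le_topologicalClosure (hq k))

theorem eigenfn_mem_H10graph {L : ℝ} (hL : 0 < L) (n : ℕ) :
    (eigenfn L n, (freq L n : ℂ) • cosine L n) ∈ H10graph L := by
  have hd : ∀ x, HasDerivAt (fun x => (sinFn L n x : ℂ)) ((freq L n * cosFn L n x : ℝ) : ℂ) x :=
    fun x => (hasDerivAt_sinFn L n x).ofReal_comp
  have hde : deriv (fun x => (sinFn L n x : ℂ)) = fun x => ((freq L n * cosFn L n x : ℝ) : ℂ) :=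
    funext fun x => (hd x).deriv
  refine mem_H10graph_of_contDiff (F := fun x => (sinFn L n x : ℂ)) (C := freq L n * √(2 / L))
    ?_ ?_ ?_ ?_ (coeFn_eigenfn L n) ?_
  · refine Complex.ofRealCLM.contDiff.comp ?_
    exact contDiff_const.mul (Real.contDiff_sin.comp (contDiff_const.mul contDiff_id))
  · simp [sinFn]
  · rw [sinFn, freq_mul_length hL, Real.sin_nat_mul_pi, mul_zero, Complex.ofReal_zero]
  · intro x
    rw [hde, Complex.norm_real, Real.norm_eq_abs, abs_mul, abs_of_pos (freq_pos hL n), cosFn, abs_mul,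
      abs_of_nonneg (Real.sqrt_nonneg _)]
    exact mul_le_mul_of_nonneg_left
      (mul_le_of_le_one_right (Real.sqrt_nonneg _) (Real.abs_cos_le_one _)) (freq_pos hL n).le
  · rw [hde]
    filter_upwards [Lp.coeFn_smul (freq L n : ℂ) (cosine L n), coeFn_cosine L n] with x h2 h3
    rw [h2, Pi.smul_apply, h3]
    push_cast
    rfl

/-! ### The Dirichlet Laplacian -/

theorem mem_graph_dx {L : ℝ} {f g : L2 L} : (f, g) ∈ (dx L).graph ↔ IsWeakDeriv L f g := by
  rw [LinearPMap.mem_graph_iff]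
  constructor
  · rintro ⟨z, rfl, rfl⟩
    exact dx_spec z
  · intro h
    exact ⟨⟨f, g, h⟩, rfl, dx_eq _ h⟩

/-- Uniqueness of weak derivatives identifies the intermediate function of the second power with
`grad`. -/
theorem mem_graph_lapA {L : ℝ} {u y : L2 L} :
    (u, y) ∈ (lapA L).graph ↔ ∃ h : u ∈ H10 L, IsWeakDeriv L (grad L ⟨u, h⟩) (-y) := by
  have h2 : ∀ {y}, (u, y) ∈ (ppow (dx L) 2).graph ↔ ∃ z, IsWeakDeriv L u z ∧ IsWeakDeriv L z y := by
    intro y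
    rw [mem_graph_ppow_succ']
    simp only [mem_graph_ppow_succ', mem_graph_ppow_zero, mem_graph_dx]
    simp
  rw [LinearPMap.mem_graph_iff]
  constructor
  · rintro ⟨z, rfl, rfl⟩
    have hz := Submodule.mem_inf.1 (show (z : L2 L) ∈ H10 L ⊓ (ppow (dx L) 2).domain from z.2)
    refine ⟨hz.1, ?_⟩
    have e : -(lapA L z) = ppow (dx L) 2 ⟨z, hz.2⟩ := by
      change -(-((ppow (dx L) 2).domRestrict (H10 L) z)) = _
      rw [neg_neg]
      exact LinearPMap.domRestrict_apply rfl
    obtain ⟨w, h3, h4⟩ := h2.1 ((ppow (dx L) 2).mem_graph ⟨z, hz.2⟩)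
    have h5 : grad L ⟨(z : L2 L), hz.1⟩ = w :=
      (isWeakDeriv_grad (⟨(z : L2 L), hz.1⟩ : H10 L)).unique h3
    rw [e, h5]
    exact h4
  · rintro ⟨h, h'⟩
    have hg := h2.2 ⟨_, isWeakDeriv_grad ⟨u, h⟩, h'⟩
    have hd := LinearPMap.mem_domain_of_mem_graph hg
    refine ⟨⟨u, h, hd⟩, rfl, ?_⟩
    have e : lapA L ⟨u, h, hd⟩ = -(ppow (dx L) 2 ⟨u, hd⟩) :=
      congrArg (fun y : L2 L => -y) (LinearPMap.domRestrict_apply rfl)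
    rw [e, LinearPMap.mem_graph_snd_inj _ hg ((ppow (dx L) 2).mem_graph ⟨u, hd⟩) rfl |>.symm, neg_neg]

theorem mem_H10_of_mem_lapA {L : ℝ} {u : L2 L} (h : u ∈ (lapA L).domain) : u ∈ H10 L :=
  (mem_graph_lapA.1 ((lapA L).mem_graph ⟨u, h⟩)).1

theorem isWeakDeriv_grad_lapA {L : ℝ} (u : H10 L) (h : (u : L2 L) ∈ (lapA L).domain) :
    IsWeakDeriv L (grad L u) (-(lapA L ⟨u, h⟩)) :=
  (mem_graph_lapA.1 ((lapA L).mem_graph ⟨u, h⟩)).2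

theorem mem_lapA_of_isWeakDeriv {L : ℝ} {u : H10 L} {g : L2 L} (h : IsWeakDeriv L (grad L u) g) :
    (u : L2 L) ∈ (lapA L).domain :=
  LinearPMap.mem_domain_of_mem_graph (mem_graph_lapA.2 ⟨u.2, by rwa [neg_neg]⟩ : ((u : L2 L), -g) ∈ _)

theorem lapA_eq {L : ℝ} {u : H10 L} (h : (u : L2 L) ∈ (lapA L).domain) {g : L2 L}
    (hg : IsWeakDeriv L (grad L u) g) : lapA L ⟨u, h⟩ = -g := by
  rw [← (isWeakDeriv_grad_lapA u h).unique hg, neg_neg]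

theorem testGraph_mem_lapA {L : ℝ} {q : L2 L × L2 L} (hq : q ∈ testGraph L) :
    q.1 ∈ (lapA L).domain := by
  obtain ⟨r, hr⟩ := exists_testGraph_snd hq
  obtain ⟨h, e⟩ := grad_eq ((testGraph L).le_topologicalClosure hq)
  refine mem_lapA_of_isWeakDeriv (u := ⟨q.1, h⟩) (g := r) ?_
  rw [e]
  exact testGraph_isWeakDeriv hr

/-! ### Expansions in eigenfunctions -/

/-- The sine vanishes at both ends, so g needs no boundary condition; in `freq_mul_inner_eigenfn` it
is u that vanishes there. -/
theorem inner_eigenfn_of_isWeakDeriv {L : ℝ} (hL : 0 < L) (n : ℕ) {g h : L2 L}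
    (H : IsWeakDeriv L g h) :
    inner ℂ (eigenfn L n) h = -((freq L n : ℂ) * inner ℂ (cosine L n) g) := by
  have := inner_H10graph (eigenfn_mem_H10graph hL n) H
  rw [inner_smul_left, Complex.conj_ofReal] at this
  rw [this, neg_neg]

theorem freq_mul_inner_eigenfn {L : ℝ} (n : ℕ) (u : H10 L) :
    (freq L n : ℂ) * inner ℂ (eigenfn L n) (u : L2 L) = inner ℂ (cosine L n) (grad L u) := by
  have := inner_grad u (isWeakDeriv_cosine L n)
  rw [inner_neg_right, neg_neg, inner_smul_right] at this
  rw [← inner_conj_symm (cosine L n), this, map_mul, Complex.conj_ofReal, inner_conj_symm]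

theorem inner_eigenfn_lapA {L : ℝ} (hL : 0 < L) (n : ℕ) {u : L2 L} (h : u ∈ (lapA L).domain) :
    inner ℂ (eigenfn L n) (lapA L ⟨u, h⟩) = (eigenval L n : ℂ) * inner ℂ (eigenfn L n) u := by
  have h1 := inner_eigenfn_of_isWeakDeriv hL n
    (isWeakDeriv_grad_lapA ⟨u, mem_H10_of_mem_lapA h⟩ h)
  rw [inner_neg_right, neg_inj, ← freq_mul_inner_eigenfn] at h1
  rw [h1, eigenval_eq]
  push_cast
  ring

theorem summable_smul_eigenfn {L : ℝ} (hL : 0 < L) {a : ℕ → ℂ} :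
    Summable (fun n => a n • eigenfn L n) ↔ Summable fun n => ‖a n‖ ^ 2 := by
  have := (orthonormal_eigenfn hL).orthogonalFamily.summable_iff_norm_sq_summable
    (f := fun n => a n)
  simpa using this

theorem inner_eigenfn_tsum {L : ℝ} (hL : 0 < L) {a : ℕ → ℂ}
    (h : Summable fun n => a n • eigenfn L n) (n : ℕ) :
    inner ℂ (eigenfn L n) (∑' m, a m • eigenfn L m) = a n := by
  have h1 := h.hasSum.mapL (innerSL ℂ (eigenfn L n))
  refine h1.unique ?_
  have h2 : ∀ m, innerSL ℂ (eigenfn L n) (a m • eigenfn L m) = if m = n then a n else 0 := by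
    intro m
    rw [innerSL_apply_apply, inner_smul_right, orthonormal_iff_ite.1 (orthonormal_eigenfn hL)]
    by_cases hmn : m = n
    · subst hmn
      simp
    · simp [hmn, Ne.symm hmn]
  simp only [h2]
  exact hasSum_ite_eq n (a n)

/-- The sines, as a Hilbert basis of `L²(0, L)`. -/
theorem exists_hilbertBasis_eigenfn {L : ℝ} (hL : 0 < L) :
    ∃ b : HilbertBasis ℕ ℂ (L2 L), ⇑b = eigenfn L := by
  refine ⟨HilbertBasis.mkOfOrthogonalEqBot (orthonormal_eigenfn hL) ?_,
    HilbertBasis.coe_mkOfOrthogonalEqBot _ _⟩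
  rw [Submodule.eq_bot_iff]
  intro f hf
  refine eq_zero_of_inner_eigenfn hL fun n => ?_
  exact (Submodule.mem_orthogonal _ _).1 hf _ (Submodule.subset_span ⟨n, rfl⟩)

theorem inner_eq_inner_of_coeff {L : ℝ} (hL : 0 < L) {f g f' g' : L2 L}
    (h : ∀ n, inner ℂ f (eigenfn L n) * inner ℂ (eigenfn L n) g
      = inner ℂ f' (eigenfn L n) * inner ℂ (eigenfn L n) g') : inner ℂ f g = inner ℂ f' g' := by
  obtain ⟨b, hb⟩ := exists_hilbertBasis_eigenfn hL
  rw [← b.tsum_inner_mul_inner f g, ← b.tsum_inner_mul_inner f' g', hb]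
  exact tsum_congr h

/-- A function of `H¹₀(0, L)` with `∑ λₙ² |uₙ|² < ∞` lies in `D(A)`. -/
theorem mem_lapA_of_summable {L : ℝ} (hL : 0 < L) (u : H10 L)
    (h : Summable fun n => (eigenval L n * ‖inner ℂ (eigenfn L n) (u : L2 L)‖) ^ 2) :
    (u : L2 L) ∈ (lapA L).domain := by
  set a : ℕ → ℂ := fun n => (eigenval L n : ℂ) * inner ℂ (eigenfn L n) (u : L2 L) with ha
  have hs : Summable fun n => a n • eigenfn L n := by
    rw [summable_smul_eigenfn hL]
    refine h.congr fun n => ?_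
    rw [ha, norm_mul, Complex.norm_real, Real.norm_of_nonneg (eigenval_pos hL n).le]
  -- The series ∑ λₙ uₙ eₙ is the candidate for A u. Both derivatives are moved onto the test
  -- function, and the two pairings agree coefficient by coefficient.
  refine mem_lapA_of_isWeakDeriv (g := -∑' n, a n • eigenfn L n) (isWeakDeriv_iff_inner.2 ?_)
  intro q hq
  obtain ⟨r, hr⟩ := exists_testGraph_snd hq
  obtain ⟨h2, e2⟩ := grad_eq ((testGraph L).le_topologicalClosure hq)
  have h3 := inner_H10graph ((testGraph L).le_topologicalClosure hr) (isWeakDeriv_grad u)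
  simp only at h3
  rw [inner_neg_right, neg_neg, ← neg_eq_iff_eq_neg.2 h3, ← inner_neg_left]
  refine inner_eq_inner_of_coeff hL fun n => ?_
  have hm := testGraph_mem_lapA hq
  have e3 : lapA L ⟨q.1, hm⟩ = -r := lapA_eq (u := ⟨q.1, h2⟩) hm (by
    rw [e2]
    exact testGraph_isWeakDeriv hr)
  have h4 := inner_eigenfn_lapA hL n hm
  rw [e3] at h4
  have h5 := congrArg (starRingEnd ℂ) h4
  rw [inner_conj_symm, map_mul, Complex.conj_ofReal, inner_conj_symm] at h5
  rw [h5, inner_eigenfn_tsum hL hs, ha]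
  ring

/-! ### Fractional powers -/

theorem eigenval_le_eigenval {L : ℝ} (n : ℕ) : eigenval L 0 ≤ eigenval L n := by
  simp only [eigenval, div_pow, mul_pow]
  gcongr
  · simp

theorem rpow_eigenval_le {L : ℝ} (hL : 0 < L) {s t : ℝ} (hst : s ≤ t) (n : ℕ) :
    eigenval L n ^ s ≤ eigenval L 0 ^ (s - t) * eigenval L n ^ t := by
  have h : eigenval L n ^ s = eigenval L n ^ (s - t) * eigenval L n ^ t := by
    rw [← Real.rpow_add (eigenval_pos hL n), sub_add_cancel]
  rw [h]
  exact mul_le_mul_of_nonneg_right (Real.rpow_le_rpow_of_nonpos (eigenval_pos hL 0)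
    (eigenval_le_eigenval n) (by linarith)) (Real.rpow_nonneg (eigenval_pos hL n).le _)

theorem rpow_half_eigenval {L : ℝ} (hL : 0 < L) (n : ℕ) :
    eigenval L n ^ (1 / 2 : ℝ) = freq L n := by
  rw [← Real.sqrt_eq_rpow, eigenval_eq, Real.sqrt_sq (freq_pos hL n).le]

theorem mem_fracA_iff {L : ℝ} (hL : 0 < L) {θ : ℝ} {f : L2 L} : f ∈ (fracA L θ).domain ↔
    Summable fun n => (eigenval L n ^ θ * ‖inner ℂ (eigenfn L n) f‖) ^ 2 := by
  change Summable (fracTerm L θ f) ↔ _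
  unfold fracTerm
  rw [summable_smul_eigenfn hL]
  refine summable_congr fun n => ?_
  rw [norm_mul, Complex.norm_real, Real.norm_of_nonneg (Real.rpow_nonneg (eigenval_pos hL n).le _)]

theorem fracA_hasSum {L θ : ℝ} (f : (fracA L θ).domain) :
    HasSum (fun n => (((eigenval L n ^ θ : ℝ) : ℂ) * inner ℂ (eigenfn L n) (f : L2 L)) • eigenfn L n)
      (fracA L θ f) :=
  Summable.hasSum f.2

theorem inner_eigenfn_fracA {L : ℝ} (hL : 0 < L) {θ : ℝ} (f : (fracA L θ).domain) (n : ℕ) :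
    inner ℂ (eigenfn L n) (fracA L θ f)
      = ((eigenval L n ^ θ : ℝ) : ℂ) * inner ℂ (eigenfn L n) (f : L2 L) := by
  rw [← (fracA_hasSum f).tsum_eq]
  exact inner_eigenfn_tsum hL (fracA_hasSum f).summable n

theorem mem_fracA_of_le {L : ℝ} (hL : 0 < L) {s t : ℝ} (hst : s ≤ t) {f : L2 L}
    (h : Summable fun n => (eigenval L n ^ t * ‖inner ℂ (eigenfn L n) f‖) ^ 2) :
    f ∈ (fracA L s).domain := by
  rw [mem_fracA_iff hL]
  refine Summable.of_nonneg_of_le (fun n => by positivity) (fun n => ?_)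
    (h.mul_left ((eigenval L 0 ^ (s - t)) ^ 2))
  rw [← mul_pow, ← mul_assoc]
  have := Real.rpow_nonneg (eigenval_pos hL n).le s
  exact pow_le_pow_left₀ (by positivity)
    (mul_le_mul_of_nonneg_right (rpow_eigenval_le hL hst n) (norm_nonneg _)) 2

theorem freq_mul_norm_inner {L : ℝ} (hL : 0 < L) (n : ℕ) (u : H10 L) :
    freq L n * ‖inner ℂ (eigenfn L n) (u : L2 L)‖ = ‖inner ℂ (cosine L n) (grad L u)‖ := by
  rw [← freq_mul_inner_eigenfn, norm_mul, Complex.norm_real, Real.norm_of_nonneg (freq_pos hL n).le]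

/-- λₙ^(1/2)|uₙ| is the modulus of the n-th cosine coefficient of u_x, square summable by Bessel. -/
theorem H10_mem_fracA {L : ℝ} (hL : 0 < L) {θ : ℝ} (hθ : θ ≤ 1 / 2) (u : H10 L) :
    (u : L2 L) ∈ (fracA L θ).domain := by
  refine mem_fracA_of_le hL hθ ?_
  simp only [rpow_half_eigenval hL, freq_mul_norm_inner hL]
  exact (orthonormal_cosine hL).inner_products_summable (x := grad L u)

theorem lapA_mem_fracA {L : ℝ} (hL : 0 < L) {θ : ℝ} (hθ : θ ≤ 1) {u : L2 L}
    (hu : u ∈ (lapA L).domain) : u ∈ (fracA L θ).domain := by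
  refine mem_fracA_of_le hL hθ ?_
  refine ((orthonormal_eigenfn hL).inner_products_summable (x := lapA L ⟨u, hu⟩)).congr fun n => ?_
  rw [inner_eigenfn_lapA hL, norm_mul, Complex.norm_real, Real.norm_of_nonneg (eigenval_pos hL n).le,
    Real.rpow_one]

theorem inner_fracA_hasSum {L θ : ℝ} (f : (fracA L θ).domain) (g : L2 L) :
    HasSum (fun n => ((eigenval L n ^ θ : ℝ) : ℂ) * ((starRingEnd ℂ) (inner ℂ (eigenfn L n) (f : L2 L))
      * inner ℂ (eigenfn L n) g)) (inner ℂ (fracA L θ f) g) := by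
  have h := ((fracA_hasSum f).mapL (innerSL ℂ g)).star
  have e : star (innerSL ℂ g (fracA L θ f)) = inner ℂ (fracA L θ f) g := by
    rw [innerSL_apply_apply]
    exact inner_conj_symm _ _
  rw [e] at h
  refine (congrArg (fun F : ℕ → ℂ => HasSum F _) (funext fun n => ?_)).mpr h
  rw [innerSL_apply_apply, inner_smul_right, star_mul', star_mul']
  change _ = (starRingEnd ℂ) _ * (starRingEnd ℂ) _ * (starRingEnd ℂ) _
  rw [Complex.conj_ofReal, inner_conj_symm (eigenfn L n) g, mul_assoc]

theorem re_inner_fracA_nonneg {L : ℝ} (hL : 0 < L) {θ : ℝ} (f : (fracA L θ).domain) :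
    0 ≤ (inner ℂ (fracA L θ f) (f : L2 L)).re := by
  have h := (inner_fracA_hasSum f (f : L2 L)).mapL Complex.reCLM
  refine h.nonneg fun n => ?_
  rw [Complex.reCLM_apply, Complex.re_ofReal_mul, mul_comm ((starRingEnd ℂ) _), Complex.mul_conj,
    Complex.ofReal_re]
  exact mul_nonneg (Real.rpow_nonneg (eigenval_pos hL n).le _) (Complex.normSq_nonneg _)

/-- λₙ^θ ≤ λ₀^(θ-1) λₙ for θ ≤ 1. One factor λₙ^(1/2) goes to w and one to u, and Cauchy–Schwarz
with Bessel concludes. This bounds the damping term although A^θ w itself is not bounded by ‖w_x‖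
when θ > 1/2. -/
theorem norm_inner_fracA_le {L : ℝ} (hL : 0 < L) {θ : ℝ} (hθ : θ ≤ 1) (w u : H10 L)
    (hw : (w : L2 L) ∈ (fracA L θ).domain) : ‖inner ℂ (fracA L θ ⟨w, hw⟩) (u : L2 L)‖
      ≤ eigenval L 0 ^ (θ - 1) * (‖grad L w‖ * ‖grad L u‖) := by
  have h := inner_fracA_hasSum (⟨(w : L2 L), hw⟩ : (fracA L θ).domain) (u : L2 L)
  refine le_of_tendsto h.tendsto_sum_nat.norm (Eventually.of_forall fun N => ?_)
  have hC : 0 ≤ eigenval L 0 ^ (θ - 1) := Real.rpow_nonneg (eigenval_pos hL 0).le _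
  refine (norm_sum_le _ _).trans ?_
  calc _ ≤ ∑ n ∈ Finset.range N, eigenval L 0 ^ (θ - 1) *
        (‖inner ℂ (cosine L n) (grad L w)‖ * ‖inner ℂ (cosine L n) (grad L u)‖) := by
        refine Finset.sum_le_sum fun n _ => ?_
        rw [norm_mul, norm_mul, Complex.norm_real, RCLike.norm_conj,
          Real.norm_of_nonneg (Real.rpow_nonneg (eigenval_pos hL n).le _),
          ← freq_mul_norm_inner hL, ← freq_mul_norm_inner hL]
        have h1 := rpow_eigenval_le hL hθ n
        rw [Real.rpow_one, eigenval_eq L n] at h1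
        calc _ ≤ eigenval L 0 ^ (θ - 1) * freq L n ^ 2 * (‖inner ℂ (eigenfn L n) (w : L2 L)‖
              * ‖inner ℂ (eigenfn L n) (u : L2 L)‖) :=
              mul_le_mul_of_nonneg_right h1 (by positivity)
          _ = _ := by ring
    _ ≤ _ := by
        rw [← Finset.mul_sum]
        refine mul_le_mul_of_nonneg_left ?_ hC
        refine (Real.sum_mul_le_sqrt_mul_sqrt _ _ _).trans ?_
        refine mul_le_mul ?_ ?_ (Real.sqrt_nonneg _) (norm_nonneg _)
        · exact Real.sqrt_le_iff.2 ⟨norm_nonneg _, (orthonormal_cosine hL).sum_inner_products_le _⟩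
        · exact Real.sqrt_le_iff.2 ⟨norm_nonneg _, (orthonormal_cosine hL).sum_inner_products_le _⟩

/-! ### The energy space -/

namespace Energy

variable {p : Beam}

theorem exists_component_bound (p : Beam) : ∃ C : ℝ, 0 ≤ C ∧ ∀ U : Energy p,
    ‖U.w‖ ≤ C * ‖U‖ ∧ ‖U.v‖ ≤ C * ‖U‖ ∧ ‖U.shear‖ ≤ C * ‖U‖ ∧ ‖grad p.L U.ψ‖ ≤ C * ‖U‖ ∧
    ‖grad p.L U.u‖ ≤ C * ‖U‖ ∧ ‖(U.ψ : L2 p.L)‖ ≤ C * ‖U‖ ∧ ‖(U.u : L2 p.L)‖ ≤ C * ‖U‖ := by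
  obtain ⟨C, hC0, hC⟩ := exists_bound p
  obtain ⟨K, hK0, hK⟩ := exists_poincare p.L
  -- A common majorant of C, KC, C + KC and K(C + KC), the constants obtained by using Poincaré for
  -- ψ and then for u.
  refine ⟨(1 + K) * (C + K * C), by positivity, fun U => ?_⟩
  obtain ⟨h1, h2, h3, h4⟩ := hC U
  have h5 : ‖(U.ψ : L2 p.L)‖ ≤ K * C * ‖U‖ := by
    rw [mul_assoc]
    exact (hK _).trans (mul_le_mul_of_nonneg_left h4 hK0)
  have h6 : ‖grad p.L U.u‖ ≤ (C + K * C) * ‖U‖ := by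
    have := u_norm_le U
    rw [add_mul]
    exact this.trans (add_le_add h3 h5)
  have h7 : ‖(U.u : L2 p.L)‖ ≤ K * (C + K * C) * ‖U‖ := by
    rw [mul_assoc]
    exact (hK _).trans (mul_le_mul_of_nonneg_left h6 hK0)
  have g1 : 0 ≤ C * ‖U‖ := by positivity
  have g2 : 0 ≤ K * C * ‖U‖ := by positivity
  have g3 : 0 ≤ K * (K * C) * ‖U‖ := by positivity
  have e : (1 + K) * (C + K * C) * ‖U‖ = C * ‖U‖ + 2 * (K * C * ‖U‖) + K * (K * C) * ‖U‖ := by ring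
  have e6 : (C + K * C) * ‖U‖ = C * ‖U‖ + K * C * ‖U‖ := by ring
  have e7 : K * (C + K * C) * ‖U‖ = K * C * ‖U‖ + K * (K * C) * ‖U‖ := by ring
  rw [e]
  rw [e6] at h6
  rw [e7] at h7
  refine ⟨?_, ?_, ?_, ?_, ?_, ?_, ?_⟩ <;> linarith

/-- The components of `U`, as bounded operators. -/
def uC (p : Beam) : Energy p →L[ℂ] L2 p.L :=
  LinearMap.mkContinuous ⟨⟨fun U => (U.u : L2 p.L), fun _ _ => rfl⟩, fun _ _ => rfl⟩ _
    fun U => ((exists_component_bound p).choose_spec.2 U).2.2.2.2.2.2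

def ψC (p : Beam) : Energy p →L[ℂ] L2 p.L :=
  LinearMap.mkContinuous ⟨⟨fun U => (U.ψ : L2 p.L), fun _ _ => rfl⟩, fun _ _ => rfl⟩ _
    fun U => ((exists_component_bound p).choose_spec.2 U).2.2.2.2.2.1

def wC (p : Beam) : Energy p →L[ℂ] L2 p.L :=
  LinearMap.mkContinuous wL _ fun U => ((exists_component_bound p).choose_spec.2 U).1

def vC (p : Beam) : Energy p →L[ℂ] L2 p.L :=
  LinearMap.mkContinuous vL _ fun U => ((exists_component_bound p).choose_spec.2 U).2.1

def shearC (p : Beam) : Energy p →L[ℂ] L2 p.L :=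
  LinearMap.mkContinuous shearL _ fun U => ((exists_component_bound p).choose_spec.2 U).2.2.1

def gradψC (p : Beam) : Energy p →L[ℂ] L2 p.L :=
  LinearMap.mkContinuous (grad p.L ∘ₗ ψL) _
    fun U => ((exists_component_bound p).choose_spec.2 U).2.2.2.1

theorem uC_apply (U : Energy p) : uC p U = (U.u : L2 p.L) := rfl
theorem ψC_apply (U : Energy p) : ψC p U = (U.ψ : L2 p.L) := rfl
theorem wC_apply (U : Energy p) : wC p U = U.w := rfl
theorem vC_apply (U : Energy p) : vC p U = U.v := rfl
theorem shearC_apply (U : Energy p) : shearC p U = U.shear := rfl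
theorem gradψC_apply (U : Energy p) : gradψC p U = grad p.L U.ψ := rfl

theorem tendsto_of_components {s : ℕ → Energy p} {U : Energy p}
    (hu : Tendsto (fun n => grad p.L (s n).u) atTop (𝓝 (grad p.L U.u)))
    (hw : Tendsto (fun n => (s n).w) atTop (𝓝 U.w))
    (hψ : Tendsto (fun n => ((s n).ψ : L2 p.L)) atTop (𝓝 U.ψ))
    (hψ' : Tendsto (fun n => grad p.L (s n).ψ) atTop (𝓝 (grad p.L U.ψ)))
    (hv : Tendsto (fun n => (s n).v) atTop (𝓝 U.v)) : Tendsto s atTop (𝓝 U) := by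
  rw [tendsto_iff_norm_sub_tendsto_zero]
  have hz : Tendsto (fun n => ‖s n - U‖ ^ 2) atTop (𝓝 0) := by
    have e : ∀ n, ‖s n - U‖ ^ 2 = p.ρ₁ * ‖(s n).w - U.w‖ ^ 2 + p.ρ₂ * ‖(s n).v - U.v‖ ^ 2
        + p.κ * ‖(grad p.L (s n).u - grad p.L U.u) + (((s n).ψ : L2 p.L) - U.ψ)‖ ^ 2
        + p.b * ‖grad p.L (s n).ψ - grad p.L U.ψ‖ ^ 2 := by
      intro n
      rw [norm_sq, shear, u_sub, ψ_sub, map_sub, map_sub, Submodule.coe_sub]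
      rfl
    simp only [e]
    have t := ((((hw.sub_const U.w).norm.pow 2).const_mul p.ρ₁).add
      (((hv.sub_const U.v).norm.pow 2).const_mul p.ρ₂)).add
      ((((hu.sub_const (grad p.L U.u)).add (hψ.sub_const (U.ψ : L2 p.L))).norm.pow 2).const_mul p.κ)
      |>.add (((hψ'.sub_const (grad p.L U.ψ)).norm.pow 2).const_mul p.b)
    simpa using t
  have := hz.sqrt
  simpa [Real.sqrt_sq] using this

end Energy

/-- A function orthogonal to all test functions is a weak derivative of 0, hence 0. -/
theorem dense_testGraph_fst (L : ℝ) : Dense ((testGraph L).map (LinearMap.fst ℂ _ _) : Set (L2 L)) := by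
  rw [Submodule.dense_iff_topologicalClosure_eq_top, Submodule.topologicalClosure_eq_top_iff,
    Submodule.eq_bot_iff]
  intro f hf
  have : IsWeakDeriv L 0 f := isWeakDeriv_iff_inner.2 fun q hq => by
    rw [inner_zero_right, (Submodule.mem_orthogonal _ _).1 hf q.1 ⟨q, hq, rfl⟩, neg_zero]
  exact this.unique (IsWeakDeriv.zero L)

theorem exists_seq_H10 {L : ℝ} (u : H10 L) : ∃ s : ℕ → H10 L, (∀ n, (s n : L2 L) ∈ (lapA L).domain) ∧
    Tendsto (fun n => (s n : L2 L)) atTop (𝓝 u) ∧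
    Tendsto (fun n => grad L (s n)) atTop (𝓝 (grad L u)) := by
  obtain ⟨q, hq, hl⟩ := mem_closure_iff_seq_limit.1 (show ((u : L2 L), grad L u) ∈
    closure (testGraph L : Set (L2 L × L2 L)) from grad_mem u)
  choose h e using fun n => grad_eq ((testGraph L).le_topologicalClosure (hq n))
  refine ⟨fun n => ⟨(q n).1, h n⟩, fun n => testGraph_mem_lapA (hq n),
    (continuous_fst.tendsto _).comp hl, ?_⟩
  simp only [e]
  exact (continuous_snd.tendsto _).comp hl

theorem exists_seq_L2 {L : ℝ} (f : L2 L) : ∃ s : ℕ → L2 L, (∀ n, s n ∈ (lapA L).domain) ∧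
    Tendsto s atTop (𝓝 f) := by
  obtain ⟨s, hs, hl⟩ := mem_closure_iff_seq_limit.1 (dense_testGraph_fst L f)
  refine ⟨s, fun n => ?_, hl⟩
  obtain ⟨q, hq, e⟩ := hs n
  rw [← e]
  exact testGraph_mem_lapA hq

/-! ### The operator `B` -/

section Operator

variable {p : Beam} {τ σ : ℝ}

theorem dense_domB (hτ : τ ≤ 1) (hσ : σ ≤ 1) : Dense (domB p τ σ : Set (Energy p)) := by
  intro U
  obtain ⟨u, hu, -, hu2⟩ := exists_seq_H10 U.u
  obtain ⟨ψ, hψ, hψ1, hψ2⟩ := exists_seq_H10 U.ψ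
  obtain ⟨w, hw, hw1⟩ := exists_seq_L2 U.w
  obtain ⟨v, hv, hv1⟩ := exists_seq_L2 U.v
  refine mem_closure_of_tendsto (f := fun n => Energy.mk (u n) (w n) (ψ n) (v n)) (b := atTop)
    (Energy.tendsto_of_components hu2 hw1 hψ1 hψ2 hv1) (Eventually.of_forall fun n => ?_)
  exact ⟨hu n, ⟨mem_H10_of_mem_lapA (hw n), lapA_mem_fracA p.L_pos hτ (hw n)⟩, hψ n,
    mem_H10_of_mem_lapA (hv n), lapA_mem_fracA p.L_pos hσ (hv n)⟩

theorem rho_smul_opB_w (U : (opB p τ σ).domain) : (p.ρ₁ : ℂ) • (opB p τ σ U).w =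
    (p.κ : ℂ) • dx p.L ⟨U.1.shear, shear_mem_dx U⟩ - fracA p.L τ ⟨U.1.w, U.2.2.1.2⟩ := by
  rw [opB_apply]
  exact smul_inv_smul₀ (Complex.ofReal_ne_zero.2 p.ρ₁_pos.ne') _

theorem rho_smul_opB_v (U : (opB p τ σ).domain) : (p.ρ₂ : ℂ) • (opB p τ σ U).v =
    -((p.b : ℂ) • lapA p.L ⟨U.1.ψ, U.2.2.2.1⟩) - (p.κ : ℂ) • U.1.shear
      - fracA p.L σ ⟨U.1.v, U.2.2.2.2.2⟩ := by
  rw [opB_apply]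
  exact smul_inv_smul₀ (Complex.ofReal_ne_zero.2 p.ρ₂_pos.ne') _

/-- The variational form of the two momentum equations. Testing with (w, v) gives dissipativity,
testing with (u, ψ) gives the lower bound. -/
theorem opB_weak (U : (opB p τ σ).domain) (φ χ : H10 p.L) :
    (p.ρ₁ : ℂ) * inner ℂ (φ : L2 p.L) (opB p τ σ U).w + (p.ρ₂ : ℂ) * inner ℂ (χ : L2 p.L) (opB p τ σ U).v
    = -((p.κ : ℂ) * inner ℂ (grad p.L φ + (χ : L2 p.L)) U.1.shear
        + (p.b : ℂ) * inner ℂ (grad p.L χ) (grad p.L U.1.ψ))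
      - inner ℂ (φ : L2 p.L) (fracA p.L τ ⟨U.1.w, U.2.2.1.2⟩)
      - inner ℂ (χ : L2 p.L) (fracA p.L σ ⟨U.1.v, U.2.2.2.2.2⟩) := by
  rw [← inner_smul_right, ← inner_smul_right, rho_smul_opB_w, rho_smul_opB_v, inner_sub_right,
    inner_sub_right, inner_sub_right, inner_neg_right, inner_smul_right, inner_smul_right,
    inner_smul_right, inner_add_left]
  have h1 := inner_grad φ (dx_spec ⟨U.1.shear, shear_mem_dx U⟩)
  have h2 := inner_grad χ (isWeakDeriv_grad_lapA U.1.ψ U.2.2.2.1)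
  rw [inner_neg_right, neg_neg] at h2
  simp only at h1
  rw [h1, h2]
  ring

/-- The elastic terms cancel in the real part, leaving -Re⟨A^τ w, w⟩ - Re⟨A^σ v, v⟩. -/
theorem isDissipative_opB : IsDissipative (opB p τ σ) := by
  intro U
  have h := opB_weak U ⟨U.1.w, U.2.2.1.1⟩ ⟨U.1.v, U.2.2.2.2.1⟩
  have h1 := re_inner_fracA_nonneg p.L_pos (⟨U.1.w, U.2.2.1.2⟩ : (fracA p.L τ).domain)
  have h2 := re_inner_fracA_nonneg p.L_pos (⟨U.1.v, U.2.2.2.2.2⟩ : (fracA p.L σ).domain)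
  have e : inner ℂ (U : Energy p) (opB p τ σ U)
      = (p.ρ₁ : ℂ) * inner ℂ U.1.w (opB p τ σ U).w + (p.ρ₂ : ℂ) * inner ℂ U.1.v (opB p τ σ U).v
        + ((p.κ : ℂ) * inner ℂ U.1.shear (grad p.L ⟨U.1.w, U.2.2.1.1⟩ + U.1.v)
        + (p.b : ℂ) * inner ℂ (grad p.L U.1.ψ) (grad p.L ⟨U.1.v, U.2.2.2.2.1⟩)) := by
    rw [← add_assoc]
    rfl
  simp only at h
  rw [← inner_conj_symm, Complex.conj_re, e, h]
  have c1 : (inner ℂ U.1.shear (grad p.L ⟨U.1.w, U.2.2.1.1⟩ + U.1.v)).re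
      = (inner ℂ (grad p.L ⟨U.1.w, U.2.2.1.1⟩ + U.1.v) U.1.shear).re := inner_re_symm (𝕜 := ℂ) _ _
  have c2 : (inner ℂ (grad p.L U.1.ψ) (grad p.L ⟨U.1.v, U.2.2.2.2.1⟩)).re
      = (inner ℂ (grad p.L ⟨U.1.v, U.2.2.2.2.1⟩) (grad p.L U.1.ψ)).re := inner_re_symm (𝕜 := ℂ) _ _
  have c3 : (inner ℂ U.1.w (fracA p.L τ ⟨U.1.w, U.2.2.1.2⟩)).re
      = (inner ℂ (fracA p.L τ ⟨U.1.w, U.2.2.1.2⟩) U.1.w).re := inner_re_symm (𝕜 := ℂ) _ _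
  have c4 : (inner ℂ U.1.v (fracA p.L σ ⟨U.1.v, U.2.2.2.2.2⟩)).re
      = (inner ℂ (fracA p.L σ ⟨U.1.v, U.2.2.2.2.2⟩) U.1.v).re := inner_re_symm (𝕜 := ℂ) _ _
  simp only [Complex.add_re, Complex.sub_re, Complex.neg_re, Complex.re_ofReal_mul, c1, c2, c3, c4]
  linarith

theorem exists_opB_lower_bound (hτ : τ ≤ 1) (hσ : σ ≤ 1) :
    ∃ K : ℝ, ∀ U : (opB p τ σ).domain, ‖(U : Energy p)‖ ≤ K * ‖opB p τ σ U‖ := by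
  obtain ⟨C, hC0, hC⟩ := Energy.exists_component_bound p
  have hρ₁ := p.ρ₁_pos
  have hρ₂ := p.ρ₂_pos
  set c₁ : ℝ := eigenval p.L 0 ^ (τ - 1) with hc₁
  set c₂ : ℝ := eigenval p.L 0 ^ (σ - 1) with hc₂
  have hc₁0 : 0 ≤ c₁ := Real.rpow_nonneg (eigenval_pos p.L_pos 0).le _
  have hc₂0 : 0 ≤ c₂ := Real.rpow_nonneg (eigenval_pos p.L_pos 0).le _
  set M : ℝ := (p.ρ₁ + p.ρ₂ + c₁ + c₂) * C ^ 2 with hM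
  have hM0 : 0 ≤ M := by positivity
  refine ⟨√((p.ρ₁ + p.ρ₂) * C ^ 2 + M ^ 2), fun U => ?_⟩
  set F := opB p τ σ U with hF
  -- The elastic part of U. The weak form tested with (u, ψ) expresses ‖Y‖² through the data and the
  -- damping terms.
  set Y : Energy p := Energy.mk U.1.u 0 U.1.ψ 0 with hY
  obtain ⟨f1, f2, -, f4, f5, f6, f7⟩ := hC F
  obtain ⟨-, -, -, y4, y5, y6, y7⟩ := hC Y
  change ‖grad p.L U.1.ψ‖ ≤ _ at y4
  change ‖grad p.L U.1.u‖ ≤ _ at y5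
  change ‖(U.1.ψ : L2 p.L)‖ ≤ _ at y6
  change ‖(U.1.u : L2 p.L)‖ ≤ _ at y7
  -- The first and third components of F = BU are w and v, so ‖F‖ controls w and v in H¹₀ and not
  -- merely in L².
  change ‖U.1.v‖ ≤ _ at f6
  change ‖U.1.w‖ ≤ _ at f7
  have hYn : ‖Y‖ ^ 2 = p.κ * ‖U.1.shear‖ ^ 2 + p.b * ‖grad p.L U.1.ψ‖ ^ 2 := by
    have : ‖Y‖ ^ 2 = p.ρ₁ * ‖(0 : L2 p.L)‖ ^ 2 + p.ρ₂ * ‖(0 : L2 p.L)‖ ^ 2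
      + p.κ * ‖U.1.shear‖ ^ 2 + p.b * ‖grad p.L U.1.ψ‖ ^ 2 := Energy.norm_sq Y
    rw [this, norm_zero]
    ring
  have hUn : ‖(U : Energy p)‖ ^ 2 = p.ρ₁ * ‖U.1.w‖ ^ 2 + p.ρ₂ * ‖U.1.v‖ ^ 2 + ‖Y‖ ^ 2 := by
    rw [Energy.norm_sq, hYn]
    ring
  have hw := opB_weak U U.1.u U.1.ψ
  rw [← hF] at hw
  have e1 : ((‖Y‖ ^ 2 : ℝ) : ℂ) = (p.κ : ℂ) * inner ℂ (grad p.L U.1.u + (U.1.ψ : L2 p.L)) U.1.shear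
        + (p.b : ℂ) * inner ℂ (grad p.L U.1.ψ) (grad p.L U.1.ψ) := by
    rw [hYn, show grad p.L U.1.u + (U.1.ψ : L2 p.L) = U.1.shear from rfl,
      inner_self_eq_norm_sq_to_K, inner_self_eq_norm_sq_to_K]
    push_cast
    rfl
  rw [← e1] at hw
  have e2 : ((‖Y‖ ^ 2 : ℝ) : ℂ) = -((p.ρ₁ : ℂ) * inner ℂ (U.1.u : L2 p.L) F.w
      + (p.ρ₂ : ℂ) * inner ℂ (U.1.ψ : L2 p.L) F.v
      + inner ℂ (U.1.u : L2 p.L) (fracA p.L τ ⟨U.1.w, U.2.2.1.2⟩)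
      + inner ℂ (U.1.ψ : L2 p.L) (fracA p.L σ ⟨U.1.v, U.2.2.2.2.2⟩)) := by
    linear_combination hw
  have e3 := congrArg norm e2
  rw [Complex.norm_real, Real.norm_of_nonneg (by positivity), norm_neg] at e3
  have b1 : ‖(p.ρ₁ : ℂ) * inner ℂ (U.1.u : L2 p.L) F.w‖ ≤ p.ρ₁ * ((C * ‖Y‖) * (C * ‖F‖)) := by
    rw [norm_mul, Complex.norm_real, Real.norm_of_nonneg hρ₁.le]
    exact mul_le_mul_of_nonneg_left ((norm_inner_le_norm _ _).trans
      (mul_le_mul y7 f1 (norm_nonneg _) (by positivity))) hρ₁.le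
  have b2 : ‖(p.ρ₂ : ℂ) * inner ℂ (U.1.ψ : L2 p.L) F.v‖ ≤ p.ρ₂ * ((C * ‖Y‖) * (C * ‖F‖)) := by
    rw [norm_mul, Complex.norm_real, Real.norm_of_nonneg hρ₂.le]
    exact mul_le_mul_of_nonneg_left ((norm_inner_le_norm _ _).trans
      (mul_le_mul y6 f2 (norm_nonneg _) (by positivity))) hρ₂.le
  have b3 : ‖inner ℂ (U.1.u : L2 p.L) (fracA p.L τ ⟨U.1.w, U.2.2.1.2⟩)‖
      ≤ c₁ * ((C * ‖F‖) * (C * ‖Y‖)) := by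
    rw [norm_inner_symm]
    refine (norm_inner_fracA_le p.L_pos hτ ⟨U.1.w, U.2.2.1.1⟩ U.1.u U.2.2.1.2).trans ?_
    exact mul_le_mul_of_nonneg_left (mul_le_mul f5 y5 (norm_nonneg _) (by positivity)) hc₁0
  have b4 : ‖inner ℂ (U.1.ψ : L2 p.L) (fracA p.L σ ⟨U.1.v, U.2.2.2.2.2⟩)‖
      ≤ c₂ * ((C * ‖F‖) * (C * ‖Y‖)) := by
    rw [norm_inner_symm]
    refine (norm_inner_fracA_le p.L_pos hσ ⟨U.1.v, U.2.2.2.2.1⟩ U.1.ψ U.2.2.2.2.2).trans ?_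
    exact mul_le_mul_of_nonneg_left (mul_le_mul f4 y4 (norm_nonneg _) (by positivity)) hc₂0
  have hYF : ‖Y‖ ^ 2 ≤ M * ‖F‖ * ‖Y‖ := by
    rw [e3]
    refine (norm_add_le _ _).trans ?_
    refine (add_le_add ((norm_add_le _ _).trans (add_le_add ((norm_add_le _ _).trans
      (add_le_add b1 b2)) b3)) b4).trans (le_of_eq ?_)
    rw [hM]
    ring
  have hYM : ‖Y‖ ≤ M * ‖F‖ := by
    by_cases h0 : ‖Y‖ = 0
    · rw [h0]
      positivity
    · have : 0 < ‖Y‖ := lt_of_le_of_ne (norm_nonneg _) (Ne.symm h0)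
      rw [sq] at hYF
      exact le_of_mul_le_mul_right hYF this
  have hfin : ‖(U : Energy p)‖ ^ 2 ≤ ((p.ρ₁ + p.ρ₂) * C ^ 2 + M ^ 2) * ‖F‖ ^ 2 := by
    have d1 := mul_le_mul_of_nonneg_left (pow_le_pow_left₀ (norm_nonneg _) f7 2) hρ₁.le
    have d2 := mul_le_mul_of_nonneg_left (pow_le_pow_left₀ (norm_nonneg _) f6 2) hρ₂.le
    have d3 := pow_le_pow_left₀ (norm_nonneg _) hYM 2
    rw [hUn]
    refine (add_le_add (add_le_add d1 d2) d3).trans (le_of_eq ?_)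
    ring
  refine le_of_sq_le_sq ?_ (by positivity)
  rw [mul_pow, Real.sq_sqrt (by positivity)]
  exact hfin

/-- Solution of the stationary problem `κ(u_x + ψ)_x = f`, `-bAψ - κ(u_x + ψ) = g`. -/
theorem exists_stationary (p : Beam) (f g : L2 p.L) : ∃ X : Energy p,
    IsWeakDeriv p.L X.shear ((p.κ : ℂ)⁻¹ • f) ∧
    IsWeakDeriv p.L (grad p.L X.ψ) ((p.b : ℂ)⁻¹ • ((p.κ : ℂ) • X.shear + g)) := by
  -- Riesz representation of this functional in the energy inner product replaces a separate
  -- Lax–Milgram argument; testing with pure u and pure ψ then separates the two equations.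
  set l : StrongDual ℂ (Energy p) :=
    -((innerSL ℂ f).comp (Energy.uC p)) - (innerSL ℂ g).comp (Energy.ψC p) with hl
  obtain ⟨X, hX⟩ := (InnerProductSpace.toDual ℂ (Energy p)).surjective l
  have hV : ∀ V : Energy p, inner ℂ X V = -inner ℂ f (V.u : L2 p.L) - inner ℂ g (V.ψ : L2 p.L) := by
    intro V
    have := DFunLike.congr_fun hX V
    rwa [InnerProductSpace.toDual_apply_apply] at this
  have hκ : (p.κ : ℂ) ≠ 0 := Complex.ofReal_ne_zero.2 p.κ_pos.ne'
  have hb : (p.b : ℂ) ≠ 0 := Complex.ofReal_ne_zero.2 p.b_pos.ne'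
  refine ⟨X, isWeakDeriv_of_inner_grad fun φ => ?_, isWeakDeriv_of_inner_grad fun χ => ?_⟩
  · have h := hV (Energy.mk φ 0 0 0)
    have e : inner ℂ X (Energy.mk φ 0 0 0) = (p.ρ₁ : ℂ) * inner ℂ X.w 0 + (p.ρ₂ : ℂ) * inner ℂ X.v 0
        + (p.κ : ℂ) * inner ℂ X.shear (grad p.L φ + ((0 : H10 p.L) : L2 p.L))
        + (p.b : ℂ) * inner ℂ (grad p.L X.ψ) (grad p.L 0) := rfl
    have e' : -inner ℂ f ((Energy.mk φ 0 0 0 : Energy p).u : L2 p.L)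
        - inner ℂ g ((Energy.mk φ 0 0 0 : Energy p).ψ : L2 p.L)
        = -inner ℂ f (φ : L2 p.L) - inner ℂ g ((0 : H10 p.L) : L2 p.L) := rfl
    rw [e, e', map_zero, Submodule.coe_zero] at h
    simp only [inner_zero_right, mul_zero, add_zero, zero_add, sub_zero] at h
    have h' := congrArg (starRingEnd ℂ) h
    rw [map_mul, Complex.conj_ofReal, inner_conj_symm, map_neg, inner_conj_symm] at h'
    rw [inner_smul_right, eq_comm, neg_eq_iff_eq_neg, ← mul_right_inj' hκ, mul_inv_cancel_left₀ hκ]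
    linear_combination h'
  · have h := hV (Energy.mk 0 0 χ 0)
    have e : inner ℂ X (Energy.mk 0 0 χ 0) = (p.ρ₁ : ℂ) * inner ℂ X.w 0 + (p.ρ₂ : ℂ) * inner ℂ X.v 0
        + (p.κ : ℂ) * inner ℂ X.shear (grad p.L 0 + (χ : L2 p.L))
        + (p.b : ℂ) * inner ℂ (grad p.L X.ψ) (grad p.L χ) := rfl
    have e' : -inner ℂ f ((Energy.mk 0 0 χ 0 : Energy p).u : L2 p.L)
        - inner ℂ g ((Energy.mk 0 0 χ 0 : Energy p).ψ : L2 p.L)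
        = -inner ℂ f ((0 : H10 p.L) : L2 p.L) - inner ℂ g (χ : L2 p.L) := rfl
    rw [e, e', map_zero, Submodule.coe_zero] at h
    simp only [inner_zero_right, mul_zero, add_zero, zero_add, neg_zero, zero_sub] at h
    have h' := congrArg (starRingEnd ℂ) h
    simp only [map_add, map_mul, Complex.conj_ofReal, inner_conj_symm, map_neg] at h'
    rw [inner_smul_right, inner_add_right, inner_smul_right, eq_comm, neg_eq_iff_eq_neg,
      ← mul_right_inj' hb, mul_inv_cancel_left₀ hb]
    linear_combination h'

/-- The velocities must be F.u and F.ψ. Their damping moves to the right-hand side, which is why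
these must lie in D(A^τ) and D(A^σ), and a stationary problem for (u, ψ) remains. -/
theorem exists_opB_eq (F : Energy p) (h₁ : (F.u : L2 p.L) ∈ (fracA p.L τ).domain)
    (h₂ : (F.ψ : L2 p.L) ∈ (fracA p.L σ).domain) : ∃ U, opB p τ σ U = F := by
  obtain ⟨X, hs, hψ⟩ := exists_stationary p ((p.ρ₁ : ℂ) • F.w + fracA p.L τ ⟨F.u, h₁⟩)
    ((p.ρ₂ : ℂ) • F.v + fracA p.L σ ⟨F.ψ, h₂⟩)
  have hψm := mem_lapA_of_isWeakDeriv hψ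
  have hum : (X.u : L2 p.L) ∈ (lapA p.L).domain := by
    -- The shear and ψ both have weak derivatives in L², hence so does u_x.
    have h : IsWeakDeriv p.L (X.shear + (-1 : ℂ) • (X.ψ : L2 p.L)) _ :=
      hs.add ((isWeakDeriv_grad X.ψ).smul (-1))
    rw [Energy.shear, neg_one_smul, add_neg_cancel_right] at h
    exact mem_lapA_of_isWeakDeriv h
  have hm : Energy.mk X.u F.u X.ψ F.ψ ∈ domB p τ σ :=
    ⟨hum, ⟨F.u.2, h₁⟩, hψm, F.ψ.2, h₂⟩
  refine ⟨⟨_, hm⟩, ?_⟩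
  have hκ : (p.κ : ℂ) ≠ 0 := Complex.ofReal_ne_zero.2 p.κ_pos.ne'
  have hb : (p.b : ℂ) ≠ 0 := Complex.ofReal_ne_zero.2 p.b_pos.ne'
  have hρ₁ : (p.ρ₁ : ℂ) ≠ 0 := Complex.ofReal_ne_zero.2 p.ρ₁_pos.ne'
  have hρ₂ : (p.ρ₂ : ℂ) ≠ 0 := Complex.ofReal_ne_zero.2 p.ρ₂_pos.ne'
  have e1 : (opB p τ σ ⟨_, hm⟩).w = F.w := by
    have h := rho_smul_opB_w (⟨_, hm⟩ : (opB p τ σ).domain)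
    have hd : dx p.L ⟨X.shear, _, hs⟩ = _ := dx_eq ⟨X.shear, _, hs⟩ hs
    have h' : (p.ρ₁ : ℂ) • (opB p τ σ ⟨_, hm⟩).w = (p.κ : ℂ) • dx p.L ⟨X.shear, _, hs⟩
      - fracA p.L τ ⟨F.u, h₁⟩ := h
    rw [hd, smul_inv_smul₀ hκ, add_sub_cancel_right] at h'
    exact smul_right_injective _ hρ₁ h'
  have e2 : (opB p τ σ ⟨_, hm⟩).v = F.v := by
    have h := rho_smul_opB_v (⟨_, hm⟩ : (opB p τ σ).domain)
    have h' : (p.ρ₂ : ℂ) • (opB p τ σ ⟨_, hm⟩).v = -((p.b : ℂ) • lapA p.L ⟨X.ψ, hψm⟩)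
      - (p.κ : ℂ) • X.shear - fracA p.L σ ⟨F.ψ, h₂⟩ := h
    rw [lapA_eq hψm hψ, smul_neg, neg_neg, smul_inv_smul₀ hb, add_sub_cancel_left,
      add_sub_cancel_right] at h'
    exact smul_right_injective _ hρ₂ h'
  exact Prod.ext rfl (Prod.ext e1 (Prod.ext rfl e2))

theorem denseRange_opB (hτ : τ ≤ 1) (hσ : σ ≤ 1) : DenseRange (opB p τ σ) := by
  refine (dense_domB hτ hσ).mono fun F hF => ?_
  exact exists_opB_eq F (lapA_mem_fracA p.L_pos hτ hF.1) (lapA_mem_fracA p.L_pos hσ hF.2.2.1)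

theorem surjective_opB (hτ : τ ≤ 1 / 2) (hσ : σ ≤ 1 / 2) (F : Energy p) : ∃ U, opB p τ σ U = F :=
  exists_opB_eq F (H10_mem_fracA p.L_pos hτ F.u) (H10_mem_fracA p.L_pos hσ F.ψ)

/-! ### Modes of the elements of the domain of the closure -/

theorem closure_graph_u {U F : Energy p} (h : (U, F) ∈ (opB p τ σ).graph.topologicalClosure) :
    (F.u : L2 p.L) = U.w ∧ (F.ψ : L2 p.L) = U.v := by
  have hc : IsClosed {q : Energy p × Energy p | Energy.uC p q.2 = Energy.wC p q.1 ∧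
      Energy.ψC p q.2 = Energy.vC p q.1} :=
    (isClosed_eq (by fun_prop) (by fun_prop)).inter (isClosed_eq (by fun_prop) (by fun_prop))
  refine closure_minimal ?_ hc h
  rintro q hq
  obtain ⟨z, h1, h2⟩ := (LinearPMap.mem_graph_iff _).1 hq
  rw [Set.mem_ofPred_eq, ← h1, ← h2]
  exact ⟨rfl, rfl⟩

/-- On the closure (u_x + ψ)_x and A^τ w need not lie in L² separately, but each sine coefficient of
the equation is continuous in the energy norm and survives the limit. -/
theorem closure_graph_modes {U F : Energy p} (h : (U, F) ∈ (opB p τ σ).graph.topologicalClosure)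
    (n : ℕ) :
    (p.ρ₁ : ℂ) * inner ℂ (eigenfn p.L n) F.w
      = -((p.κ : ℂ) * eigenval p.L n * inner ℂ (eigenfn p.L n) (U.u : L2 p.L))
        + (p.κ : ℂ) * inner ℂ (eigenfn p.L n) (grad p.L U.ψ)
        - ((eigenval p.L n ^ τ : ℝ) : ℂ) * inner ℂ (eigenfn p.L n) U.w ∧
    (p.ρ₂ : ℂ) * inner ℂ (eigenfn p.L n) F.v
      = -((p.b : ℂ) * eigenval p.L n * inner ℂ (eigenfn p.L n) (U.ψ : L2 p.L))
        - (p.κ : ℂ) * inner ℂ (eigenfn p.L n) U.shear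
        - ((eigenval p.L n ^ σ : ℝ) : ℂ) * inner ℂ (eigenfn p.L n) U.v := by
  have hc : IsClosed {q : Energy p × Energy p |
      (p.ρ₁ : ℂ) * inner ℂ (eigenfn p.L n) (Energy.wC p q.2)
        = -((p.κ : ℂ) * eigenval p.L n * inner ℂ (eigenfn p.L n) (Energy.uC p q.1))
        + (p.κ : ℂ) * inner ℂ (eigenfn p.L n) (Energy.gradψC p q.1)
        - ((eigenval p.L n ^ τ : ℝ) : ℂ) * inner ℂ (eigenfn p.L n) (Energy.wC p q.1) ∧
      (p.ρ₂ : ℂ) * inner ℂ (eigenfn p.L n) (Energy.vC p q.2)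
        = -((p.b : ℂ) * eigenval p.L n * inner ℂ (eigenfn p.L n) (Energy.ψC p q.1))
        - (p.κ : ℂ) * inner ℂ (eigenfn p.L n) (Energy.shearC p q.1)
        - ((eigenval p.L n ^ σ : ℝ) : ℂ) * inner ℂ (eigenfn p.L n) (Energy.vC p q.1)} :=
    (isClosed_eq (by fun_prop) (by fun_prop)).inter (isClosed_eq (by fun_prop) (by fun_prop))
  refine closure_minimal ?_ hc h
  rintro q hq
  obtain ⟨z, h1, h2⟩ := (LinearPMap.mem_graph_iff _).1 hq
  rw [Set.mem_ofPred_eq, ← h1, ← h2]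
  simp only [Energy.wC_apply, Energy.uC_apply, Energy.gradψC_apply, Energy.vC_apply,
    Energy.ψC_apply, Energy.shearC_apply]
  constructor
  · rw [← inner_smul_right, rho_smul_opB_w, inner_sub_right, inner_smul_right, inner_eigenfn_fracA
      p.L_pos, inner_eigenfn_of_isWeakDeriv p.L_pos n (dx_spec ⟨z.1.shear, shear_mem_dx z⟩)]
    simp only [Energy.shear]
    rw [inner_add_right, ← freq_mul_inner_eigenfn,
      inner_eigenfn_of_isWeakDeriv p.L_pos n (isWeakDeriv_grad z.1.ψ), eigenval_eq]
    push_cast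
    ring
  · rw [← inner_smul_right, rho_smul_opB_v, inner_sub_right, inner_sub_right, inner_neg_right,
      inner_smul_right, inner_smul_right, inner_eigenfn_fracA p.L_pos, inner_eigenfn_lapA p.L_pos]
    ring

theorem summable_sq_of_eq {α β γ δ : ℕ → ℂ} (e : ∀ n, α n = β n + γ n + δ n)
    (hβ : Summable fun n => ‖β n‖ ^ 2) (hγ : Summable fun n => ‖γ n‖ ^ 2)
    (hδ : Summable fun n => ‖δ n‖ ^ 2) : Summable fun n => ‖α n‖ ^ 2 := by
  refine Summable.of_nonneg_of_le (fun n => by positivity) (fun n => ?_)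
    (((hβ.add hγ).add hδ).mul_left 3)
  have h : ‖α n‖ ≤ ‖β n‖ + ‖γ n‖ + ‖δ n‖ := by
    rw [e]
    exact norm_add₃_le
  refine (pow_le_pow_left₀ (norm_nonneg _) h 2).trans ?_
  nlinarith [sq_nonneg (‖β n‖ - ‖γ n‖), sq_nonneg (‖β n‖ - ‖δ n‖), sq_nonneg (‖γ n‖ - ‖δ n‖)]

theorem summable_mul_inner_eigenfn {L : ℝ} (hL : 0 < L) (c : ℂ) (f : L2 L) :
    Summable fun n => ‖c * inner ℂ (eigenfn L n) f‖ ^ 2 := by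
  simp only [norm_mul, mul_pow]
  exact ((orthonormal_eigenfn hL).inner_products_summable (x := f)).mul_left _

theorem summable_mul_eigenval {L : ℝ} (hL : 0 < L) (c : ℂ) {f : L2 L}
    (h : Summable fun n => (eigenval L n * ‖inner ℂ (eigenfn L n) f‖) ^ 2) :
    Summable fun n => ‖c * eigenval L n * inner ℂ (eigenfn L n) f‖ ^ 2 := by
  refine (h.mul_left (‖c‖ ^ 2)).congr fun n => ?_
  rw [norm_mul, norm_mul, Complex.norm_real, Real.norm_of_nonneg (eigenval_pos hL n).le]
  ring

theorem mem_fracA_of_summable {L : ℝ} (hL : 0 < L) {θ : ℝ} {f : L2 L}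
    (h : Summable fun n => ‖((eigenval L n ^ θ : ℝ) : ℂ) * inner ℂ (eigenfn L n) f‖ ^ 2) :
    f ∈ (fracA L θ).domain := by
  rw [mem_fracA_iff hL]
  refine h.congr fun n => ?_
  rw [norm_mul, Complex.norm_real, Real.norm_of_nonneg (Real.rpow_nonneg (eigenval_pos hL n).le _)]

/-- For U in the domain of the closure only u, ψ ∈ D(A) is at stake: w and v equal components of F,
hence lie in H¹₀, and the equation of the modes makes λₙ^τ wₙ and λₙ^σ vₙ square summable. -/
theorem mem_domB_of_summable {U F : Energy p} (h : (U, F) ∈ (opB p τ σ).graph.topologicalClosure)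
    (hu : Summable fun n => (eigenval p.L n * ‖inner ℂ (eigenfn p.L n) (U.u : L2 p.L)‖) ^ 2)
    (hψ : Summable fun n => (eigenval p.L n * ‖inner ℂ (eigenfn p.L n) (U.ψ : L2 p.L)‖) ^ 2) :
    U ∈ domB p τ σ := by
  obtain ⟨h1, h2⟩ := closure_graph_u h
  refine ⟨mem_lapA_of_summable p.L_pos _ hu, ⟨h1 ▸ F.u.2, mem_fracA_of_summable p.L_pos ?_⟩,
    mem_lapA_of_summable p.L_pos _ hψ, h2 ▸ F.ψ.2, mem_fracA_of_summable p.L_pos ?_⟩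
  · refine summable_sq_of_eq (fun n => ?_) (summable_mul_inner_eigenfn p.L_pos (-p.ρ₁) F.w)
      (summable_mul_eigenval p.L_pos (-p.κ) hu)
      (summable_mul_inner_eigenfn p.L_pos p.κ (grad p.L U.ψ))
    linear_combination (closure_graph_modes h n).1
  · refine summable_sq_of_eq (fun n => ?_) (summable_mul_inner_eigenfn p.L_pos (-p.ρ₂) F.v)
      (summable_mul_eigenval p.L_pos (-p.b) hψ)
      (summable_mul_inner_eigenfn p.L_pos (-p.κ) U.shear)
    linear_combination (closure_graph_modes h n).2

end Operator

/-! ### Invariance of the domain under the semigroup -/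

/-- An energy estimate for damped oscillators `ρ aₙ'' + dₙ aₙ' + κ λₙ aₙ = fₙ`, uniform in `n`. -/
theorem summable_of_damped_oscillators {ρ κ G T : ℝ} {lam d : ℕ → ℝ} {a w z f f' : ℕ → ℝ → ℂ}
    (hκ : 0 < κ) (hρ : 0 < ρ) (hT : 0 ≤ T) (hlam : ∀ n, 0 < lam n) (hd : ∀ n, 0 ≤ d n)
    (ha : ∀ n t, 0 ≤ t → HasDerivWithinAt (a n) (w n t) (Ici 0) t)
    (hw : ∀ n t, 0 ≤ t → HasDerivWithinAt (w n) (z n t) (Ici 0) t)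
    (hf : ∀ n t, 0 ≤ t → HasDerivWithinAt (f n) (f' n t) (Ici 0) t)
    (hz : ∀ n t, 0 ≤ t → ρ * z n t = -(κ * lam n * a n t) + f n t - d n * w n t)
    (hG : ∀ N t, 0 ≤ t → ∑ n ∈ Finset.range N, ‖f n t‖ ^ 2 ≤ G)
    (hG' : ∀ N t, 0 ≤ t → ∑ n ∈ Finset.range N, ‖f' n t‖ ^ 2 ≤ G)
    (ha0 : Summable fun n => (lam n * ‖a n 0‖) ^ 2) (hw0 : Summable fun n => lam n * ‖w n 0‖ ^ 2) :
    Summable fun n => (lam n * ‖a n T‖) ^ 2 := by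
  -- The oscillator energy times λₙ, corrected by the forcing: the last term trades ⟨f, w⟩ for ⟨f',
  -- a⟩ in the derivative, since λₙ‖a‖ is controlled by Φ while the forcing term λₙ⟨f, w⟩ is not.
  let Φ : ℕ → ℝ → ℝ := fun n t => ρ * lam n / 2 * ‖w n t‖ ^ 2 + κ * lam n ^ 2 / 2 * ‖a n t‖ ^ 2
    - lam n * inner ℝ (f n t) (a n t)
  let Φ' : ℕ → ℝ → ℝ := fun n t => -(lam n * d n * ‖w n t‖ ^ 2) - lam n * inner ℝ (f' n t) (a n t)
  have hΦ : ∀ n t, 0 ≤ t → HasDerivWithinAt (Φ n) (Φ' n t) (Ici 0) t := by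
    intro n t ht
    have h1 := ((((hw n t ht).norm_sq).const_mul (ρ * lam n / 2)).add
      (((ha n t ht).norm_sq).const_mul (κ * lam n ^ 2 / 2))).sub
      (((hf n t ht).inner ℝ (ha n t ht)).const_mul (lam n))
    refine h1.congr_deriv ?_
    have hz' : ρ * inner ℝ (w n t) (z n t) = -(κ * lam n * inner ℝ (a n t) (w n t))
        + inner ℝ (f n t) (w n t) - d n * ‖w n t‖ ^ 2 := by
      have e1 : ρ * inner ℝ (w n t) (z n t) = inner ℝ (w n t) ((ρ : ℂ) * z n t) := by
        rw [← Complex.real_smul, inner_smul_right]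
      have e2 : -((κ : ℂ) * lam n * a n t) + f n t - d n * w n t
          = -((κ * lam n : ℝ) • a n t) + f n t - (d n : ℝ) • w n t := by
        simp only [Complex.real_smul]
        push_cast
        rfl
      rw [e1, hz n t ht, e2, inner_sub_right, inner_add_right, inner_neg_right, inner_smul_right,
        inner_smul_right, real_inner_self_eq_norm_sq, real_inner_comm (a n t) (w n t),
        real_inner_comm (f n t) (w n t)]
    simp only [Φ']
    linear_combination lam n * hz'
  -- Young's inequality spends half of κλₙ²‖a‖²/2 on the correction term.
  have hlow : ∀ n t, κ / 4 * (lam n * ‖a n t‖) ^ 2 - ‖f n t‖ ^ 2 / κ ≤ Φ n t := by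
    intro n t
    have h1 := real_inner_le_norm (f n t) (a n t)
    have h2 : lam n * inner ℝ (f n t) (a n t) ≤ lam n * (‖f n t‖ * ‖a n t‖) :=
      mul_le_mul_of_nonneg_left h1 (hlam n).le
    have h3 : lam n * (‖f n t‖ * ‖a n t‖) ≤ κ / 4 * (lam n * ‖a n t‖) ^ 2 + ‖f n t‖ ^ 2 / κ := by
      have : κ / 4 * (lam n * ‖a n t‖) ^ 2 + ‖f n t‖ ^ 2 / κ - lam n * (‖f n t‖ * ‖a n t‖)
          = (κ / 2 * (lam n * ‖a n t‖) - ‖f n t‖) ^ 2 / κ := by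
        field_simp
        ring
      have h4 : 0 ≤ (κ / 2 * (lam n * ‖a n t‖) - ‖f n t‖) ^ 2 / κ := by positivity
      linarith
    have h4 : 0 ≤ ρ * lam n / 2 * ‖w n t‖ ^ 2 := by
      have := hlam n
      positivity
    simp only [Φ]
    nlinarith
  have hup : ∀ n t, Φ n t ≤ ρ / 2 * (lam n * ‖w n t‖ ^ 2) + κ * (lam n * ‖a n t‖) ^ 2
      + ‖f n t‖ ^ 2 / κ := by
    intro n t
    have h1 := neg_le_of_abs_le (abs_real_inner_le_norm (f n t) (a n t))
    have h2 : -(lam n * inner ℝ (f n t) (a n t)) ≤ lam n * (‖f n t‖ * ‖a n t‖) := by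
      rw [← mul_neg]
      exact mul_le_mul_of_nonneg_left (by linarith) (hlam n).le
    have h3 : lam n * (‖f n t‖ * ‖a n t‖) ≤ κ / 4 * (lam n * ‖a n t‖) ^ 2 + ‖f n t‖ ^ 2 / κ := by
      have : κ / 4 * (lam n * ‖a n t‖) ^ 2 + ‖f n t‖ ^ 2 / κ - lam n * (‖f n t‖ * ‖a n t‖)
          = (κ / 2 * (lam n * ‖a n t‖) - ‖f n t‖) ^ 2 / κ := by
        field_simp
        ring
      have h4 : 0 ≤ (κ / 2 * (lam n * ‖a n t‖) - ‖f n t‖) ^ 2 / κ := by positivity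
      linarith
    have h4 : 0 ≤ κ / 4 * (lam n * ‖a n t‖) ^ 2 := by positivity
    simp only [Φ]
    nlinarith
  -- The damping contributes with a favourable sign and is dropped, so the estimate is uniform in
  -- the size of d.
  have hder : ∀ n t, Φ' n t ≤ Φ n t + (‖f n t‖ ^ 2 / κ + ‖f' n t‖ ^ 2 / κ) := by
    intro n t
    have h1 := neg_le_of_abs_le (abs_real_inner_le_norm (f' n t) (a n t))
    have h2 : -(lam n * inner ℝ (f' n t) (a n t)) ≤ lam n * (‖f' n t‖ * ‖a n t‖) := by
      rw [← mul_neg]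
      exact mul_le_mul_of_nonneg_left (by linarith) (hlam n).le
    have h3 : lam n * (‖f' n t‖ * ‖a n t‖) ≤ κ / 4 * (lam n * ‖a n t‖) ^ 2 + ‖f' n t‖ ^ 2 / κ := by
      have : κ / 4 * (lam n * ‖a n t‖) ^ 2 + ‖f' n t‖ ^ 2 / κ - lam n * (‖f' n t‖ * ‖a n t‖)
          = (κ / 2 * (lam n * ‖a n t‖) - ‖f' n t‖) ^ 2 / κ := by
        field_simp
        ring
      have h4 : 0 ≤ (κ / 2 * (lam n * ‖a n t‖) - ‖f' n t‖) ^ 2 / κ := by positivity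
      linarith
    have h4 : 0 ≤ lam n * d n * ‖w n t‖ ^ 2 :=
      mul_nonneg (mul_nonneg (hlam n).le (hd n)) (by positivity)
    have h5 := hlow n t
    simp only [Φ']
    linarith
  -- Grönwall for the partial sums
  have hsum : ∀ N, ∑ n ∈ Finset.range N, Φ n T + 2 * G / κ
      ≤ Real.exp T * (∑ n ∈ Finset.range N, Φ n 0 + 2 * G / κ) := by
    intro N
    let Ψ : ℝ → ℝ := fun t => Real.exp (-t) * (∑ n ∈ Finset.range N, Φ n t + 2 * G / κ)
    have hΨ : ∀ t, 0 ≤ t → HasDerivWithinAt Ψ (-Real.exp (-t) *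
        (∑ n ∈ Finset.range N, Φ n t + 2 * G / κ)
        + Real.exp (-t) * ∑ n ∈ Finset.range N, Φ' n t) (Ici 0) t := by
      intro t ht
      have e1 : HasDerivWithinAt (fun t : ℝ => Real.exp (-t)) (-Real.exp (-t)) (Ici 0) t := by
        have := ((hasDerivAt_id t).neg.exp).hasDerivWithinAt (s := Ici 0)
        simpa using! this
      exact e1.mul ((HasDerivWithinAt.fun_sum fun n _ => hΦ n t ht).add_const _)
    have hanti : AntitoneOn Ψ (Ici 0) := by
      refine antitoneOn_of_deriv_nonpos (convex_Ici 0)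
        (fun t ht => (hΨ t ht).continuousWithinAt) (fun t ht => ?_) fun t ht => ?_
      · rw [interior_Ici] at ht ⊢
        exact ((hΨ t (le_of_lt ht)).differentiableWithinAt).mono Ioi_subset_Ici_self
      · rw [interior_Ici] at ht
        have ht' : 0 ≤ t := le_of_lt ht
        rw [((hΨ t ht').hasDerivAt (Ici_mem_nhds ht)).deriv]
        have k1 : ∑ n ∈ Finset.range N, Φ' n t ≤ ∑ n ∈ Finset.range N, Φ n t + 2 * G / κ := by
          refine (Finset.sum_le_sum fun n _ => hder n t).trans ?_
          rw [Finset.sum_add_distrib, Finset.sum_add_distrib, ← Finset.sum_div, ← Finset.sum_div]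
          have k2 := div_le_div_of_nonneg_right (hG N t ht') hκ.le
          have k3 := div_le_div_of_nonneg_right (hG' N t ht') hκ.le
          have k4 : 2 * G / κ = G / κ + G / κ := by ring
          linarith
        have k5 := mul_le_mul_of_nonneg_left k1 (Real.exp_pos (-t)).le
        linarith
    have h0 := hanti (mem_Ici.2 le_rfl) hT hT
    simp only [Ψ, neg_zero, Real.exp_zero, one_mul] at h0
    have h1 := mul_le_mul_of_nonneg_left h0 (Real.exp_pos T).le
    rwa [← mul_assoc, ← Real.exp_add, add_neg_cancel, Real.exp_zero, one_mul] at h1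
  have hinit := (hw0.mul_left (ρ / 2)).add (ha0.mul_left κ)
  -- The bound is uniform in N: the lower bound at T, then Grönwall, then the upper bound at time 0,
  -- where the initial data are summable.
  refine summable_of_sum_range_le (c := 4 / κ * (Real.exp T * (∑' n, (ρ / 2 * (lam n * ‖w n 0‖ ^ 2)
    + κ * (lam n * ‖a n 0‖) ^ 2) + G / κ + 2 * G / κ))) (fun n => by positivity) fun N => ?_
  have b1 : ∑ n ∈ Finset.range N, Φ n 0 ≤ ∑' n, (ρ / 2 * (lam n * ‖w n 0‖ ^ 2)
      + κ * (lam n * ‖a n 0‖) ^ 2) + G / κ := by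
    refine (Finset.sum_le_sum fun n _ => hup n 0).trans ?_
    rw [Finset.sum_add_distrib, ← Finset.sum_div]
    refine add_le_add (hinit.sum_le_tsum _ fun n _ => ?_)
      (div_le_div_of_nonneg_right (hG N 0 le_rfl) hκ.le)
    have := hlam n
    positivity
  have b2 : κ / 4 * ∑ n ∈ Finset.range N, (lam n * ‖a n T‖) ^ 2
      ≤ ∑ n ∈ Finset.range N, Φ n T + 2 * G / κ := by
    have k1 := Finset.sum_le_sum fun n (_ : n ∈ Finset.range N) => hlow n T
    rw [Finset.sum_sub_distrib, ← Finset.mul_sum, ← Finset.sum_div] at k1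
    have k2 := div_le_div_of_nonneg_right (hG N T hT) hκ.le
    have k3 : 0 ≤ G / κ := div_nonneg ((Finset.sum_nonneg fun n _ => by positivity).trans (hG N T hT))
      hκ.le
    have k4 : 2 * G / κ = G / κ + G / κ := by ring
    linarith
  have b3 := b2.trans ((hsum N).trans (mul_le_mul_of_nonneg_left
    (add_le_add_left b1 (2 * G / κ)) (Real.exp_pos T).le))
  have b4 := mul_le_mul_of_nonneg_left b3 (show 0 ≤ 4 / κ by positivity)
  have b5 : 4 / κ * (κ / 4 * ∑ n ∈ Finset.range N, (lam n * ‖a n T‖) ^ 2)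
      = ∑ n ∈ Finset.range N, (lam n * ‖a n T‖) ^ 2 := by
    field_simp
  rwa [b5] at b4

section Invariance

variable {p : Beam} {τ σ : ℝ} {S : ContractionSemigroup (Energy p)}

theorem ContractionSemigroup.norm_apply_le {E : Type*} [NormedAddCommGroup E] [NormedSpace ℂ E]
    (S : ContractionSemigroup E) (t : ℝ≥0) (x : E) : ‖S.toFun t x‖ ≤ ‖x‖ := by
  simpa using (S.toFun t).le_of_opNorm_le (S.norm_le_one t) x

theorem sum_inner_orbit_le {v : ℕ → L2 p.L} (hv : Orthonormal ℂ v) (c : ℂ) (D : Energy p →L[ℂ] L2 p.L)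
    (x : Energy p) (t : ℝ≥0) (N : ℕ) :
    ∑ n ∈ Finset.range N, ‖c * inner ℂ (v n) (D (S.toFun t x))‖ ^ 2 ≤ (‖c‖ * (‖D‖ * ‖x‖)) ^ 2 := by
  simp only [norm_mul, mul_pow ‖c‖]
  rw [← Finset.mul_sum]
  refine mul_le_mul_of_nonneg_left ?_ (by positivity)
  refine (hv.sum_inner_products_le _).trans (pow_le_pow_left₀ (norm_nonneg _) ?_ 2)
  exact (D.le_opNorm _).trans (mul_le_mul_of_nonneg_left (S.norm_apply_le t x) (norm_nonneg _))

theorem hasDerivWithinAt_inner {D : Energy p →L[ℂ] L2 p.L} {U : ℝ → Energy p} {U' : Energy p} {t : ℝ}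
    {s : Set ℝ} (h : HasDerivWithinAt U U' s t) (c : ℂ) (e : L2 p.L) :
    HasDerivWithinAt (fun t => c * inner ℂ e (D (U t))) (c * inner ℂ e (D U')) s t :=
  ((c • (innerSL ℂ e).comp D).restrictScalars ℝ).hasFDerivAt.comp_hasDerivWithinAt t h

theorem summable_eigenval_mul_inner {u : L2 p.L} (hu : u ∈ (lapA p.L).domain) :
    Summable fun n => (eigenval p.L n * ‖inner ℂ (eigenfn p.L n) u‖) ^ 2 := by
  refine ((orthonormal_eigenfn p.L_pos).inner_products_summable (x := lapA p.L ⟨u, hu⟩)).congr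
    fun n => ?_
  rw [inner_eigenfn_lapA p.L_pos, norm_mul, Complex.norm_real,
    Real.norm_of_nonneg (eigenval_pos p.L_pos n).le]

/-- Supplies the initial bound on the weighted kinetic energy, finite because the velocities in D(B)
lie in H¹₀. -/
theorem summable_eigenval_mul_inner_sq (w : H10 p.L) :
    Summable fun n => eigenval p.L n * ‖inner ℂ (eigenfn p.L n) (w : L2 p.L)‖ ^ 2 := by
  refine ((orthonormal_cosine p.L_pos).inner_products_summable (x := grad p.L w)).congr fun n => ?_
  rw [← freq_mul_norm_inner p.L_pos, mul_pow, eigenval_eq]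

/-- The semigroup leaves the domain of `B` invariant. -/
theorem semigroup_mem_domB
    (hcl : ∀ t x y, (x, y) ∈ (opB p τ σ).graph.topologicalClosure →
      (S.toFun t x, S.toFun t y) ∈ (opB p τ σ).graph.topologicalClosure)
    (hder : ∀ {x y : Energy p} {t : ℝ}, (x, y) ∈ (opB p τ σ).graph.topologicalClosure → 0 ≤ t →
      HasDerivWithinAt (fun t : ℝ => S.toFun t.toNNReal x) (S.toFun t.toNNReal y) (Ici 0) t)
    (U : domB p τ σ) (t : ℝ≥0) : S.toFun t U ∈ domB p τ σ := by
  set F : Energy p := opB p τ σ U with hF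
  have hg : ((U : Energy p), F) ∈ (opB p τ σ).graph.topologicalClosure :=
    Submodule.le_topologicalClosure _ ((opB p τ σ).mem_graph U)
  have hs := fun t => hcl t _ _ hg
  have ho := orthonormal_eigenfn p.L_pos
  have h0 : S.toFun (0 : ℝ).toNNReal U = U := by
    rw [Real.toNNReal_zero, S.map_zero]
    rfl
  have hd1 : ∀ (n : ℕ) (t : ℝ), 0 ≤ t → HasDerivWithinAt
      (fun t : ℝ => 1 * inner ℂ (eigenfn p.L n) (Energy.uC p (S.toFun t.toNNReal U)))
      (1 * inner ℂ (eigenfn p.L n) (Energy.uC p (S.toFun t.toNNReal F))) (Ici 0) t :=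
    fun n t ht => hasDerivWithinAt_inner (hder hg ht) 1 _
  have hd2 : ∀ (n : ℕ) (t : ℝ), 0 ≤ t → HasDerivWithinAt
      (fun t : ℝ => 1 * inner ℂ (eigenfn p.L n) (Energy.ψC p (S.toFun t.toNNReal U)))
      (1 * inner ℂ (eigenfn p.L n) (Energy.ψC p (S.toFun t.toNNReal F))) (Ici 0) t :=
    fun n t ht => hasDerivWithinAt_inner (hder hg ht) 1 _
  have hd3 : ∀ (n : ℕ) (t : ℝ), 0 ≤ t → HasDerivWithinAt
      (fun t : ℝ => 1 * inner ℂ (eigenfn p.L n) (Energy.wC p (S.toFun t.toNNReal U)))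
      (1 * inner ℂ (eigenfn p.L n) (Energy.wC p (S.toFun t.toNNReal F))) (Ici 0) t :=
    fun n t ht => hasDerivWithinAt_inner (hder hg ht) 1 _
  have hd4 : ∀ (n : ℕ) (t : ℝ), 0 ≤ t → HasDerivWithinAt
      (fun t : ℝ => 1 * inner ℂ (eigenfn p.L n) (Energy.vC p (S.toFun t.toNNReal U)))
      (1 * inner ℂ (eigenfn p.L n) (Energy.vC p (S.toFun t.toNNReal F))) (Ici 0) t :=
    fun n t ht => hasDerivWithinAt_inner (hder hg ht) 1 _
  have huw : ∀ r : ℝ≥0, Energy.uC p (S.toFun r F) = Energy.wC p (S.toFun r U) :=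
    fun r => (closure_graph_u (hs r)).1
  have hψv : ∀ r : ℝ≥0, Energy.ψC p (S.toFun r F) = Energy.vC p (S.toFun r U) :=
    fun r => (closure_graph_u (hs r)).2
  simp only [huw, hψv, one_mul] at hd1 hd2 hd3 hd4
  have hpow : ∀ (θ : ℝ) n, 0 ≤ eigenval p.L n ^ θ :=
    fun θ n => Real.rpow_nonneg (eigenval_pos p.L_pos n).le _
  refine mem_domB_of_summable (hs t) ?_ ?_
  -- The forcing is κψ_x, differentiable in L² since ψ' = v along the orbit with v in H¹₀. The
  -- constant G adds the Bessel bounds for the forcing and its derivative, so that it serves both.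
  · have := summable_of_damped_oscillators (T := (t : ℝ)) p.κ_pos p.ρ₁_pos t.2 (eigenval_pos p.L_pos)
      (hpow τ) hd1 hd3 (fun n t ht => hasDerivWithinAt_inner (D := Energy.gradψC p) (hder hg ht)
        (p.κ : ℂ) (eigenfn p.L n)) (fun n t ht => ?_)
      (G := (‖(p.κ : ℂ)‖ * (‖Energy.gradψC p‖ * ‖(U : Energy p)‖)) ^ 2
        + (‖(p.κ : ℂ)‖ * (‖Energy.gradψC p‖ * ‖F‖)) ^ 2)
      (fun N t _ => (sum_inner_orbit_le ho _ _ _ _ N).trans (le_add_of_nonneg_right (by positivity)))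
      (fun N t _ => (sum_inner_orbit_le ho _ _ _ _ N).trans (le_add_of_nonneg_left (by positivity)))
      ?_ ?_
    · simpa only [Real.toNNReal_coe, Energy.uC_apply] using this
    · exact (closure_graph_modes (hs t.toNNReal) n).1
    · simp only [h0]
      exact summable_eigenval_mul_inner U.2.1
    · simp only [h0]
      exact summable_eigenval_mul_inner_sq ⟨U.1.w, U.2.2.1.1⟩
  -- The same estimate for ψ, with stiffness b and forcing -κ(u_x + ψ).
  · have := summable_of_damped_oscillators (T := (t : ℝ)) p.b_pos p.ρ₂_pos t.2 (eigenval_pos p.L_pos)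
      (hpow σ) hd2 hd4 (fun n t ht => hasDerivWithinAt_inner (D := Energy.shearC p) (hder hg ht)
        (-(p.κ : ℂ)) (eigenfn p.L n)) (fun n t ht => ?_)
      (G := (‖-(p.κ : ℂ)‖ * (‖Energy.shearC p‖ * ‖(U : Energy p)‖)) ^ 2
        + (‖-(p.κ : ℂ)‖ * (‖Energy.shearC p‖ * ‖F‖)) ^ 2)
      (fun N t _ => (sum_inner_orbit_le ho _ _ _ _ N).trans (le_add_of_nonneg_right (by positivity)))
      (fun N t _ => (sum_inner_orbit_le ho _ _ _ _ N).trans (le_add_of_nonneg_left (by positivity)))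
      ?_ ?_
    · simpa only [Real.toNNReal_coe, Energy.ψC_apply] using this
    · have := (closure_graph_modes (hs t.toNNReal) n).2
      rw [neg_mul, ← sub_eq_add_neg]
      exact this
    · simp only [h0]
      exact summable_eigenval_mul_inner U.2.2.2.1
    · simp only [h0]
      exact summable_eigenval_mul_inner_sq ⟨U.1.v, U.2.2.2.2.1⟩

end Invariance

end Timoshenko

end

/-! ### Assembly of the three assertions. -/

theorem theorem2 (p : Timoshenko.Beam) (τ σ : ℝ) (hτ : τ ∈ Set.Icc (0 : ℝ) 1)
    (hσ : σ ∈ Set.Icc (0 : ℝ) 1) :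
    Dense ((Timoshenko.opB p τ σ).domain : Set (Timoshenko.Energy p)) ∧
    Timoshenko.IsDissipative (Timoshenko.opB p τ σ) ∧
    (Timoshenko.opB p τ σ).IsClosable ∧
    (τ ≤ 1 / 2 → σ ≤ 1 / 2 → (Timoshenko.opB p τ σ).closure = Timoshenko.opB p τ σ) ∧
    Timoshenko.InResolventSet (Timoshenko.opB p τ σ).closure 0 ∧
    ∃ S : Timoshenko.ContractionSemigroup (Timoshenko.Energy p),
      Timoshenko.IsGenerator (Timoshenko.opB p τ σ).closure S ∧
      ∀ U₀ : Timoshenko.Energy p, ∃ U : ℝ → Timoshenko.Energy p,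
        (∀ t : ℝ≥0, U t = S.toFun t U₀) ∧
        Timoshenko.IsWeakSolution (Timoshenko.opB p τ σ) U₀ U ∧
        (∀ U' : ℝ → Timoshenko.Energy p,
          Timoshenko.IsWeakSolution (Timoshenko.opB p τ σ) U₀ U' → ∀ t : ℝ, 0 ≤ t → U' t = U t) ∧
        ∀ k : ℕ,
          (U₀ ∈ (Timoshenko.ppow (Timoshenko.opB p τ σ) k).domain →
            ∀ j ≤ k, Timoshenko.IsCmInto (Timoshenko.opB p τ σ) (k - j) j U) ∧
          (U₀ ∈ (Timoshenko.ppow (Timoshenko.opB p τ σ).closure k).domain →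
            ∀ j ≤ k, Timoshenko.IsCmInto (Timoshenko.opB p τ σ).closure (k - j) j U) := by
  set B := Timoshenko.opB p τ σ with hB
  have hd : Dense (B.domain : Set (Timoshenko.Energy p)) := Timoshenko.dense_domB hτ.2 hσ.2
  have hdis : Timoshenko.IsDissipative B := Timoshenko.isDissipative_opB
  have hr : DenseRange B := Timoshenko.denseRange_opB hτ.2 hσ.2
  obtain ⟨K, hK⟩ := Timoshenko.exists_opB_lower_bound (p := p) hτ.2 hσ.2
  obtain ⟨R, hR⟩ := Timoshenko.exists_neg_inverse hK hr
  have hA := Timoshenko.isAccretive_of_neg_inverse hdis hr hR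
  have hdR := Timoshenko.denseRange_of_neg_inverse hd hR
  have hcl := Timoshenko.closure_graph_of_neg_inverse hr hR
  have hclos := Timoshenko.isClosable_of_neg_inverse hA hdR hr hR
  have hC : ∀ x y, (x, y) ∈ B.closure.graph ↔ R y = -x := by
    rw [← hclos.graph_closure_eq_closure_graph]
    exact hcl
  obtain ⟨S, hSR, hS⟩ := hA.exists_semigroup hdR
  have hinv : ∀ t x y, (x, y) ∈ B.graph.topologicalClosure →
      (S.toFun t x, S.toFun t y) ∈ B.graph.topologicalClosure := by
    intro t x y h
    rw [hcl] at h ⊢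
    rw [hSR, h, map_neg]
  have hder : ∀ {x y : Timoshenko.Energy p} {t : ℝ}, (x, y) ∈ B.graph.topologicalClosure → 0 ≤ t →
      HasDerivWithinAt (fun t : ℝ => S.toFun t.toNNReal x) (S.toFun t.toNNReal y) (Set.Ici 0) t :=
    fun h ht => Timoshenko.hasDerivWithinAt_orbit hS ((hcl _ _).1 h) ht
  have hle : ∀ {x y : Timoshenko.Energy p}, (x, y) ∈ B.graph → (x, y) ∈ B.graph.topologicalClosure :=
    fun h => Submodule.le_topologicalClosure _ h
  refine ⟨hd, hdis, hclos, fun h1 h2 => ?_, Timoshenko.inResolventSet_zero hC, S,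
    Timoshenko.isGenerator_of_neg_inverse hC hSR hS, fun U₀ => ⟨fun t => S.toFun t.toNNReal U₀,
    fun t => by simp only [Real.toNNReal_coe], Timoshenko.isWeakSolution_orbit hd hcl hSR hS U₀,
    fun U' hU' t ht => (Timoshenko.isWeakSolution_orbit hd hcl hSR hS U₀).unique hd hA hdR hR hU' ht,
    fun k => ⟨fun hU j hj => Timoshenko.isCmInto_orbit ?_ (fun h ht => hder (hle h) ht) hU hj,
      fun hU j hj => Timoshenko.isCmInto_orbit ?_ ?_ hU hj⟩⟩⟩
  -- By surjectivity y = BU; a pair (x, BU) of the closure has x = -R B U = U, so it already lies in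
  -- the graph of B.
  · refine LinearPMap.eq_of_eq_graph (le_antisymm ?_ ?_)
    · rintro ⟨x, y⟩ h
      obtain ⟨U, rfl⟩ := Timoshenko.surjective_opB (p := p) h1 h2 y
      have := (hC _ _).1 h
      rw [hR, neg_inj] at this
      rw [← this]
      exact B.mem_graph U
    · exact LinearPMap.le_graph_of_le B.le_closure
  · intro t x y h
    have h1 := hinv t _ _ (hle h)
    obtain ⟨z, rfl, rfl⟩ := (LinearPMap.mem_graph_iff _).1 h
    have hm := Timoshenko.semigroup_mem_domB hinv hder z t
    have h2 := hle (B.mem_graph ⟨_, hm⟩)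
    -- Both values are paired with S(t)z in the closed graph, and R is injective.
    have e : B ⟨_, hm⟩ = S.toFun t (B z) := by
      rw [hcl] at h1 h2
      refine sub_eq_zero.1 (hA.injective hdR ?_)
      rw [map_sub, h1, h2, sub_self]
    rw [← e]
    exact B.mem_graph ⟨_, hm⟩
  · rw [← hclos.graph_closure_eq_closure_graph]
    exact hinv
  · intro x y t h ht
    rw [← hclos.graph_closure_eq_closure_graph] at h
    exact hder h ht
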